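/- Let $P$ be a finite set of points in the Euclidean plane and let $S$ be a set of line segments, called constraints, each joining two distinct points of $P$, such that no two constraints intersect properly (in a point interior to both). Points $u\neq v$ of $P$ can see each other if $uv$ is a constraint or $uv$ does not properly intersect any constraint; the visibility graph $\mathrm{Vis}(P,S)$ has vertex set $P$ and all pairs that can see each other as edges. Edges are weighted by Euclidean length and $d_G$ denotes the weighted shortest-path distance in a graph $G$. A subgraph $H$ of $G$ on the same vertices is a $t$-spanner of $G$ if $d_H(u,v)\le t\,d_G(u,v)$ for all vertices $u,v$. Let $k\ge 1$ be an integer and $\theta=2\pi/(4k+2)$. For each point $u$, divide the plane into $4k+2$ cones $C_0^u,\dots,C_{4k+1}^u$ of aperture $\theta$ with apex $u$, numbered clockwise, where the bisector of $C_0^u$ is the upward vertical ray from $u$. Each cone $C_i^u$ is divided into closed subcones by the rays from $u$ along the constraints that have $u$ as an endpoint and whose other endpoint lies in $C_i^u$ (that endpoint belongs to both adjacent subcones; an undivided cone is a single subcone). The constrained $\theta$-graph of $(P,S)$ with $4k+2$ cones has vertex set $P$ and has, for every $u\in P$ and every subcone of every cone $C_i^u$, an edge from $u$ to the point of $P$ in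 that subcone that can see $u$ and whose projection on the bisector of the whole cone $C_i^u$ is closest to $u$ (if there is such a point). The set $P$ is in general position if no two of its points lie on a line parallel to one of the rays bounding the cones, no two lie on a line perpendicular to the bisector of a cone, and no three are collinear. Then for every finite $P$ in general position and every such $S$, the constrained $\theta$-graph of $(P,S)$ with $4k+2$ cones is a $(1+2\sin(\theta/2))$-spanner of $\mathrm{Vis}(P,S)$. This ratio is tight: for every real $t<1+2\sin(\theta/2)$ there is a finite point set $P$ in general position such that, already for $S=\emptyset$, the constrained $\theta$-graph with $4k+2$ cones is not a $t$-spanner of $\mathrm{Vis}(P,S)$. -/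

import Mathlib

open Complex (I)
open scoped Real

noncomputable section

namespace ConstrainedTheta

/-! The Euclidean plane is `ℂ`, with its usual distance. The vertical direction is `I`.
A finite point set is `P : Finset ℂ`. A set of segments between two (distinct) points of `P` is a
set of unordered pairs of distinct elements of `P`, i.e. the edge set of a `SimpleGraph P`. -/

/-! ### Geometric graphs and spanners -/

/-- Euclidean length of a walk: the sum of the lengths of its edges. -/
def walkLength {P : Finset ℂ} {G : SimpleGraph P} {u v : P} (p : G.Walk u v) : ℝ :=
  (p.darts.map fun d => dist (d.fst : ℂ) (d.snd : ℂ)).sum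

/-- Weighted shortest-path distance in `G` (`∞` if there is no path). -/
def graphDist {P : Finset ℂ} (G : SimpleGraph P) (u v : P) : ENNReal :=
  ⨅ p : G.Walk u v, ENNReal.ofReal (walkLength p)

/-- `H` is a `t`-spanner of `G`: it is a subgraph of `G` with the same vertices, and distances in
`H` are at most `t` times the distances in `G`. -/
def IsSpanner {P : Finset ℂ} (t : ℝ) (H G : SimpleGraph P) : Prop :=
  H ≤ G ∧ ∀ u v : P, graphDist H u v ≤ ENNReal.ofReal t * graphDist G u v

/-! ### Constraints and visibility -/

/-- The segments `ab` and `cd` intersect properly: their relative interiors meet in exactly one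
point. -/
def ProperlyIntersect (a b c d : ℂ) : Prop :=
  ∃ x, openSegment ℝ a b ∩ openSegment ℝ c d = {x}

/-- No two constraints intersect properly. -/
def IsPlanar {P : Finset ℂ} (S : SimpleGraph P) : Prop :=
  ∀ a b c d : P, S.Adj a b → S.Adj c d → ¬ ProperlyIntersect a b c d

theorem properlyIntersect_swap_left {a b c d : ℂ} (h : ProperlyIntersect a b c d) :
    ProperlyIntersect b a c d := by
  obtain ⟨x, hx⟩ := h
  exact ⟨x, by rwa [openSegment_symm ℝ b a]⟩

/-- The visibility graph of `P` with respect to the constraints `S`: distinct `u`, `v` are adjacent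
iff `uv` is a constraint or does not properly intersect any constraint. -/
def visibilityGraph {P : Finset ℂ} (S : SimpleGraph P) : SimpleGraph P where
  Adj u v := u ≠ v ∧ (S.Adj u v ∨ ∀ a b : P, S.Adj a b → ¬ ProperlyIntersect u v a b)
  symm := ⟨fun _ _ h => ⟨h.1.symm, h.2.imp (fun e => e.symm)
    (fun g a b hab hp => g a b hab (properlyIntersect_swap_left hp))⟩⟩
  loopless := ⟨fun _ h => h.1 rfl⟩

/-! ### Cones -/

/-- The aperture `2π/m` of each of the `m` cones. -/
def aperture (m : ℕ) : ℝ := 2 * π / m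

/-- Unit direction of the bisector of the `i`-th cone: the upward vertical direction rotated
clockwise by `i` apertures. -/
def bisectorDir (m : ℕ) (i : Fin m) : ℂ :=
  I * Complex.exp (-((((i : ℕ) : ℝ) * aperture m : ℝ) * I))

/-- Coordinates of `v` in the frame with origin `u` whose positive real axis is the bisector of the
`i`-th cone of `u`. The argument is the signed angle from the bisector to `uv`, and
for `v` in the cone the real part is the distance from `u` to the projection of `v` on the
bisector. -/
def coneCoord (m : ℕ) (i : Fin m) (u v : ℂ) : ℂ := (v - u) / bisectorDir m i

/-- The `i`-th cone with apex `u`. -/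
def cone (m : ℕ) (i : Fin m) (u : ℂ) : Set ℂ :=
  {v | |Complex.arg (coneCoord m i u v)| ≤ aperture m / 2}

/-- The signed angles, from the bisector of the `i`-th cone of `u`, of the rays from `u` delimiting
the subcones: the two boundary rays of the cone, and the rays along the constraints whose one
endpoint is `u` and whose other endpoint lies in this cone. -/
def splitAngles (m : ℕ) {P : Finset ℂ} (S : SimpleGraph P) (i : Fin m) (u : P) : Set ℝ :=
  {-(aperture m / 2), aperture m / 2} ∪
    {φ | ∃ v : P, S.Adj u v ∧ (v : ℂ) ∈ cone m i u ∧ φ = Complex.arg (coneCoord m i u v)}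

/-- The subcones of the `i`-th cone of `u`: the closed regions between two consecutive delimiting
rays. In particular the other endpoint of a constraint splitting the cone lies in both adjacent
subcones, and a cone that is not split is a single subcone. -/
def subcones (m : ℕ) {P : Finset ℂ} (S : SimpleGraph P) (i : Fin m) (u : P) : Set (Set ℂ) :=
  {C | ∃ α ∈ splitAngles m S i u, ∃ β ∈ splitAngles m S i u,
    α < β ∧ (∀ γ ∈ splitAngles m S i u, ¬ (α < γ ∧ γ < β)) ∧
    C = {x | x ∈ cone m i u ∧ Complex.arg (coneCoord m i u x) ∈ Set.Icc α β}}

/-! ### The constrained theta-graph -/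

/-- `v` is a closest vertex, along the bisector of the cone, among the vertices that see `u` in some
subcone of `u`. -/
def ThetaArc (m : ℕ) {P : Finset ℂ} (S : SimpleGraph P) (u v : P) : Prop :=
  (visibilityGraph S).Adj u v ∧
  ∃ i : Fin m, ∃ C ∈ subcones m S i u, (v : ℂ) ∈ C ∧
    ∀ w : P, (w : ℂ) ∈ C → (visibilityGraph S).Adj u w →
      (coneCoord m i u v).re ≤ (coneCoord m i u w).re

/-- The constrained theta-graph with `m` cones. -/
def constrainedThetaGraph (m : ℕ) {P : Finset ℂ} (S : SimpleGraph P) : SimpleGraph P where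
  Adj u v := ThetaArc m S u v ∨ ThetaArc m S v u
  symm := ⟨fun _ _ h => h.symm⟩
  loopless := ⟨fun _ h => h.elim (fun a => a.1.ne rfl) (fun a => a.1.ne rfl)⟩

/-! ### General position -/

/-- No two points lie on a line parallel to one of the rays bounding the cones, no two points lie
on a line perpendicular to the bisector of a cone, and no three points are collinear. -/
structure GeneralPosition (m : ℕ) (P : Finset ℂ) : Prop where
  not_parallel_ray : ∀ p ∈ P, ∀ q ∈ P, p ≠ q → ∀ i : Fin m,
    ((q - p) / (bisectorDir m i * Complex.exp (((aperture m / 2 : ℝ) : ℂ) * I))).im ≠ 0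
  not_perp_bisector : ∀ p ∈ P, ∀ q ∈ P, p ≠ q → ∀ i : Fin m,
    ((q - p) / bisectorDir m i).re ≠ 0
  not_collinear : ∀ p ∈ P, ∀ q ∈ P, ∀ r ∈ P, p ≠ q → p ≠ r → q ≠ r →
    ¬ Collinear ℝ {p, q, r}

end ConstrainedTheta

end

/-! Write y = θ/2. Draw a cone in its frame with the bisector, the real axis, pointing up and the
imaginary axis pointing right. Then real parts are heights, and `0 < det a b` says that b lies to
the right of a as seen from the apex. The canonical triangle of a visible pair u, w is cut off from
the cone of u containing w by the perpendicular to the bisector through w. If w has coordinates (re,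
im), the walk from u along the left side to the corner and then along the top to w has length κ·re +
im, where κ = (1 + sin y)/cos y. The longer of the left and right walks has length κ·re + |im|,
which is at most (1 + 2 sin y)·|uw| (`cost_le_stretch`). So it suffices to bound graph distances of
visible pairs by κ·re + |im|. The induction also needs a signed bound: κ·re + im suffices when no
vertex seen by u lies in the triangle to the right of w (`PathBound`).

The induction is on the height of w (`pathBound`). Let v₀ be the lowest vertex seen by u that no
constraint separates from w, so that u has an arc to v₀. If v₀ ≠ w, a reflection puts v₀ to the left
of w. The vertices of this region that are not to the right of w have a lower hull running from v₀
to w. The triangle spanned by u and a hull edge is empty, so the ends of the edge see each other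
(`triangle_empty`, `sees_of_triangle_empty`). In its own cone the edge has smaller height than w
(`rot_re_sub_lt`), so the induction hypothesis applies to it. `hullEdge_cost` turns this into κ·Δre
+ Δim, plus a correction when the edge leans left and the right side is not clear, and these costs
telescope along the hull (`hull_induction`, `pathBound_of_arc_left`). The signed bound for an edge
requires one side of its triangle to be clear. If it were not, a sight line would cross another one,
and `exists_visible_of_crossing` would yield a vertex seen by u below the hull or in the region
assumed clear. With 4k + 2 cones the angle π/2 − y is again a bisector, and measuring the flattest
hull edges from their right end then gives exactly the required cost (`cost_reflect`).

For tightness, place a and b near the two top corners of a canonical triangle at u, with b slightly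
lower, and complete u, a, b to a parallelogram. Its half-turn symmetry rules out the edge ua from
both ends, and the detour has ratio tending to 1 + 2 sin y. -/

/-! ### Planar geometry by determinants -/

namespace ConstrainedTheta

/-- The determinant of two plane vectors. -/
def det (a b : ℂ) : ℝ := a.re * b.im - a.im * b.re

/-- The orientation of a triangle: twice its signed area. -/
def orient (a b c : ℂ) : ℝ := det (b - a) (c - a)

/-- The open segments `ab` and `cd` cross transversally. -/
def Crosses (a b c d : ℂ) : Prop :=
  orient a b c * orient a b d < 0 ∧ orient c d a * orient c d b < 0

theorem det_swap (a b : ℂ) : det a b = -det b a := by simp only [det]; ring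

theorem det_self (a : ℂ) : det a a = 0 := by simp only [det]; ring

theorem det_sub_right (a b c : ℂ) : det a (b - c) = det a b - det a c := by
  simp only [det, Complex.sub_re, Complex.sub_im]; ring

theorem det_sub_left (a b c : ℂ) : det (a - b) c = det a c - det b c := by
  simp only [det, Complex.sub_re, Complex.sub_im]; ring

theorem det_comb_left (x y c : ℂ) (α β : ℝ) :
    det (α • x + β • y) c = α * det x c + β * det y c := by
  simp only [det, Complex.add_re, Complex.add_im, Complex.smul_re, Complex.smul_im, smul_eq_mul]
  ring

theorem det_comb_right (x y c : ℂ) (α β : ℝ) :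
    det c (α • x + β • y) = α * det c x + β * det c y := by
  simp only [det, Complex.add_re, Complex.add_im, Complex.smul_re, Complex.smul_im, smul_eq_mul]
  ring

/-- The Grassmann–Plücker relation. -/
theorem det_pluecker (a b c d : ℂ) :
    det a b * det c d - det a c * det b d + det a d * det b c = 0 := by
  simp only [det]; ring

theorem orient_zero_left (a b : ℂ) : orient 0 a b = det a b := by simp [orient]

theorem orient_zero_right (a b : ℂ) : orient a b 0 = det a b := by
  simp only [orient, det, Complex.sub_re, Complex.sub_im, Complex.zero_re, Complex.zero_im]; ring

theorem orient_rotate (a b c : ℂ) : orient a b c = orient b c a := by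
  simp only [orient, det, Complex.sub_re, Complex.sub_im]; ring

theorem orient_swap (a b c : ℂ) : orient a b c = -orient b a c := by
  simp only [orient, det, Complex.sub_re, Complex.sub_im]; ring

theorem orient_self (a b : ℂ) : orient a b a = 0 := by
  simp only [orient, det, Complex.sub_re, Complex.sub_im]; ring

theorem orient_self_right (a b : ℂ) : orient a b b = 0 := by
  simp only [orient, det, Complex.sub_re, Complex.sub_im]; ring

theorem orient_eq (a b c : ℂ) : orient a b c = det a b + det b c + det c a := by
  simp only [orient, det, Complex.sub_re, Complex.sub_im]; ring

theorem orient_comb (a b x y : ℂ) (α β : ℝ) :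
    orient a b (α • x + β • y) =
      α * orient a b x + β * orient a b y + (1 - α - β) * det a b := by
  simp only [orient, det, Complex.sub_re, Complex.sub_im, Complex.add_re, Complex.add_im,
    Complex.smul_re, Complex.smul_im, smul_eq_mul]
  ring

theorem comb_of_det_ne_zero {a b : ℂ} (h : det a b ≠ 0) (c : ℂ) :
    c = (det c b / det a b) • a + (det a c / det a b) • b := by
  apply Complex.ext
  · simp only [Complex.add_re, Complex.smul_re, smul_eq_mul]
    field_simp
    simp only [det]; ring
  · simp only [Complex.add_im, Complex.smul_im, smul_eq_mul]
    field_simp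
    simp only [det]; ring

/-- The relation `0 < det a b` is transitive in a half-plane. -/
theorem det_pos_trans {a b c : ℂ} (ha : 0 < a.re) (hb : 0 < b.re) (hc : 0 < c.re)
    (hab : 0 < det a b) (hbc : 0 < det b c) : 0 < det a c := by
  have : b.re * det a c = a.re * det b c + c.re * det a b := by simp only [det]; ring
  have h : 0 < b.re * det a c := by rw [this]; positivity
  exact (mul_pos_iff_of_pos_left hb).1 h

/-- Orientation with respect to one segment's line is affine along the other and changes sign; the
parameters ρ and t are its zeros. -/
theorem Crosses.exists_point {u q c d : ℂ} (h : Crosses u q c d) :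
    ∃ ρ t : ℝ, 0 < ρ ∧ ρ < 1 ∧ 0 < t ∧ t < 1 ∧
      (1 - ρ) • u + ρ • q = (1 - t) • c + t • d := by
  obtain ⟨h1, h2⟩ := h
  have key : ∀ {x y : ℝ}, x * y < 0 → x - y ≠ 0 ∧ 0 < x / (x - y) ∧ x / (x - y) < 1 := by
    intro x y hxy
    rcases mul_neg_iff.1 hxy with ⟨hx, hy⟩ | ⟨hx, hy⟩
    · have : 0 < x - y := by linarith
      exact ⟨this.ne', div_pos hx this, (div_lt_one this).2 (by linarith)⟩
    · have : x - y < 0 := by linarith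
      exact ⟨this.ne, div_pos_of_neg_of_neg hx this, (div_lt_one_of_neg this).2 (by linarith)⟩
  obtain ⟨n1, t0, t1⟩ := key h1
  obtain ⟨n2, r0, r1⟩ := key h2
  refine ⟨_, _, r0, r1, t0, t1, ?_⟩
  have e : orient c d u - orient c d q = -(orient u q c - orient u q d) := by
    simp only [orient, det, Complex.sub_re, Complex.sub_im]; ring
  apply Complex.ext
  · simp only [Complex.add_re, Complex.smul_re, smul_eq_mul]
    rw [e] at n2 ⊢
    field_simp
    simp only [orient, det, Complex.sub_re, Complex.sub_im]; ring
  · simp only [Complex.add_im, Complex.smul_im, smul_eq_mul]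
    rw [e] at n2 ⊢
    field_simp
    simp only [orient, det, Complex.sub_re, Complex.sub_im]; ring

theorem orient_convex (a b x y : ℂ) (t : ℝ) :
    orient a b ((1 - t) • x + t • y) = (1 - t) * orient a b x + t * orient a b y := by
  rw [orient_comb]; ring

theorem Crosses.symm_right {a b c d : ℂ} (h : Crosses a b c d) : Crosses a b d c := by
  refine ⟨by rw [mul_comm]; exact h.1, ?_⟩
  rw [orient_swap d c a, orient_swap d c b, neg_mul_neg]; exact h.2

theorem Crosses.symm_left {a b c d : ℂ} (h : Crosses a b c d) : Crosses b a c d := by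
  refine ⟨?_, by rw [mul_comm]; exact h.2⟩
  rw [orient_swap b a c, orient_swap b a d, neg_mul_neg]; exact h.1

/-! ### Visibility -/

variable {V : Type*}

/-- `u` sees `v`: no constraint crosses the segment `uv` transversally. -/
def Sees (f : V → ℂ) (S : SimpleGraph V) (u v : V) : Prop :=
  u ≠ v ∧ ∀ a b, S.Adj a b → ¬ Crosses (f u) (f v) (f a) (f b)

/-- No three points are collinear. -/
def NoThreeCollinear (f : V → ℂ) : Prop :=
  ∀ a b c, a ≠ b → a ≠ c → b ≠ c → orient (f a) (f b) (f c) ≠ 0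

theorem Sees.symm {f : V → ℂ} {S : SimpleGraph V} {u v : V} (h : Sees f S u v) :
    Sees f S v u :=
  ⟨h.1.symm, fun a b hab hc => h.2 a b hab hc.symm_left⟩

theorem NoThreeCollinear.det_ne_zero {f : V → ℂ} (hf : NoThreeCollinear f) {u v w : V}
    (hu : f u = 0) (huv : u ≠ v) (huw : u ≠ w) (hvw : v ≠ w) : det (f v) (f w) ≠ 0 := by
  have := hf u v w huv huw hvw
  rwa [hu, orient_zero_left] at this

/-- If a constraint with end `c` on the positive side of `uq` crosses `uq`, then its line has `u` on
the negative and `q` on the positive side. -/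
theorem crosses_zero_sides {q c d : ℂ} (h : Crosses 0 q c d) (hc : 0 < det q c) :
    det q d < 0 ∧ det c d < 0 ∧ 0 < orient c d q := by
  obtain ⟨h1, h2⟩ := h
  rw [orient_zero_left, orient_zero_left] at h1
  rw [orient_zero_right] at h2
  have hd : det q d < 0 := by
    by_contra hd
    exact absurd h1 (not_lt.2 (mul_nonneg hc.le (not_lt.1 hd)))
  have hcd : det c d < 0 := by
    by_contra hcd
    have : 0 < orient c d q := by
      rw [orient_eq, det_swap d q]; linarith [not_lt.1 hcd]
    exact absurd h2 (not_lt.2 (mul_nonneg (not_lt.1 hcd) this.le))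
  exact ⟨hd, hcd, by by_contra hq; exact absurd h2 (not_lt.2 (mul_nonneg_of_nonpos_of_nonpos hcd.le (not_lt.1 hq)))⟩

/-- The segment v'p crosses uv at some x, and q is the vertex of the triangle u p x whose direction
is closest to uv. Constraints cross neither uv nor v'p, so one that cuts uq, or that leaves u
between q and v, would need an end in the triangle strictly between these directions. -/
theorem exists_visible_of_crossing [Finite V] {f : V → ℂ} {S : SimpleGraph V}
    (hf : NoThreeCollinear f) {u v v' p : V} (hu : f u = 0) (huv : Sees f S u v)
    (hvp : Sees f S v' p) (h1 : 0 < det (f v) (f v')) (h2 : det (f v) (f p) < 0)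
    (h3 : 0 < det (f p) (f v')) (h4 : 0 < orient (f v) (f v') (f p)) :
    ∃ q, Sees f S u q ∧
      (∃ a b : ℝ, 0 ≤ a ∧ 0 < b ∧ a + b ≤ 1 ∧ f q = a • f v + b • f p) ∧
      ∀ z, S.Adj u z → ¬ (det (f v) (f z) ≤ 0 ∧ 0 < det (f q) (f z)) := by
  classical
  set K : V → ℝ := fun q => orient (f v') (f p) (f q) with hK
  have Kv : 0 < K v := by simp only [hK]; rw [← orient_rotate]; exact h4
  have K0 : det (f v') (f p) < 0 := by rw [det_swap]; linarith
  -- The triangle between the rays up and uv, up to the line v'p: K is positive at v and negative at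
  -- u.
  let Q : Set V := {q | det (f v) (f q) < 0 ∧ det (f q) (f p) ≤ 0 ∧ K q ≤ 0}
  have hpQ : p ∈ Q := ⟨h2, (det_self _).le, (orient_self_right _ _).le⟩
  -- The ratio of barycentric coordinates grows as the direction of q turns towards uv.
  obtain ⟨q, hqQ, hmax⟩ := (Set.toFinite Q).exists_maximalFor
    (fun q => det (f q) (f p) / det (f v) (f q)) Q ⟨p, hpQ⟩
  obtain ⟨hq1, hq2, hq3⟩ := hqQ
  -- points to the right of `q` have a larger ratio
  have hbig : ∀ z, det (f v) (f z) < 0 → 0 < det (f q) (f z) →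
      det (f z) (f p) < 0 ∧ ¬ K z ≤ 0 := by
    intro z hz1 hz2
    have e := det_pluecker (f v) (f q) (f z) (f p)
    have hzp : det (f z) (f p) < 0 := by
      by_contra hcon
      have a1 : det (f v) (f q) * det (f z) (f p) ≤ 0 :=
        mul_nonpos_of_nonpos_of_nonneg hq1.le (not_lt.1 hcon)
      have a2 : 0 ≤ det (f v) (f z) * det (f q) (f p) :=
        mul_nonneg_of_nonpos_of_nonpos hz1.le hq2
      have a3 : det (f v) (f p) * det (f q) (f z) < 0 := mul_neg_of_neg_of_pos h2 hz2
      linarith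
    refine ⟨hzp, fun hz3 => ?_⟩
    have hle : det (f q) (f p) / det (f v) (f q) ≤ det (f z) (f p) / det (f v) (f z) := by
      rw [← neg_div_neg_eq, ← neg_div_neg_eq (det (f z) (f p)),
        div_le_div_iff₀ (by linarith) (by linarith)]
      nlinarith [mul_neg_of_neg_of_pos h2 hz2]
    have := hmax (j := z) ⟨hz1, hzp.le, hz3⟩ hle
    simp only at this
    rw [← neg_div_neg_eq, ← neg_div_neg_eq (det (f q) (f p)),
        div_le_div_iff₀ (by linarith) (by linarith)] at this
    nlinarith [mul_neg_of_neg_of_pos h2 hz2]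
  -- barycentric coordinates of `q`
  obtain ⟨a, b, ha, hb, hab, hqe⟩ : ∃ a b : ℝ, 0 ≤ a ∧ 0 < b ∧ a + b ≤ 1 ∧
      f q = a • f v + b • f p := by
    have e := comb_of_det_ne_zero h2.ne (f q)
    have ha : 0 ≤ det (f q) (f p) / det (f v) (f p) := div_nonneg_of_nonpos hq2 h2.le
    have hb : 0 < det (f v) (f q) / det (f v) (f p) := div_pos_of_neg_of_neg hq1 h2
    refine ⟨_, _, ha, hb, ?_, e⟩
    have e2 : K q = _ := (congrArg (orient (f v') (f p)) e).trans (orient_comb _ _ _ _ _ _)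
    rw [orient_self_right, mul_zero, add_zero] at e2
    by_contra hcon
    have : 0 < (1 - det (f q) (f p) / det (f v) (f p) - det (f v) (f q) / det (f v) (f p)) *
      det (f v') (f p) := mul_pos_of_neg_of_neg (by linarith) K0
    have := mul_nonneg ha Kv.le
    simp only [hK] at this
    linarith
  have huq : u ≠ q := by
    rintro rfl; rw [hu] at hq1; simp [det] at hq1
  have hqv' : 0 < det (f q) (f v') := by
    rw [hqe, det_comb_left]; have := mul_nonneg ha h1.le; have := mul_pos hb h3; linarith
  refine ⟨q, ⟨huq, ?_⟩, ⟨a, b, ha, hb, hab, hqe⟩, ?_⟩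
  · -- no constraint crosses `uq`
    have main : ∀ c d, S.Adj c d → Crosses 0 (f q) (f c) (f d) → ¬ 0 < det (f q) (f c) := by
      intro c d hcd hcr hqc
      obtain ⟨hqd, L0, Lq⟩ := crosses_zero_sides hcr hqc
      obtain ⟨ρ, t, r0, r1, t0, t1, hx⟩ := hcr.exists_point
      rw [smul_zero, zero_add] at hx
      set L : V → ℝ := fun z => orient (f c) (f d) (f z) with hL
      have hcomb : ∀ z, ∃ α β : ℝ, α * det (f v) (f q) = det (f z) (f q) ∧
          β * det (f v) (f q) = det (f v) (f z) ∧
          L z = α * L v + β * L q + (1 - α - β) * det (f c) (f d) ∧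
          K z = α * K v + β * K q + (1 - α - β) * det (f v') (f p) := by
        intro z
        refine ⟨det (f z) (f q) / det (f v) (f q), det (f v) (f z) / det (f v) (f q),
          div_mul_cancel₀ _ hq1.ne, div_mul_cancel₀ _ hq1.ne, ?_, ?_⟩
        · exact (congrArg (orient (f c) (f d)) (comb_of_det_ne_zero hq1.ne (f z))).trans
            (orient_comb _ _ _ _ _ _)
        · exact (congrArg (orient (f v') (f p)) (comb_of_det_ne_zero hq1.ne (f z))).trans
            (orient_comb _ _ _ _ _ _)
      obtain ⟨α, β, hα, hβ, hLc, hKc⟩ := hcomb c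
      have Lc : L c = 0 := orient_self _ _
      rw [Lc] at hLc
      have hα0 : 0 < α := by
        by_contra hcon
        have : 0 ≤ α * det (f v) (f q) := mul_nonneg_of_nonpos_of_nonpos (not_lt.1 hcon) hq1.le
        rw [hα, det_swap] at this
        linarith
      -- if `c` is beyond `uv`, then `v` and `u` are on the same side of `cd`
      have hbeyond : 0 < det (f v) (f c) → L v ≤ 0 := by
        intro hvc
        have hvx : det (f v) ((1 - t) • f c + t • f d) < 0 := by
          rw [← hx]
          have := det_comb_right (f q) 0 (f v) ρ 0
          simp only [smul_zero, add_zero, zero_mul] at this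
          rw [this]; exact mul_neg_of_pos_of_neg r0 hq1
        rw [det_comb_right] at hvx
        have hvd : det (f v) (f d) < 0 := by
          have : 0 < (1 - t) * det (f v) (f c) := mul_pos (by linarith) hvc
          exact neg_of_mul_neg_right (by linarith : t * det (f v) (f d) < 0) t0.le
        by_contra hcon
        refine huv.2 c d hcd ⟨?_, ?_⟩
        · rw [hu, orient_zero_left, orient_zero_left]; exact mul_neg_of_pos_of_neg hvc hvd
        · rw [hu, orient_zero_right]; exact mul_neg_of_neg_of_pos L0 (not_le.1 hcon)
      -- If c is on the side of u, the choice of q puts c beyond uv; then v is not on the far side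
      -- of cd, and the signs contradict that c lies on cd. If c is beyond v'p, then u, p and the
      -- crossing point all fail to lie on the far side of cd, and so does q in their hull.
      by_cases hKc0 : K c ≤ 0
      · -- `c` is on the near side of `v'p`
        rcases lt_trichotomy (det (f v) (f c)) 0 with hvc | hvc | hvc
        · exact (hbig c hvc hqc).2 hKc0
        · have hcu : u ≠ c := by
            rintro rfl; rw [hu] at hqc; simp [det] at hqc
          have hcv : c ≠ v := by
            rintro rfl; linarith
          refine hf u v c huv.1 hcu hcv.symm ?_
          rw [hu, orient_zero_left, hvc]
        · have hLv := hbeyond hvc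
          have hβ0 : β < 0 := by
            by_contra hcon
            have : β * det (f v) (f q) ≤ 0 := mul_nonpos_of_nonneg_of_nonpos (not_lt.1 hcon) hq1.le
            linarith
          have hs : 0 ≤ 1 - α - β := by
            by_contra hcon
            have := mul_pos_of_neg_of_neg (not_le.1 hcon) K0
            have := mul_pos hα0 Kv
            have := mul_nonneg_of_nonpos_of_nonpos hβ0.le hq3
            linarith
          have := mul_nonpos_of_nonneg_of_nonpos hs L0.le
          have := mul_neg_of_neg_of_pos hβ0 Lq
          have := mul_nonpos_of_nonneg_of_nonpos hα0.le hLv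
          simp only [hL] at *
          linarith
      · have hKc1 := not_le.1 hKc0
        -- the crossing of `uv` and `v'p` is on the side of `u`
        have hLy : L v * (-det (f v') (f p)) + det (f c) (f d) * K v < 0 := by
          rcases le_or_gt (det (f v) (f c)) 0 with hvc | hvc
          · have hβ0 : 0 ≤ β := by
              by_contra hcon
              have : 0 < β * det (f v) (f q) := mul_pos_of_neg_of_neg (not_le.1 hcon) hq1
              linarith
            have e : α * (L v * (-det (f v') (f p)) + det (f c) (f d) * K v) =
                det (f v') (f p) * (β * L q) + det (f c) (f d) * K c
                  - β * (det (f c) (f d) * K q) := by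
              rw [hKc]
              linear_combination (det (f v') (f p)) * hLc
            have e1 := mul_nonpos_of_nonpos_of_nonneg K0.le (mul_nonneg hβ0 Lq.le)
            have e2 := mul_neg_of_neg_of_pos L0 hKc1
            have e3 := mul_nonneg hβ0 (mul_nonneg_of_nonpos_of_nonpos L0.le hq3)
            simp only [hL] at e ⊢
            exact neg_of_mul_neg_right (by rw [e]; linarith) hα0.le
          · have := mul_nonpos_of_nonpos_of_nonneg (hbeyond hvc) (neg_pos.2 K0).le
            have := mul_neg_of_neg_of_pos L0 Kv
            linarith
        -- `d` is on the near side of `v'p`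
        have hKd : K d < 0 := by
          have e1 : orient (f v') (f p) (ρ • f q) = ρ * K q + (1 - ρ) * det (f v') (f p) := by
            have := orient_comb (f v') (f p) (f q) 0 ρ 0
            simpa using this
          rw [hx, orient_convex] at e1
          have := mul_nonpos_of_nonneg_of_nonpos r0.le hq3
          have := mul_neg_of_pos_of_neg (sub_pos.2 r1) K0
          have := mul_pos (sub_pos.2 t1) hKc1
          exact neg_of_mul_neg_right (by simp only [hK] at *; linarith : t * K d < 0) t0.le
        have hncr := hvp.2 c d hcd
        have hLp : L p ≤ 0 := by
          by_contra hcon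
          have hLv' : 0 ≤ L v' := by
            by_contra hcon2
            exact hncr ⟨mul_neg_of_pos_of_neg hKc1 hKd,
              mul_neg_of_neg_of_pos (not_le.1 hcon2) (not_le.1 hcon)⟩
          -- the crossing point is a convex combination of `v'` and `p`
          have e : (L v * (-det (f v') (f p)) + det (f c) (f d) * K v) * (det (f v) (f v') - det (f v) (f p)) =
              (K v - det (f v') (f p)) * (L p * det (f v) (f v') + L v' * (- det (f v) (f p))) := by
            simp only [hL, hK, orient, det, Complex.sub_re, Complex.sub_im]; ring
          have e1 := mul_neg_of_neg_of_pos hLy (by linarith : 0 < det (f v) (f v') - det (f v) (f p))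
          rw [e] at e1
          have e2 : 0 ≤ L p * det (f v) (f v') + L v' * (- det (f v) (f p)) :=
            add_nonneg (mul_nonneg (not_le.1 hcon).le h1.le) (mul_nonneg hLv' (by linarith))
          have := mul_nonneg (by linarith : 0 ≤ K v - det (f v') (f p)) e2
          linarith
        have e1 : L q = a * L v + b * L p + (1 - a - b) * det (f c) (f d) :=
          (congrArg (orient (f c) (f d)) hqe).trans (orient_comb _ _ _ _ _ _)
        have e2 : K q = a * K v + (1 - a - b) * det (f v') (f p) := by
          have := (congrArg (orient (f v') (f p)) hqe).trans (orient_comb _ _ _ _ _ _)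
          rw [orient_self_right, mul_zero, add_zero] at this
          exact this
        -- `q` is a convex combination of `u`, `p` and the crossing point
        have e3 : L q * (-det (f v') (f p)) =
            a * (L v * (-det (f v') (f p)) + det (f c) (f d) * K v)
            + b * (L p * (-det (f v') (f p))) - det (f c) (f d) * K q := by
          rw [e1, e2]; ring
        have n1 := mul_nonpos_of_nonneg_of_nonpos ha hLy.le
        have n2 := mul_nonpos_of_nonneg_of_nonpos hb.le
          (mul_nonpos_of_nonpos_of_nonneg hLp (neg_pos.2 K0).le)
        have n3 := mul_nonneg_of_nonpos_of_nonpos L0.le hq3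
        have n4 := mul_pos Lq (neg_pos.2 K0)
        simp only [hL] at *
        linarith
    intro c d hcd hcr
    rw [hu] at hcr
    by_cases hqc : 0 < det (f q) (f c)
    · exact main c d hcd hcr hqc
    · refine main d c hcd.symm hcr.symm_right ?_
      have := hcr.1
      rw [orient_zero_left, orient_zero_left] at this
      by_contra hqd
      exact absurd this (not_lt.2 (mul_nonneg_of_nonpos_of_nonpos (not_lt.1 hqc) (not_lt.1 hqd)))
  -- By the choice of q such a z lies beyond v'p, so the constraint uz would cross v'p.
  · rintro z huz ⟨hz0, hz2⟩
    have hz1 : det (f v) (f z) < 0 := by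
      refine lt_of_le_of_ne hz0 (hf.det_ne_zero hu huv.1 huz.ne ?_)
      rintro rfl
      refine hvp.2 u v huz ⟨?_, ?_⟩
      · rw [hu, orient_zero_right]; exact mul_neg_of_neg_of_pos K0 Kv
      · rw [hu, orient_zero_left, orient_zero_left]; exact mul_neg_of_pos_of_neg h1 h2
    obtain ⟨hz3, hz4⟩ := hbig z hz1 hz2
    refine hvp.2 u z huz ⟨?_, ?_⟩
    · rw [hu, orient_zero_right]; exact mul_neg_of_neg_of_pos K0 (not_le.1 hz4)
    · rw [hu, orient_zero_left, orient_zero_left]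
      refine mul_neg_of_pos_of_neg ?_ hz3
      have e := det_pluecker (f v) (f q) (f z) (f v')
      have := mul_neg_of_neg_of_pos hz1 hqv'
      have := mul_pos h1 hz2
      by_contra hcon
      have := mul_nonneg_of_nonpos_of_nonpos hq1.le (not_lt.1 hcon)
      linarith


/-! ### Empty triangles -/

/-- Barycentric coordinates with respect to the triangle `0`, `v`, `v'`. -/
theorem exists_barycentric {v v' : ℂ} (h : 0 < det v v') (z : ℂ) :
    ∃ α β : ℝ, α * det v v' = det z v' ∧ β * det v v' = det v z ∧
      (1 - α - β) * det v v' = orient v v' z ∧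
      ∀ c d, orient c d z = α * orient c d v + β * orient c d v' + (1 - α - β) * det c d := by
  refine ⟨det z v' / det v v', det v z / det v v', div_mul_cancel₀ _ h.ne', div_mul_cancel₀ _ h.ne',
    ?_, fun c d => ?_⟩
  · rw [orient_eq, sub_mul, sub_mul, div_mul_cancel₀ _ h.ne', div_mul_cancel₀ _ h.ne',
      det_swap z v', det_swap z v]; ring
  · exact (congrArg (orient c d) (comb_of_det_ne_zero h.ne' z)).trans (orient_comb _ _ _ _ _ _)

/-- An open triangle at `u`, whose sides at `u` are visible and which contains no point that sees
`u`, contains no point at all. -/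
theorem triangle_empty [Finite V] {f : V → ℂ} {S : SimpleGraph V} (hf : NoThreeCollinear f)
    {u v v' : V} (hu : f u = 0) (huv : Sees f S u v) (huv' : Sees f S u v')
    (h1 : 0 < det (f v) (f v'))
    (hvis : ∀ q, Sees f S u q → 0 < det (f v) (f q) → 0 < det (f q) (f v') →
      ¬ 0 < orient (f v) (f v') (f q)) :
    ∀ p, 0 < det (f v) (f p) → 0 < det (f p) (f v') → ¬ 0 < orient (f v) (f v') (f p) := by
  classical
  intro p hp1 hp2 hp3
  let Q : Set V := {q | 0 < det (f v) (f q) ∧ 0 < det (f q) (f v') ∧ 0 < orient (f v) (f v') (f q)}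
  -- The vertex of the triangle farthest from vv' is visible: a constraint cutting uq has an end
  -- still farther from vv', and that end cannot leave the triangle through uv or uv'.
  obtain ⟨q, ⟨hq1, hq2, hq3⟩, hmax⟩ := (Set.toFinite Q).exists_maximalFor
    (fun q => orient (f v) (f v') (f q)) Q ⟨p, hp1, hp2, hp3⟩
  have huq : u ≠ q := by
    rintro rfl; rw [hu] at hq1; simp [det] at hq1
  refine hvis q ⟨huq, ?_⟩ hq1 hq2 hq3
  obtain ⟨a, b, ha, hb, hab, hqc⟩ := exists_barycentric h1 (f q)
  have ha0 : 0 < a := (mul_pos_iff_of_pos_right h1).1 (by rw [ha]; exact hq2)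
  have hb0 : 0 < b := (mul_pos_iff_of_pos_right h1).1 (by rw [hb]; exact hq1)
  have hab0 : 0 < 1 - a - b := (mul_pos_iff_of_pos_right h1).1 (by rw [hab]; exact hq3)
  -- the end of a crossing constraint that is closer to `u` lies in the triangle
  have main : ∀ c d, S.Adj c d → Crosses 0 (f q) (f c) (f d) →
      ¬ orient (f v) (f v') (f q) < orient (f v) (f v') (f c) := by
    intro c d hcd hcr hGc
    obtain ⟨ρ, t, r0, r1, t0, t1, hx⟩ := hcr.exists_point
    rw [smul_zero, zero_add] at hx
    obtain ⟨α, β, hα, hβ, hαβ, hc⟩ := exists_barycentric h1 (f c)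
    have hs : 0 < 1 - α - β :=
      (mul_pos_iff_of_pos_right h1).1 (by rw [hαβ]; linarith)
    have hLc := hc (f c) (f d)
    rw [orient_self] at hLc
    have hLq := hqc (f c) (f d)
    have hcross := hcr.2
    rw [orient_zero_right] at hcross
    have huc : u ≠ c := by
      rintro rfl; rw [hu] at hcross; simp [det] at hcross
    -- If c is beyond the line uv', then cd meets that line; as cd does not cross the segment uv',
    -- the vertex v' is not on the other side of cd from u.
    have sv : α < 0 → 0 ≤ det (f c) (f d) * orient (f c) (f d) (f v') := by
      intro hα0
      have hcv : det (f c) (f v') < 0 := by rw [← hα]; exact mul_neg_of_neg_of_pos hα0 h1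
      have hdv : 0 < det (f d) (f v') := by
        have e : det ((1 - t) • f c + t • f d) (f v') = ρ * det (f q) (f v') := by
          rw [← hx]; simpa using det_comb_left (f q) 0 (f v') ρ 0
        rw [det_comb_left] at e
        have := mul_pos r0 hq2
        have := mul_neg_of_pos_of_neg (sub_pos.2 t1) hcv
        exact (mul_pos_iff_of_pos_left t0).1 (by linarith)
      by_contra hcon
      refine huv'.2 c d hcd ⟨?_, ?_⟩
      · rw [hu, orient_zero_left, orient_zero_left, det_swap, det_swap _ (f d), neg_mul_neg]
        exact mul_neg_of_neg_of_pos hcv hdv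
      · rw [hu, orient_zero_right]; exact not_le.1 hcon
    have sv' : β < 0 → 0 ≤ det (f c) (f d) * orient (f c) (f d) (f v) := by
      intro hβ0
      have hcv : det (f v) (f c) < 0 := by rw [← hβ]; exact mul_neg_of_neg_of_pos hβ0 h1
      have hdv : 0 < det (f v) (f d) := by
        have e : det (f v) ((1 - t) • f c + t • f d) = ρ * det (f v) (f q) := by
          rw [← hx]; simpa using det_comb_right (f q) 0 (f v) ρ 0
        rw [det_comb_right] at e
        have := mul_pos r0 hq1
        have := mul_neg_of_pos_of_neg (sub_pos.2 t1) hcv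
        exact (mul_pos_iff_of_pos_left t0).1 (by linarith)
      by_contra hcon
      refine huv.2 c d hcd ⟨?_, ?_⟩
      · rw [hu, orient_zero_left, orient_zero_left]
        exact mul_neg_of_neg_of_pos hcv hdv
      · rw [hu, orient_zero_right]; exact not_le.1 hcon
    -- multiply all equations by the sign of `u`
    set m := det (f c) (f d) with hm
    have hm0 : 0 < m * m := mul_self_pos.2 (fun h => by rw [h] at hcross; simp at hcross)
    set A := m * orient (f c) (f d) (f v) with hA
    set B := m * orient (f c) (f d) (f v') with hB
    -- `E1` says that c lies on cd, `E2` that cd separates q from u.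
    have E1 : 0 = α * A + β * B + (1 - α - β) * (m * m) := by
      linear_combination m * hLc
    have E2 : a * A + b * B + (1 - a - b) * (m * m) < 0 := by
      have : m * orient (f c) (f d) (f q) = a * A + b * B + (1 - a - b) * (m * m) := by
        linear_combination m * hLq
      linarith
    have hsm := mul_pos hs hm0
    have habm := mul_pos hab0 hm0
    have hα0 : 0 ≤ α := by
      by_contra hα0
      have hB0 := sv (not_le.1 hα0)
      have hA0 : A < 0 := by
        by_contra hA0
        have := mul_nonneg ha0.le (not_lt.1 hA0)
        have := mul_nonneg hb0.le hB0
        linarith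
      have hβ0 : 0 ≤ β := by
        by_contra hβ0
        linarith [sv' (not_le.1 hβ0)]
      have := mul_nonneg hβ0 hB0
      have := mul_pos_of_neg_of_neg (not_le.1 hα0) hA0
      linarith
    have hβ0 : 0 ≤ β := by
      by_contra hβ0
      have hA0 := sv' (not_le.1 hβ0)
      have hB0 : B < 0 := by
        by_contra hB0
        have := mul_nonneg ha0.le hA0
        have := mul_nonneg hb0.le (not_lt.1 hB0)
        linarith
      have := mul_nonneg hα0 hA0
      have := mul_pos_of_neg_of_neg (not_le.1 hβ0) hB0
      linarith
    have hcv : v ≠ c := by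
      rintro rfl; rw [orient_self] at hGc; linarith
    have hcv' : v' ≠ c := by
      rintro rfl; rw [orient_self_right] at hGc; linarith
    have d1 : 0 < det (f v) (f c) := by
      refine lt_of_le_of_ne (by rw [← hβ]; exact mul_nonneg hβ0 h1.le)
        (hf.det_ne_zero hu huv.1 huc hcv).symm
    have d2 : 0 < det (f c) (f v') := by
      refine lt_of_le_of_ne (by rw [← hα]; exact mul_nonneg hα0 h1.le)
        (hf.det_ne_zero hu huc huv'.1 hcv'.symm).symm
    exact absurd (hmax (j := c) ⟨d1, d2, hq3.trans hGc⟩ hGc.le) (not_le.2 hGc)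
  intro c d hcd hcr
  rw [hu] at hcr
  by_contra
  have h3 := main c d hcd hcr
  have h4 := main d c hcd.symm hcr.symm_right
  obtain ⟨ρ, t, r0, r1, t0, t1, hx⟩ := hcr.exists_point
  -- The distance to vv' is affine along cd and larger at the crossing point than at q, so it is
  -- larger at one of the ends.
  have e := congrArg (orient (f v) (f v')) hx
  rw [orient_convex, orient_convex, orient_zero_right] at e
  have hlt : orient (f v) (f v') (f q) < det (f v) (f v') := by
    rw [← hab]; nlinarith
  nlinarith [not_lt.1 h3, not_lt.1 h4]

/-- If the open triangle `u v v'` contains no points, its sides at `u` are visible, and no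
constraint leaves `u` into the triangle, then its third side is visible. -/
theorem sees_of_triangle_empty {f : V → ℂ} {S : SimpleGraph V} (hf : NoThreeCollinear f)
    {u v v' : V} (hu : f u = 0) (huv : Sees f S u v) (huv' : Sees f S u v')
    (h1 : 0 < det (f v) (f v'))
    (hemp : ∀ p, 0 < det (f v) (f p) → 0 < det (f p) (f v') → ¬ 0 < orient (f v) (f v') (f p))
    (hcon : ∀ z, S.Adj u z → ¬ (0 < det (f v) (f z) ∧ 0 < det (f z) (f v'))) :
    Sees f S v v' := by
  refine ⟨by rintro rfl; simp [det_self] at h1, ?_⟩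
  have main : ∀ c d, S.Adj c d → Crosses (f v) (f v') (f c) (f d) →
      ¬ 0 < orient (f v) (f v') (f c) := by
    intro c d hcd hcr hGc
    have hGd : orient (f v) (f v') (f d) < 0 := by
      by_contra h; exact absurd hcr.1 (not_lt.2 (mul_nonneg hGc.le (not_lt.1 h)))
    obtain ⟨ρ, t, r0, r1, t0, t1, hx⟩ := hcr.exists_point
    obtain ⟨α, β, hα, hβ, hαβ, hc⟩ := exists_barycentric h1 (f c)
    have hs : 0 < 1 - α - β :=
      (mul_pos_iff_of_pos_right h1).1 (by rw [hαβ]; linarith)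
    have hLc := hc (f c) (f d)
    rw [orient_self] at hLc
    have ex : det (f v) ((1 - t) • f c + t • f d) = ρ * det (f v) (f v') := by
      rw [← hx, det_comb_right, det_self]; ring
    have ex' : det ((1 - t) • f c + t • f d) (f v') = (1 - ρ) * det (f v) (f v') := by
      rw [← hx, det_comb_left, det_self]; ring
    have hρ := mul_pos r0 h1
    have hρ' := mul_pos (sub_pos.2 r1) h1
    rw [det_comb_right] at ex
    rw [det_comb_left] at ex'
    -- The case c = u is a constraint leaving u into the triangle, excluded by `hcon`.
    have huc : u ≠ c := by
      rintro rfl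
      have z1 : det (f v) (f u) = 0 := by simp [hu, det]
      have z2 : det (f u) (f v') = 0 := by simp [hu, det]
      rw [z1, mul_zero, zero_add] at ex
      rw [z2, mul_zero, zero_add] at ex'
      exact hcon d hcd ⟨(mul_pos_iff_of_pos_left t0).1 (by linarith),
        (mul_pos_iff_of_pos_left t0).1 (by linarith)⟩
    have hud : u ≠ d := by
      rintro rfl
      rw [hu, orient_zero_right] at hGd; linarith
    set m := det (f c) (f d) with hm
    have hm0 : m ≠ 0 := hf.det_ne_zero hu huc hud hcd.ne
    have sv : α < 0 → 0 ≤ m * orient (f c) (f d) (f v') := by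
      intro hα0
      have hcv : det (f c) (f v') < 0 := by rw [← hα]; exact mul_neg_of_neg_of_pos hα0 h1
      have hdv : 0 < det (f d) (f v') := by
        have := mul_neg_of_pos_of_neg (sub_pos.2 t1) hcv
        exact (mul_pos_iff_of_pos_left t0).1 (by linarith)
      by_contra hcon
      refine huv'.2 c d hcd ⟨?_, ?_⟩
      · rw [hu, orient_zero_left, orient_zero_left, det_swap, det_swap _ (f d), neg_mul_neg]
        exact mul_neg_of_neg_of_pos hcv hdv
      · rw [hu, orient_zero_right]; exact not_le.1 hcon
    have sv' : β < 0 → 0 ≤ m * orient (f c) (f d) (f v) := by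
      intro hβ0
      have hcv : det (f v) (f c) < 0 := by rw [← hβ]; exact mul_neg_of_neg_of_pos hβ0 h1
      have hdv : 0 < det (f v) (f d) := by
        have := mul_neg_of_pos_of_neg (sub_pos.2 t1) hcv
        exact (mul_pos_iff_of_pos_left t0).1 (by linarith)
      by_contra hcon
      refine huv.2 c d hcd ⟨?_, ?_⟩
      · rw [hu, orient_zero_left, orient_zero_left]
        exact mul_neg_of_neg_of_pos hcv hdv
      · rw [hu, orient_zero_right]; exact not_le.1 hcon
    have hAB : (m * orient (f c) (f d) (f v)) * (m * orient (f c) (f d) (f v')) < 0 := by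
      have := mul_neg_of_pos_of_neg (mul_self_pos.2 hm0) hcr.2
      linarith
    set A := m * orient (f c) (f d) (f v) with hA
    set B := m * orient (f c) (f d) (f v') with hB
    have E1 : 0 = α * A + β * B + (1 - α - β) * (m * m) := by
      linear_combination m * hLc
    have hsm := mul_pos hs (mul_self_pos.2 hm0)
    have hα0 : 0 ≤ α := by
      by_contra hα0
      have hB0 := sv (not_le.1 hα0)
      have hA0 : A < 0 := by
        by_contra hA0; exact absurd hAB (not_lt.2 (mul_nonneg (not_lt.1 hA0) hB0))
      have hβ0 : 0 ≤ β := by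
        by_contra hβ0
        linarith [sv' (not_le.1 hβ0)]
      have := mul_nonneg hβ0 hB0
      have := mul_pos_of_neg_of_neg (not_le.1 hα0) hA0
      linarith
    have hβ0 : 0 ≤ β := by
      by_contra hβ0
      have hA0 := sv' (not_le.1 hβ0)
      have hB0 : B < 0 := by
        by_contra hB0; exact absurd hAB (not_lt.2 (mul_nonneg hA0 (not_lt.1 hB0)))
      have := mul_nonneg hα0 hA0
      have := mul_pos_of_neg_of_neg (not_le.1 hβ0) hB0
      linarith
    have hcv : v ≠ c := by
      rintro rfl; rw [orient_self] at hGc; linarith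
    have hcv' : v' ≠ c := by
      rintro rfl; rw [orient_self_right] at hGc; linarith
    have d1 : 0 < det (f v) (f c) := by
      refine lt_of_le_of_ne (by rw [← hβ]; exact mul_nonneg hβ0 h1.le)
        (hf.det_ne_zero hu huv.1 huc hcv).symm
    have d2 : 0 < det (f c) (f v') := by
      refine lt_of_le_of_ne (by rw [← hα]; exact mul_nonneg hα0 h1.le)
        (hf.det_ne_zero hu huc huv'.1 hcv'.symm).symm
    exact hemp c d1 d2 hGc
  intro c d hcd hcr
  by_cases hG : 0 < orient (f v) (f v') (f c)
  · exact main c d hcd hcr hG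
  · refine main d c hcd.symm hcr.symm_right ?_
    by_contra hG'
    exact absurd hcr.1 (not_lt.2 (mul_nonneg_of_nonpos_of_nonpos (not_lt.1 hG) (not_lt.1 hG')))

/-! ### The convex chain -/

/-- All three vectors lie in the open half-plane on one side of e, where being to the right of is
transitive. -/
theorem det_pos_of_convex {s t e v : ℂ} (h1 : 0 < det s v) (h2 : 0 < det v t) (h3 : det e t < 0)
    (h4 : det e s < 0) (h5 : det e v < 0) : 0 < det s t := by
  have e1 := det_pluecker s t e v
  rw [det_swap s e, det_swap t v] at e1
  rw [det_swap t e] at e1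
  have := mul_pos_of_neg_of_neg h4 (neg_neg_of_pos h2)
  have := mul_pos_of_neg_of_neg h3 (neg_neg_of_pos h1)
  by_contra hcon
  have := mul_nonneg_of_nonpos_of_nonpos (not_lt.1 hcon) h5.le
  linarith

/-- An edge of the lower hull of the points of `Z` that lie between `v₀` and `w`, as seen from the
origin. -/
structure HullEdge (f : V → ℂ) (Z : Set V) (v₀ v v' : V) : Prop where
  left_mem : v ∈ Z
  right_mem : v' ∈ Z
  start : v = v₀ ∨ 0 < det (f v₀) (f v)
  det_pos : 0 < det (f v) (f v')
  above : ∀ q ∈ Z, q ≠ v → q ≠ v' → orient (f v) (f v') (f q) < 0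

/-- Induction along the lower hull, from its rightmost point `w` back to its lowest point `v₀`. -/
theorem hull_induction [Finite V] {f : V → ℂ} (hf : NoThreeCollinear f) {u : V} (hu : f u = 0)
    {Z : Set V} (hZ : ∀ q ∈ Z, 0 < (f q).re) {v₀ w : V} (hv₀ : v₀ ∈ Z) (hw : w ∈ Z)
    (hlow : ∀ q ∈ Z, q ≠ v₀ → (f v₀).re < (f q).re) (hright : ∀ q ∈ Z, q ≠ w → 0 < det (f q) (f w))
    (Q : V → Prop) (hQw : Q w) (hstep : ∀ v v', HullEdge f Z v₀ v v' → Q v' → Q v) : Q v₀ := by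
  classical
  have huq : ∀ q ∈ Z, u ≠ q := by
    rintro q hq rfl
    have := hZ u hq
    simp [hu] at this
  -- Gift wrapping, by induction on the number of vertices to the right of v. The last hypothesis is
  -- convexity at v: a segment joining a vertex on the left of v to one on the right passes above v.
  have key : ∀ n : ℕ, ∀ v ∈ Z, {t | t ∈ Z ∧ 0 < det (f v) (f t)}.ncard = n →
      (v = v₀ ∨ 0 < det (f v₀) (f v)) →
      (∀ s ∈ Z, ∀ t ∈ Z, 0 < det (f s) (f v) → 0 < det (f v) (f t) →
        orient (f s) (f v) (f t) < 0) → Q v := by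
    intro n
    induction n using Nat.strong_induction_on with
    | _ n ih =>
    intro v hv hn hst hJ
    by_cases hvw : v = w
    · rw [hvw]; exact hQw
    let R : Set V := {t | t ∈ Z ∧ 0 < det (f v) (f t)}
    have hwR : w ∈ R := ⟨hw, hright v hv hvw⟩
    -- The minimised quotient is the cotangent of the angle from the direction of v to t − v, so v'
    -- is the vertex reached by turning farthest to the right.
    obtain ⟨v', ⟨hv'Z, hvv'⟩, hmin⟩ := (Set.toFinite R).exists_minimalFor
      (fun t => ((f v).re * ((f t).re - (f v).re) + (f v).im * ((f t).im - (f v).im))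
        / det (f v) (f t)) R ⟨w, hwR⟩
    have hne : v ≠ v' := by rintro rfl; simp [det_self] at hvv'
    -- all points to the right of `v` are above `vv'`
    have hR : ∀ t ∈ R, t ≠ v' → orient (f v) (f v') (f t) < 0 := by
      intro t ht htv'
      have htv : t ≠ v := by rintro rfl; have := ht.2; simp [det_self] at this
      refine lt_of_le_of_ne ?_ (hf v v' t hne htv.symm htv'.symm)
      have hle : ((f v).re * ((f v').re - (f v).re) + (f v).im * ((f v').im - (f v).im))
          / det (f v) (f v') ≤ ((f v).re * ((f t).re - (f v).re) + (f v).im * ((f t).im - (f v).im))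
          / det (f v) (f t) := by
        rcases le_total (((f v).re * ((f v').re - (f v).re) + (f v).im * ((f v').im - (f v).im))
          / det (f v) (f v')) (((f v).re * ((f t).re - (f v).re)
          + (f v).im * ((f t).im - (f v).im)) / det (f v) (f t)) with h | h
        · exact h
        · exact hmin (j := t) ht h
      rw [div_le_div_iff₀ hvv' ht.2] at hle
      have e : (f v).re ^ 2 * orient (f v) (f v') (f t) + (f v).im ^ 2 * orient (f v) (f v') (f t) =
        ((f v).re * ((f v').re - (f v).re) + (f v).im * ((f v').im - (f v).im)) * det (f v) (f t)
        - ((f v).re * ((f t).re - (f v).re)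
          + (f v).im * ((f t).im - (f v).im)) * det (f v) (f v') := by
        simp only [orient, det, Complex.sub_re, Complex.sub_im]; ring
      by_contra hcon
      have := mul_pos (pow_pos (hZ v hv) 2) (not_le.1 hcon)
      have := mul_nonneg (sq_nonneg (f v).im) (not_le.1 hcon).le
      linarith
    have hedge : HullEdge f Z v₀ v v' := by
      refine ⟨hv, hv'Z, hst, hvv', fun q hq hqv hqv' => ?_⟩
      rcases lt_or_gt_of_ne (hf.det_ne_zero hu (huq v hv) (huq q hq) hqv.symm) with h | h
      · rw [← orient_rotate]
        exact hJ q hq v' hv'Z (by rw [det_swap]; linarith) hvv'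
      · exact hR q ⟨hq, h⟩ hqv'
    refine hstep v v' hedge (ih _ ?_ v' hv'Z rfl ?_ ?_)
    · rw [← hn]
      refine Set.ncard_lt_ncard ⟨fun t ht => ⟨ht.1, ?_⟩, fun hsub => ?_⟩ (Set.toFinite _)
      · exact det_pos_trans (hZ v hv) (hZ v' hv'Z) (hZ t ht.1) hvv' ht.2
      · have := (hsub (show v' ∈ {t | t ∈ Z ∧ 0 < det (f v) (f t)} from ⟨hv'Z, hvv'⟩)).2
        simp [det_self] at this
    · right
      rcases hst with rfl | h
      · exact hvv'
      · exact det_pos_trans (hZ v₀ hv₀) (hZ v hv) (hZ v' hv'Z) h hvv'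
    · intro s hs t ht hsv' hv't
      have htR : t ∈ R := ⟨ht, det_pos_trans (hZ v hv) (hZ v' hv'Z) (hZ t ht) hvv' hv't⟩
      have htv' : t ≠ v' := by rintro rfl; simp [det_self] at hv't
      have hsv'' : s ≠ v' := by rintro rfl; simp [det_self] at hsv'
      have h1 := hR t htR htv'
      by_cases hsv : s = v
      · rw [hsv]; exact h1
      have h2 := hedge.above s hs hsv hsv''
      -- Seen from v', both s and t lie above the line vv', and v' separates their directions as
      -- seen from u.
      have : 0 < det (f s - f v') (f t - f v') := by
        refine det_pos_of_convex (e := f v' - f v) (v := f v') ?_ ?_ ?_ ?_ ?_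
        · rw [det_sub_left, det_self]; linarith
        · rw [det_sub_right, det_self]; linarith
        · have : det (f v' - f v) (f t - f v') = orient (f v) (f v') (f t) := by
            simp only [orient, det, Complex.sub_re, Complex.sub_im]; ring
          rw [this]; exact h1
        · have : det (f v' - f v) (f s - f v') = orient (f v) (f v') (f s) := by
            simp only [orient, det, Complex.sub_re, Complex.sub_im]; ring
          rw [this]; exact h2
        · rw [det_sub_left, det_self]; linarith
      rw [orient_swap]
      simp only [orient]
      linarith
  -- Convexity at v₀ holds because every other vertex is above the horizontal line through v₀.
  refine key _ v₀ hv₀ rfl (Or.inl rfl) fun s hs t ht hs1 ht1 => ?_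
  have hsv : s ≠ v₀ := by rintro rfl; simp [det_self] at hs1
  have htv : t ≠ v₀ := by rintro rfl; simp [det_self] at ht1
  have : 0 < det (f s - f v₀) (f t - f v₀) := by
    have hk : ∀ z : ℂ, det I z = -z.re := by intro z; simp [det]
    refine det_pos_of_convex (e := I) (v := f v₀) ?_ ?_ ?_ ?_ ?_
    · rw [det_sub_left, det_self]; linarith
    · rw [det_sub_right, det_self]; linarith
    · rw [hk, Complex.sub_re]; linarith [hlow t ht htv]
    · rw [hk, Complex.sub_re]; linarith [hlow s hs hsv]
    · rw [hk]; linarith [hZ v₀ hv₀]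
  rw [orient_swap]
  simp only [orient]
  linarith

/-- Hull edges ascend. -/
theorem HullEdge.re_lt {f : V → ℂ} {Z : Set V} {v₀ v v' : V} (h : HullEdge f Z v₀ v v')
    (hZ : ∀ q ∈ Z, 0 < (f q).re) (hv₀ : v₀ ∈ Z)
    (hlow : ∀ q ∈ Z, q ≠ v₀ → (f v₀).re < (f q).re) : (f v).re < (f v').re := by
  have hdet := h.det_pos
  rcases h.start with rfl | hst
  · exact hlow v' h.right_mem (by rintro rfl; simp [det_self] at hdet)
  have hne : v ≠ v₀ := by rintro rfl; simp [det_self] at hst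
  have hne' : v₀ ≠ v' := by
    rintro rfl; rw [det_swap] at hst; linarith
  have h1 := h.above v₀ hv₀ hne.symm hne'
  have h2 := hlow v h.left_mem hne
  have e : ((f v').re - (f v).re) * det (f v₀) (f v) =
      -((f v).re * orient (f v) (f v') (f v₀)) + ((f v).re - (f v₀).re) * det (f v) (f v') := by
    simp only [orient, det, Complex.sub_re, Complex.sub_im]; ring
  have := mul_neg_of_pos_of_neg (hZ v h.left_mem) h1
  have := mul_pos (sub_pos.2 h2) hdet
  have := (mul_pos_iff_of_pos_right hst).1 (by rw [e]; linarith)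
  linarith

/-- Hull edges point to the right of `w`. -/
theorem HullEdge.det_pos_right {f : V → ℂ} {Z : Set V} {v₀ v v' w : V}
    (h : HullEdge f Z v₀ v v') (hw : w ∈ Z)
    (hright : ∀ q ∈ Z, q ≠ w → 0 < det (f q) (f w)) : 0 < det (f w) (f v' - f v) := by
  have hdet := h.det_pos
  have hvw : v ≠ w := by
    rintro rfl
    have hne : v' ≠ v := by rintro rfl; simp [det_self] at hdet
    have := hright v' h.right_mem hne
    rw [det_swap] at this; linarith
  have h1 := hright v h.left_mem hvw
  rw [det_sub_right, det_swap (f w) (f v)]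
  by_cases hv'w : v' = w
  · rw [hv'w, det_self]; linarith
  have h2 := hright v' h.right_mem hv'w
  have h3 := h.above w hw (Ne.symm hvw) (Ne.symm hv'w)
  have e : orient (f v) (f v') (f w) = det (f v) (f v') + det (f v') (f w) - det (f v) (f w) := by
    rw [orient_eq, det_swap (f w)]; ring
  rw [det_swap (f w) (f v')]
  linarith


/-! ### Visibility in terms of transversal crossings -/

theorem crosses_properlyIntersect {a b c d : ℂ} (h : Crosses a b c d) :
    ProperlyIntersect a b c d := by
  obtain ⟨ρ, t, r0, r1, t0, t1, hx⟩ := h.exists_point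
  refine ⟨(1 - ρ) • a + ρ • b, Set.eq_singleton_iff_unique_mem.2 ⟨⟨?_, ?_⟩, ?_⟩⟩
  · exact ⟨1 - ρ, ρ, by linarith, r0, by ring, rfl⟩
  · exact ⟨1 - t, t, by linarith, t0, by ring, hx.symm⟩
  · rintro x ⟨⟨α, β, -, -, hαβ, rfl⟩, ⟨α', β', -, -, hαβ', hx'⟩⟩
    have e1 : orient c d ((1 - ρ) • a + ρ • b) = 0 := by
      rw [hx, orient_convex, orient_self, orient_self_right]; ring
    have e2 : orient c d (α • a + β • b) = 0 := by
      rw [← hx', orient_comb, orient_self, orient_self_right, ← hαβ']; ring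
    obtain rfl : α = 1 - β := by linarith
    rw [orient_convex] at e1 e2
    have hne : orient c d b - orient c d a ≠ 0 := by
      intro h0
      have : orient c d b = orient c d a := by linarith
      have h2 := h.2
      rw [this] at h2
      exact absurd h2 (not_lt.2 (mul_self_nonneg _))
    have : (β - ρ) * (orient c d b - orient c d a) = 0 := by linarith
    rcases mul_eq_zero.1 this with h0 | h0
    · rw [show β = ρ by linarith]
    · exact absurd h0 hne

theorem openSegment_ne_singleton {a b x : ℂ} (hab : a ≠ b) : openSegment ℝ a b ≠ {x} := by
  intro h
  have h1 : (1 / 2 : ℝ) • a + (1 / 2 : ℝ) • b ∈ openSegment ℝ a b :=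
    ⟨1 / 2, 1 / 2, by norm_num, by norm_num, by norm_num, rfl⟩
  have h2 : (1 / 3 : ℝ) • a + (2 / 3 : ℝ) • b ∈ openSegment ℝ a b :=
    ⟨1 / 3, 2 / 3, by norm_num, by norm_num, by norm_num, rfl⟩
  rw [h, Set.mem_singleton_iff] at h1 h2
  refine hab ?_
  have h3 := h1.trans h2.symm
  apply Complex.ext
  · have := congrArg Complex.re h3
    simp only [Complex.add_re, Complex.smul_re, smul_eq_mul] at this
    linarith
  · have := congrArg Complex.im h3
    simp only [Complex.add_im, Complex.smul_im, smul_eq_mul] at this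
    linarith

theorem ProperlyIntersect.symm_right {a b c d : ℂ} (h : ProperlyIntersect a b c d) :
    ProperlyIntersect a b d c := by
  obtain ⟨x, hx⟩ := h
  exact ⟨x, by rwa [openSegment_symm ℝ d c]⟩

/-- With no three points collinear, segments sharing an endpoint cannot meet properly, so the four
endpoints are distinct and all orientations nonzero; a common interior point then forces the sign
changes. -/
theorem crosses_of_properlyIntersect {f : V → ℂ} (hf : NoThreeCollinear f)
    (hinj : Function.Injective f) {a b c d : V} (hab : a ≠ b) (hcd : c ≠ d)
    (h : ProperlyIntersect (f a) (f b) (f c) (f d)) : Crosses (f a) (f b) (f c) (f d) := by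
  have share : ∀ a b d, a ≠ b → a ≠ d → ¬ ProperlyIntersect (f a) (f b) (f a) (f d) := by
    rintro a b d hab had ⟨x, hx⟩
    by_cases hbd : b = d
    · rw [hbd, Set.inter_self] at hx
      exact openSegment_ne_singleton (hinj.ne had) hx
    · have hmem : x ∈ openSegment ℝ (f a) (f b) ∩ openSegment ℝ (f a) (f d) := by
        rw [hx]; exact Set.mem_singleton x
      obtain ⟨⟨α, β, h1, h2, h3, h4⟩, ⟨α', β', h1', h2', h3', h4'⟩⟩ := hmem
      have e1 : orient (f a) (f b) x = 0 := by
        rw [← h4, orient_comb, orient_self, orient_self_right, ← h3]; ring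
      rw [← h4', orient_comb, orient_self, ← h3'] at e1
      have := hf a b d hab had hbd
      have e2 : β' * orient (f a) (f b) (f d) = 0 := by linarith
      exact (mul_ne_zero h2'.ne' this) e2
  have hac : a ≠ c := by
    rintro rfl; exact share a b d hab hcd h
  have had : a ≠ d := by
    rintro rfl; exact share a b c hab hcd.symm h.symm_right
  have hbc : b ≠ c := by
    rintro rfl; exact share b a d hab.symm hcd (properlyIntersect_swap_left h)
  have hbd : b ≠ d := by
    rintro rfl; exact share b a c hab.symm hcd.symm (properlyIntersect_swap_left h).symm_right
  obtain ⟨x, hx⟩ := h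
  have hmem : x ∈ openSegment ℝ (f a) (f b) ∩ openSegment ℝ (f c) (f d) := by
    rw [hx]; exact Set.mem_singleton x
  obtain ⟨⟨α, β, h1, h2, h3, h4⟩, ⟨α', β', h1', h2', h3', h4'⟩⟩ := hmem
  have key : ∀ {s t X Y : ℝ}, 0 < s → 0 < t → X ≠ 0 → s * X + t * Y = 0 → X * Y < 0 := by
    intro s t X Y hs ht hX he
    have e : t * (X * Y) = -(s * (X * X)) := by linear_combination X * he
    have := mul_pos hs (mul_self_pos.2 hX)
    exact neg_of_mul_neg_right (by linarith : t * (X * Y) < 0) ht.le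
  constructor
  · refine key h1' h2' (hf a b c hab hac hbc) ?_
    have e1 : orient (f a) (f b) x = 0 := by
      rw [← h4, orient_comb, orient_self, orient_self_right, ← h3]; ring
    rw [← h4', orient_comb, ← h3'] at e1
    linarith
  · refine key h1 h2 (hf c d a hcd hac.symm had.symm) ?_
    have e1 : orient (f c) (f d) x = 0 := by
      rw [← h4', orient_comb, orient_self, orient_self_right, ← h3']; ring
    rw [← h4, orient_comb, ← h3] at e1
    linarith

theorem collinear_of_orient_eq_zero {a b c : ℂ} (h : orient a b c = 0) :
    Collinear ℝ ({a, b, c} : Set ℂ) := by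
  by_cases hab : a = b
  · rw [hab, Set.insert_eq_of_mem (Set.mem_insert b {c})]; exact collinear_pair ℝ b c
  rw [collinear_iff_of_mem (p₀ := a) (by simp)]
  refine ⟨b - a, ?_⟩
  have hn : Complex.normSq (b - a) ≠ 0 := by
    rw [Ne, Complex.normSq_eq_zero, sub_eq_zero]; exact fun h => hab h.symm
  rintro x (rfl | rfl | rfl)
  · exact ⟨0, by simp⟩
  · exact ⟨1, by simp⟩
  · refine ⟨((x - a).re * (b - a).re + (x - a).im * (b - a).im) / Complex.normSq (b - a), ?_⟩
    have h' : (b - a).re * (x - a).im = (b - a).im * (x - a).re := by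
      simp only [orient, det] at h; linarith
    rw [Complex.normSq_apply] at *
    rw [vadd_eq_add, ← sub_eq_iff_eq_add]
    apply Complex.ext
    · rw [Complex.smul_re, smul_eq_mul, div_mul_eq_mul_div, eq_div_iff hn]
      linear_combination (-(b - a).im) * h'
    · rw [Complex.smul_im, smul_eq_mul, div_mul_eq_mul_div, eq_div_iff hn]
      linear_combination ((b - a).re) * h'

theorem GeneralPosition.noThreeCollinear {m : ℕ} {P : Finset ℂ} (h : GeneralPosition m P) :
    NoThreeCollinear (fun p : P => (p : ℂ)) := by
  intro a b c hab hac hbc h0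
  exact h.not_collinear a a.2 b b.2 c c.2 (fun h => hab (Subtype.ext h))
    (fun h => hac (Subtype.ext h)) (fun h => hbc (Subtype.ext h)) (collinear_of_orient_eq_zero h0)

/-- Constraints are edges of the visibility graph by definition; planarity is what makes them
uncrossed. -/
theorem visibilityGraph_adj_iff {P : Finset ℂ} {S : SimpleGraph P}
    (hP : NoThreeCollinear (fun p : P => (p : ℂ))) (hS : IsPlanar S) (u v : P) :
    (visibilityGraph S).Adj u v ↔ Sees (fun p : P => (p : ℂ)) S u v := by
  constructor
  · rintro ⟨h1, h2⟩
    refine ⟨h1, fun a b hab hc => ?_⟩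
    rcases h2 with h2 | h2
    · exact hS u v a b h2 hab (crosses_properlyIntersect hc)
    · exact h2 a b hab (crosses_properlyIntersect hc)
  · rintro ⟨h1, h2⟩
    exact ⟨h1, Or.inr fun a b hab hp =>
      h2 a b hab (crosses_of_properlyIntersect hP Subtype.val_injective h1 hab.ne hp)⟩

/-- Crossings involve only products of two orientations, so a common sign cancels. This transfers
visibility to direct and reflected frames alike. -/
theorem sees_iff_of_orient {f g : V → ℂ} {ε : ℝ} (hε : ε * ε = 1)
    (h : ∀ a b c, orient (f a) (f b) (f c) = ε * orient (g a) (g b) (g c)) (S : SimpleGraph V)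
    (u v : V) : Sees f S u v ↔ Sees g S u v := by
  have e : ∀ x y : ℝ, ε * x * (ε * y) = x * y := fun x y => by linear_combination (x * y) * hε
  unfold Sees Crosses
  simp only [h, e]

/-! ### Frames -/

/-- The coordinate systems attached to the cones: the real axis is the bisector of a cone, with
either orientation. -/
def IsFrame (m : ℕ) (F : ℂ → ℂ) : Prop :=
  ∃ i : Fin m, (F = fun z => z / bisectorDir m i) ∨
    F = fun z => (starRingEnd ℂ) (z / bisectorDir m i)

theorem norm_bisectorDir (m : ℕ) (i : Fin m) : ‖bisectorDir m i‖ = 1 := by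
  rw [bisectorDir, norm_mul, Complex.norm_I, one_mul, ← neg_mul, ← Complex.ofReal_neg,
    Complex.norm_exp_ofReal_mul_I]

theorem bisectorDir_ne_zero (m : ℕ) (i : Fin m) : bisectorDir m i ≠ 0 := by
  rw [← norm_ne_zero_iff, norm_bisectorDir]; exact one_ne_zero

/-- Every rotation of the vertical direction by a multiple of the aperture is a bisector. -/
theorem exists_bisectorDir {m : ℕ} (hm : 0 < m) (j : ℤ) :
    ∃ i : Fin m, bisectorDir m i = I * Complex.exp (-((((j : ℝ) * aperture m : ℝ) : ℂ) * I)) := by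
  have hm' : (m : ℤ) ≠ 0 := by exact_mod_cast hm.ne'
  have h0 : 0 ≤ j % m := Int.emod_nonneg _ hm'
  have h1 : j % m < m := Int.emod_lt_of_pos _ (by exact_mod_cast hm)
  refine ⟨⟨(j % m).toNat, by omega⟩, ?_⟩
  rw [bisectorDir]
  congr 1
  rw [Complex.exp_eq_exp_iff_exists_int]
  refine ⟨j / m, ?_⟩
  have e : (((j % m).toNat : ℕ) : ℝ) = (j : ℝ) - m * ((j / m : ℤ) : ℝ) := by
    have e2 : (((j % m).toNat : ℕ) : ℤ) = j - m * (j / m) := by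
      rw [Int.toNat_of_nonneg h0]; have := Int.emod_add_mul_ediv j m; linarith
    exact_mod_cast congrArg (fun n : ℤ => (n : ℝ)) e2
  simp only [e, aperture]
  push_cast
  have : (m : ℂ) ≠ 0 := by exact_mod_cast hm.ne'
  field_simp
  ring

namespace IsFrame

variable {m : ℕ} {F : ℂ → ℂ}

theorem norm (h : IsFrame m F) (z : ℂ) : ‖F z‖ = ‖z‖ := by
  obtain ⟨i, rfl | rfl⟩ := h
  · simp [norm_bisectorDir]
  · simp only [RCLike.norm_conj]; simp [norm_bisectorDir]

theorem sub (h : IsFrame m F) (z w : ℂ) : F (z - w) = F z - F w := by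
  obtain ⟨i, rfl | rfl⟩ := h
  · simp only [sub_div]
  · simp only [sub_div, map_sub]

theorem conj (h : IsFrame m F) : IsFrame m (fun z => (starRingEnd ℂ) (F z)) := by
  obtain ⟨i, rfl | rfl⟩ := h
  · exact ⟨i, Or.inr rfl⟩
  · exact ⟨i, Or.inl (by simp)⟩

theorem rotate (hm : 0 < m) (h : IsFrame m F) (j : ℤ) :
    IsFrame m (fun z => F z * Complex.exp (-((((j : ℝ) * aperture m : ℝ) : ℂ) * I))) := by
  obtain ⟨i, rfl | rfl⟩ := h
  · obtain ⟨i', hi'⟩ := exists_bisectorDir hm ((i : ℕ) - j : ℤ)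
    refine ⟨i', Or.inl ?_⟩
    funext z
    rw [hi', div_mul_eq_mul_div, div_eq_div_iff (bisectorDir_ne_zero m i)
      (by rw [← hi']; exact bisectorDir_ne_zero m i'), bisectorDir, mul_assoc, mul_left_comm _ I,
      ← Complex.exp_add]
    congr 3
    push_cast; ring_nf
  · obtain ⟨i', hi'⟩ := exists_bisectorDir hm ((i : ℕ) + j : ℤ)
    refine ⟨i', Or.inr ?_⟩
    funext z
    have e : Complex.exp (-((((j : ℝ) * aperture m : ℝ) : ℂ) * I)) =
        (starRingEnd ℂ) (Complex.exp (((((j : ℝ) * aperture m : ℝ) : ℂ) * I))) := by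
      rw [← Complex.exp_conj, map_mul, Complex.conj_ofReal, Complex.conj_I, mul_neg]
    rw [e, ← map_mul]
    congr 1
    rw [hi', div_mul_eq_mul_div, div_eq_div_iff (bisectorDir_ne_zero m i)
      (by rw [← hi']; exact bisectorDir_ne_zero m i'), bisectorDir, mul_assoc, mul_left_comm _ I,
      ← Complex.exp_add]
    congr 3
    push_cast; ring_nf

/-- Half a turn is 2k + 1 apertures, so the opposite of a cone is a cone; this allows an edge to be
measured from its other end. -/
theorem neg {k : ℕ} (h : IsFrame (4 * k + 2) F) : IsFrame (4 * k + 2) (fun z => -F z) := by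
  have := h.rotate (by omega) (2 * k + 1 : ℤ)
  convert this using 2 with z
  have e : (((2 * k + 1 : ℤ) : ℝ) * aperture (4 * k + 2)) = π := by
    rw [aperture]; push_cast
    have : (4 * (k : ℝ) + 2) ≠ 0 := by positivity
    field_simp; ring
  rw [e, Complex.exp_neg, Complex.exp_pi_mul_I]
  simp

theorem det (h : IsFrame m F) : ∃ ε : ℝ, ε * ε = 1 ∧
    ∀ a b, det (F a) (F b) = ε * ConstrainedTheta.det a b := by
  obtain ⟨i, rfl | rfl⟩ := h
  all_goals
    have hn : Complex.normSq (bisectorDir m i) = 1 := by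
      rw [Complex.normSq_eq_norm_sq, norm_bisectorDir, one_pow]
    have hn' := hn
    rw [Complex.normSq_apply] at hn'
  · refine ⟨1, by norm_num, fun a b => ?_⟩
    simp only [ConstrainedTheta.det, Complex.div_re, Complex.div_im, hn, div_one]
    linear_combination (a.re * b.im - a.im * b.re) * hn'
  · refine ⟨-1, by norm_num, fun a b => ?_⟩
    simp only [ConstrainedTheta.det, Complex.conj_re, Complex.conj_im, Complex.div_re,
      Complex.div_im, hn, div_one]
    linear_combination -(a.re * b.im - a.im * b.re) * hn'

theorem exists_orient (h : IsFrame m F) (o : ℂ) : ∃ ε : ℝ, ε * ε = 1 ∧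
    ∀ a b c, orient (F (a - o)) (F (b - o)) (F (c - o)) = ε * orient a b c := by
  obtain ⟨ε, h1, h2⟩ := h.det
  refine ⟨ε, h1, fun a b c => ?_⟩
  simp only [orient]
  rw [← h.sub, ← h.sub, h2, sub_sub_sub_cancel_right, sub_sub_sub_cancel_right]

end IsFrame

theorem finite_frames (m : ℕ) : {F : ℂ → ℂ | IsFrame m F}.Finite := by
  have : {F : ℂ → ℂ | IsFrame m F} =
      Set.range (fun (i : Fin m) z => z / bisectorDir m i) ∪
      Set.range (fun (i : Fin m) z => (starRingEnd ℂ) (z / bisectorDir m i)) := by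
    ext F
    simp only [IsFrame, Set.mem_ofPred_eq, Set.mem_union, Set.mem_range, exists_or, eq_comm]
  rw [this]
  exact (Set.finite_range _).union (Set.finite_range _)

/-! ### General position in frames -/

theorem GeneralPosition.frame_re_ne {m : ℕ} {P : Finset ℂ} (h : GeneralPosition m P) {F : ℂ → ℂ}
    (hF : IsFrame m F) {p q : P} (hpq : p ≠ q) : (F (q - p)).re ≠ 0 := by
  have hpq' : (p : ℂ) ≠ q := fun h => hpq (Subtype.ext h)
  obtain ⟨i, rfl | rfl⟩ := hF
  · exact h.not_perp_bisector p p.2 q q.2 hpq' i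
  · rw [Complex.conj_re]; exact h.not_perp_bisector p p.2 q q.2 hpq' i

theorem GeneralPosition.frame_im_ne {m : ℕ} (hm : 0 < m) {P : Finset ℂ} (h : GeneralPosition m P)
    {F : ℂ → ℂ} (hF : IsFrame m F) (hc : 0 < Real.cos (aperture m / 2)) {p q : P} (hpq : p ≠ q) :
    (F (q - p)).im ≠ Real.tan (aperture m / 2) * (F (q - p)).re := by
  have hpq' : (p : ℂ) ≠ q := fun h => hpq (Subtype.ext h)
  -- direct frames
  have main : ∀ i : Fin m, ∀ z : ℂ,
      (z / (bisectorDir m i * Complex.exp (((aperture m / 2 : ℝ) : ℂ) * I))).im ≠ 0 →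
      (z / bisectorDir m i).im ≠ Real.tan (aperture m / 2) * (z / bisectorDir m i).re := by
    intro i z hz he
    apply hz
    rw [← div_div, div_eq_mul_inv (z / _), ← Complex.exp_neg, ← neg_mul, ← Complex.ofReal_neg,
      Complex.mul_im, Complex.exp_ofReal_mul_I_im, Complex.exp_ofReal_mul_I_re, Real.cos_neg,
      Real.sin_neg, he, Real.tan_eq_sin_div_cos]
    field_simp
    ring
  obtain ⟨i, rfl | rfl⟩ := hF
  · exact main i _ (h.not_parallel_ray p p.2 q q.2 hpq' i)
  -- General position names only the boundary ray at angle +y of each cone; the ray at −y of cone i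
  -- is the ray at +y of cone i + 1.
  · obtain ⟨i', hi'⟩ := exists_bisectorDir hm ((i : ℕ) + 1 : ℤ)
    have h1 := h.not_parallel_ray p p.2 q q.2 hpq' i'
    have e : bisectorDir m i' * Complex.exp (((aperture m / 2 : ℝ) : ℂ) * I) =
        bisectorDir m i * Complex.exp (((-(aperture m / 2) : ℝ) : ℂ) * I) := by
      rw [hi', bisectorDir, mul_assoc, mul_assoc, ← Complex.exp_add, ← Complex.exp_add]
      congr 2
      push_cast; ring
    rw [e] at h1
    intro he
    apply h1
    rw [← div_div, div_eq_mul_inv (_ / bisectorDir m i), ← Complex.exp_neg, ← neg_mul,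
      ← Complex.ofReal_neg, neg_neg, Complex.mul_im, Complex.exp_ofReal_mul_I_im,
      Complex.exp_ofReal_mul_I_re]
    simp only [Complex.conj_im, Complex.conj_re] at he
    rw [neg_eq_iff_eq_neg.1 he, Real.tan_eq_sin_div_cos]
    field_simp
    ring

/-! ### Angles and determinants -/

theorem arg_mem_of_re_pos {z : ℂ} (h : 0 < z.re) : z.arg ∈ Set.Ioo (-(π / 2)) (π / 2) := by
  have := Complex.abs_arg_lt_pi_div_two_iff.2 (Or.inl h)
  exact abs_lt.1 this

theorem arg_lt_arg_iff {a b : ℂ} (ha : 0 < a.re) (hb : 0 < b.re) :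
    a.arg < b.arg ↔ 0 < det a b := by
  rw [← Real.strictMonoOn_tan.lt_iff_lt (arg_mem_of_re_pos ha) (arg_mem_of_re_pos hb),
    Complex.tan_arg, Complex.tan_arg, div_lt_div_iff₀ ha hb, det]
  constructor <;> intro h <;> linarith

theorem abs_arg_le_iff {y : ℝ} (hy0 : 0 < y) (hy : y < π / 2) {z : ℂ} (hz : z ≠ 0) :
    |z.arg| ≤ y ↔ |z.im| ≤ Real.tan y * z.re := by
  have hmem : y ∈ Set.Ioo (-(π / 2)) (π / 2) := ⟨by linarith, hy⟩
  have hmem' : -y ∈ Set.Ioo (-(π / 2)) (π / 2) := ⟨by linarith, by linarith⟩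
  have aux : 0 < z.re → (|z.arg| ≤ y ↔ |z.im| ≤ Real.tan y * z.re) := by
    intro hre
    rw [abs_le, abs_le, ← Real.strictMonoOn_tan.le_iff_le hmem' (arg_mem_of_re_pos hre),
      ← Real.strictMonoOn_tan.le_iff_le (arg_mem_of_re_pos hre) hmem, Complex.tan_arg,
      Real.tan_neg, div_le_iff₀ hre, le_div_iff₀ hre, neg_mul]
  constructor
  · intro h
    have hre : 0 < z.re := by
      rcases Complex.abs_arg_lt_pi_div_two_iff.1 (lt_of_le_of_lt h hy) with h | h
      · exact h
      · exact absurd h hz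
    exact (aux hre).1 h
  · intro h
    have hre : 0 < z.re := by
      have h1 : 0 ≤ Real.tan y * z.re := (abs_nonneg _).trans h
      have ht := Real.tan_pos_of_pos_of_lt_pi_div_two hy0 hy
      rcases lt_trichotomy z.re 0 with h2 | h2 | h2
      · exact absurd h1 (not_le.2 (mul_neg_of_pos_of_neg ht h2))
      · exfalso
        rw [h2, mul_zero] at h
        exact hz (Complex.ext h2 (abs_eq_zero.1 (le_antisymm h (abs_nonneg _))))
      · exact h2
    exact (aux hre).2 h


/-! ### Arcs of the constrained theta-graph -/

theorem re_pos_of_between {a b z : ℂ} (ha : 0 < a.re) (hb : 0 < b.re) (hab : 0 < det a b)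
    (h1 : 0 < det a z) (h2 : 0 < det z b) : 0 < z.re := by
  have e : z.re * det a b = det z b * a.re + det a z * b.re := by simp only [det]; ring
  exact (mul_pos_iff_of_pos_right hab).1 (by rw [e]; positivity)

/-- A constraint with end `u` separates the directions of `q` and `w`. -/
def Separates {V : Type*} (f : V → ℂ) (S : SimpleGraph V) (u q w : V) : Prop :=
  ∃ z, S.Adj u z ∧ (0 < det (f q) (f w) ∧ 0 < det (f q) (f z) ∧ 0 < det (f z) (f w) ∨
    0 < det (f w) (f q) ∧ 0 < det (f w) (f z) ∧ 0 < det (f z) (f q))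

theorem re_pos_of_cone {T : ℝ} (hT : 0 < T) {z : ℂ} (hz : z ≠ 0) (h : |z.im| ≤ T * z.re) :
    0 < z.re := by
  have h1 : 0 ≤ T * z.re := (abs_nonneg _).trans h
  refine lt_of_le_of_ne ((mul_nonneg_iff_of_pos_left hT).1 h1) fun h0 => hz ?_
  rw [← h0, mul_zero] at h
  exact Complex.ext h0.symm (abs_eq_zero.1 (le_antisymm h (abs_nonneg _)))

theorem coneCoord_ne_zero {m : ℕ} (i : Fin m) {P : Finset ℂ} {u v : P} (h : u ≠ v) :
    coneCoord m i u v ≠ 0 :=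
  div_ne_zero (sub_ne_zero.2 fun e => h (Subtype.ext e.symm)) (bisectorDir_ne_zero m i)

theorem mem_cone_iff {m : ℕ} (hy0 : 0 < aperture m / 2) (hy : aperture m / 2 < π / 2) (i : Fin m)
    {P : Finset ℂ} {u v : P} (h : u ≠ v) : (v : ℂ) ∈ cone m i u ↔
      |(coneCoord m i u v).im| ≤ Real.tan (aperture m / 2) * (coneCoord m i u v).re :=
  abs_arg_le_iff hy0 hy (coneCoord_ne_zero i h)

/-- The subcone is bounded by the last splitting angle α up to both v and w and by the next one β.
Since no constraint runs strictly between v and w, it contains both, and none of its vertices is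
separated from w. -/
theorem thetaArc_of_lowest_coneCoord {m : ℕ} (hy0 : 0 < aperture m / 2)
    (hy : aperture m / 2 < π / 2) {P : Finset ℂ} {S : SimpleGraph P} (i : Fin m) {u w v : P}
    (huw : u ≠ w)
    (hw : |(coneCoord m i u w).im| < Real.tan (aperture m / 2) * (coneCoord m i u w).re)
    (hv : |(coneCoord m i u v).im| ≤ Real.tan (aperture m / 2) * (coneCoord m i u v).re)
    (hvis : (visibilityGraph S).Adj u v)
    (hsep : ¬ Separates (fun p : P => coneCoord m i u p) S u v w)
    (hlow : ∀ q : P, (visibilityGraph S).Adj u q →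
      |(coneCoord m i u q).im| ≤ Real.tan (aperture m / 2) * (coneCoord m i u q).re →
      ¬ Separates (fun p : P => coneCoord m i u p) S u q w →
      (coneCoord m i u v).re ≤ (coneCoord m i u q).re) :
    ThetaArc m S u v := by
  classical
  set y := aperture m / 2 with hydef
  have hT : 0 < Real.tan y := Real.tan_pos_of_pos_of_lt_pi_div_two hy0 hy
  set g : P → ℂ := fun p => coneCoord m i u p with hg
  have hne : ∀ p, u ≠ p → g p ≠ 0 := fun p h => coneCoord_ne_zero i h
  have hcone : ∀ p : P, u ≠ p → ((p : ℂ) ∈ cone m i u ↔ |(g p).im| ≤ Real.tan y * (g p).re) :=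
    fun p h => mem_cone_iff hy0 hy i h
  have hwre : 0 < (g w).re := re_pos_of_cone hT (hne w huw) hw.le
  have hvre : 0 < (g v).re := re_pos_of_cone hT (hne v hvis.1) hv
  have haw : (g w).arg < y := by
    have h1 : (g w).im < Real.tan y * (g w).re := lt_of_le_of_lt (le_abs_self _) hw
    have hmem : y ∈ Set.Ioo (-(π / 2)) (π / 2) := ⟨by linarith, hy⟩
    rwa [← Real.strictMonoOn_tan.lt_iff_lt (arg_mem_of_re_pos hwre) hmem, Complex.tan_arg,
      div_lt_iff₀ hwre]
  have haw' : |(g w).arg| ≤ y := (abs_arg_le_iff hy0 hy (hne w huw)).2 hw.le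
  have hav : |(g v).arg| ≤ y := (abs_arg_le_iff hy0 hy (hne v hvis.1)).2 hv
  set lo := min (g v).arg (g w).arg with hlo
  set hi := max (g v).arg (g w).arg with hhi
  let A := splitAngles m S i u
  have hfin : A.Finite := by
    refine Set.Finite.union (Set.toFinite _) ?_
    refine (Set.finite_range (fun p : P => (g p).arg)).subset ?_
    rintro φ ⟨p, -, -, rfl⟩
    exact ⟨p, rfl⟩
  have hbound : ∀ γ ∈ A, |γ| ≤ y := by
    rintro γ ((rfl | rfl) | ⟨p, -, hp, rfl⟩)
    · rw [abs_neg, abs_of_pos hy0]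
    · rw [abs_of_pos hy0]
    · exact hp
  have hlo1 : -y ≤ lo := le_min (abs_le.1 hav).1 (abs_le.1 haw').1
  have hlo2 : lo < y := lt_of_le_of_lt (min_le_right _ _) haw
  have hhi2 : hi ≤ y := max_le (abs_le.1 hav).2 (abs_le.1 haw').2
  obtain ⟨α, ⟨hαA, hαlo⟩, hα⟩ := (hfin.subset (Set.sep_subset A (· ≤ lo))).exists_maximal
    ⟨-y, Or.inl (Or.inl rfl), hlo1⟩
  -- The strict inequality gives α < β even if v or w lies on a splitting ray; the angle y qualifies
  -- because w is strictly inside the cone.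
  obtain ⟨β, ⟨hβA, hβlo⟩, hβ⟩ := (hfin.subset (Set.sep_subset A (lo < ·))).exists_minimal
    ⟨y, Or.inl (Or.inr rfl), hlo2⟩
  have hbetween : ∀ γ ∈ A, ¬ (α < γ ∧ γ < β) := by
    rintro γ hγ ⟨h1, h2⟩
    rcases le_or_gt γ lo with h | h
    · exact absurd (hα ⟨hγ, h⟩ h1.le) (not_le.2 h1)
    · exact absurd (hβ ⟨hγ, h⟩ h2.le) (not_le.2 h2)
  have hsplit : ∀ z : P, S.Adj u z → |(g z).arg| ≤ y → (g z).arg ∈ A :=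
    fun z hz ha => Or.inr ⟨z, hz, ha, rfl⟩
  -- Otherwise β is the angle of a constraint strictly between v and w.
  have hβhi : hi ≤ β := by
    by_contra hcon
    have hcon := not_le.1 hcon
    rcases hβA with (h | h) | ⟨z, hz, hzc, h⟩
    · change lo < β at hβlo; change β = -y at h; linarith
    · change β = y at h; linarith
    · change β = (g z).arg at h
      have hzre := re_pos_of_cone hT (hne z hz.ne) ((hcone z hz.ne).1 hzc)
      change lo < β at hβlo
      rw [h] at hβlo hcon
      refine hsep ⟨z, hz, ?_⟩
      rcases le_total (g v).arg (g w).arg with hle | hle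
      · rw [hlo, min_eq_left hle] at hβlo
        rw [hhi, max_eq_right hle] at hcon
        exact Or.inl ⟨(arg_lt_arg_iff hvre hwre).1 (hβlo.trans hcon),
          (arg_lt_arg_iff hvre hzre).1 hβlo, (arg_lt_arg_iff hzre hwre).1 hcon⟩
      · rw [hlo, min_eq_right hle] at hβlo
        rw [hhi, max_eq_left hle] at hcon
        exact Or.inr ⟨(arg_lt_arg_iff hwre hvre).1 (hβlo.trans hcon),
          (arg_lt_arg_iff hwre hzre).1 hβlo, (arg_lt_arg_iff hzre hvre).1 hcon⟩
  have hαβ : α < β := lt_of_le_of_lt hαlo hβlo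
  refine ⟨hvis, i, _, ⟨α, hαA, β, hβA, hαβ, hbetween, rfl⟩, ⟨(hcone v hvis.1).2 hv, ?_, ?_⟩, ?_⟩
  · exact hαlo.trans (min_le_left _ _)
  · exact (le_max_left _ _).trans hβhi
  · rintro q ⟨hqc, hq1, hq2⟩ hq
    have hqc' := (hcone q hq.1).1 hqc
    refine hlow q hq hqc' ?_
    rintro ⟨z, hz, hzs⟩
    have hqre := re_pos_of_cone hT (hne q hq.1) hqc'
    change α ≤ (g q).arg at hq1
    change (g q).arg ≤ β at hq2
    have hw1 : α ≤ (g w).arg := hαlo.trans (min_le_right _ _)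
    have hw2 : (g w).arg ≤ β := (le_max_right _ _).trans hβhi
    have hy1 := (abs_le.1 (hbound α hαA)).1
    have hy2 := (abs_le.1 (hbound β hβA)).2
    rcases hzs with ⟨h1, h2, h3⟩ | ⟨h1, h2, h3⟩
    · have hzre := re_pos_of_between hqre hwre h1 h2 h3
      have a1 := (arg_lt_arg_iff hqre hzre).2 h2
      have a2 := (arg_lt_arg_iff hzre hwre).2 h3
      exact hbetween _ (hsplit z hz (abs_le.2 ⟨by linarith, by linarith⟩))
        ⟨by linarith, by linarith⟩
    · have hzre := re_pos_of_between hwre hqre h1 h2 h3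
      have a1 := (arg_lt_arg_iff hwre hzre).2 h2
      have a2 := (arg_lt_arg_iff hzre hqre).2 h3
      exact hbetween _ (hsplit z hz (abs_le.2 ⟨by linarith, by linarith⟩))
        ⟨by linarith, by linarith⟩

theorem det_conj (a b : ℂ) : det ((starRingEnd ℂ) a) ((starRingEnd ℂ) b) = det b a := by
  simp only [det, Complex.conj_re, Complex.conj_im]; ring

theorem separates_conj {V : Type*} {f : V → ℂ} {S : SimpleGraph V} {u q w : V} :
    Separates (fun p => (starRingEnd ℂ) (f p)) S u q w ↔ Separates f S u q w := by
  unfold Separates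
  simp only [det_conj]
  refine exists_congr fun z => and_congr_right fun _ => ?_
  constructor <;> rintro (⟨h1, h2, h3⟩ | ⟨h1, h2, h3⟩)
  · exact Or.inr ⟨h1, h3, h2⟩
  · exact Or.inl ⟨h1, h3, h2⟩
  · exact Or.inr ⟨h1, h3, h2⟩
  · exact Or.inl ⟨h1, h3, h2⟩

/-- In any frame, the lowest visible vertex of a cone that no constraint separates from `w` is an
endpoint of an arc from `u`. -/
theorem thetaArc_of_lowest {m : ℕ} (hy0 : 0 < aperture m / 2)
    (hy : aperture m / 2 < π / 2) {P : Finset ℂ} {S : SimpleGraph P} {F : ℂ → ℂ}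
    (hF : IsFrame m F) {u w v : P} (huw : u ≠ w)
    (hw : |(F (w - u)).im| < Real.tan (aperture m / 2) * (F (w - u)).re)
    (hv : |(F (v - u)).im| ≤ Real.tan (aperture m / 2) * (F (v - u)).re)
    (hvis : (visibilityGraph S).Adj u v)
    (hsep : ¬ Separates (fun p : P => F (p - u)) S u v w)
    (hlow : ∀ q : P, (visibilityGraph S).Adj u q →
      |(F (q - u)).im| ≤ Real.tan (aperture m / 2) * (F (q - u)).re →
      ¬ Separates (fun p : P => F (p - u)) S u q w → (F (v - u)).re ≤ (F (q - u)).re) :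
    ThetaArc m S u v := by
  obtain ⟨i, rfl | rfl⟩ := hF
  · exact thetaArc_of_lowest_coneCoord hy0 hy i huw hw hv hvis hsep hlow
  · simp only [Complex.conj_re, Complex.conj_im, abs_neg] at hw hv hlow
    have e : ∀ q, ¬ Separates (fun p : P => coneCoord m i u p) S u q w →
        ¬ Separates (fun p : P => (starRingEnd ℂ) ((p - u : ℂ) / bisectorDir m i)) S u q w :=
      fun q h h' => h (separates_conj.1 h')
    refine thetaArc_of_lowest_coneCoord hy0 hy i huw hw hv hvis ?_ fun q hq hqc hqs =>
      hlow q hq hqc (e q hqs)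
    exact fun h => hsep (separates_conj.2 h)

/-! ### Paths of bounded length -/

/-- There is a walk of length at most `r` from `u` to `v`. -/
def Reach {P : Finset ℂ} (G : SimpleGraph P) (u v : P) (r : ℝ) : Prop :=
  ∃ p : G.Walk u v, walkLength p ≤ r

namespace Reach

variable {P : Finset ℂ} {G : SimpleGraph P} {u v w : P} {r s : ℝ}

theorem refl (u : P) : Reach G u u 0 := ⟨SimpleGraph.Walk.nil, by simp [walkLength]⟩

theorem mono (h : Reach G u v r) (hrs : r ≤ s) : Reach G u v s := by
  obtain ⟨p, hp⟩ := h; exact ⟨p, hp.trans hrs⟩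

theorem trans (h : Reach G u v r) (h' : Reach G v w s) : Reach G u w (r + s) := by
  obtain ⟨p, hp⟩ := h
  obtain ⟨q, hq⟩ := h'
  refine ⟨p.append q, ?_⟩
  have : walkLength (p.append q) = walkLength p + walkLength q := by
    simp [walkLength, SimpleGraph.Walk.darts_append]
  rw [this]; exact add_le_add hp hq

theorem symm (h : Reach G u v r) : Reach G v u r := by
  obtain ⟨p, hp⟩ := h
  refine ⟨p.reverse, le_trans (le_of_eq ?_) hp⟩
  simp only [walkLength, SimpleGraph.Walk.darts_reverse, List.map_reverse, List.map_map,
    List.sum_reverse]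
  congr 2
  funext d
  simp [dist_comm]

theorem of_adj (h : G.Adj u v) : Reach G u v (dist (u : ℂ) v) :=
  ⟨SimpleGraph.Walk.cons h SimpleGraph.Walk.nil, by simp [walkLength]⟩

theorem graphDist_le (h : Reach G u v r) : graphDist G u v ≤ ENNReal.ofReal r := by
  obtain ⟨p, hp⟩ := h
  exact (iInf_le _ p).trans (ENNReal.ofReal_le_ofReal hp)

end Reach

/-- A bound on the stretch of edges gives a bound on the stretch of all distances. -/
theorem isSpanner_of_adj {P : Finset ℂ} {G H : SimpleGraph P} {t : ℝ} (ht : 0 < t) (hHG : H ≤ G)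
    (h : ∀ u v, G.Adj u v → Reach H u v (t * dist (u : ℂ) v)) : IsSpanner t H G := by
  refine ⟨hHG, fun u v => ?_⟩
  have key : ∀ {u v : P} (p : G.Walk u v), Reach H u v (t * walkLength p) := by
    intro u v p
    induction p with
    | nil => exact (Reach.refl _).mono (by simp [walkLength])
    | cons hadj p ih =>
      refine ((h _ _ hadj).trans ih).mono (le_of_eq ?_)
      simp [walkLength, mul_add]
  unfold graphDist
  rw [ENNReal.mul_iInf_of_ne (by simpa using ht) ENNReal.ofReal_ne_top]
  refine le_iInf fun p => ?_
  rw [← ENNReal.ofReal_mul ht.le]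
  exact (key p).graphDist_le

/-! ### Trigonometry -/

/-- As a function of the angle a, the cost κ·cos a + sin a is a positive multiple of cos(a − (π/2 −
y)/2). The hypotheses say that g is at least as close as b to the maximum at (π/2 − y)/2. -/
theorem cost_mono {y b g : ℝ} (hy0 : 0 < y) (hy : y < π / 2) (hb : 0 ≤ b) (hbg : b ≤ g)
    (hs : b + g ≤ π / 2 - y) :
    (1 + Real.sin y) / Real.cos y * Real.cos b + Real.sin b ≤
      (1 + Real.sin y) / Real.cos y * Real.cos g + Real.sin g := by
  have hc : 0 < Real.cos y := Real.cos_pos_of_mem_Ioo ⟨by linarith, hy⟩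
  have e : ∀ a, (1 + Real.sin y) / Real.cos y * Real.cos a + Real.sin a =
      (Real.cos a + Real.sin (a + y)) / Real.cos y := by
    intro a; rw [Real.sin_add]; field_simp; ring
  rw [e, e]
  refine div_le_div_of_nonneg_right ?_ hc.le
  have e2 : (Real.cos g + Real.sin (g + y)) - (Real.cos b + Real.sin (b + y)) =
      2 * Real.sin ((g - b) / 2) * (Real.cos ((g + b) / 2 + y) - Real.sin ((g + b) / 2)) := by
    have h1 := Real.cos_sub_cos g b
    have h2 := Real.sin_sub_sin (g + y) (b + y)
    have h3 : (g + y - (b + y)) / 2 = (g - b) / 2 := by ring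
    have h4 : (g + y + (b + y)) / 2 = (g + b) / 2 + y := by ring
    rw [h3, h4] at h2
    linarith
  have h1 : 0 ≤ Real.sin ((g - b) / 2) :=
    Real.sin_nonneg_of_nonneg_of_le_pi (by linarith) (by linarith [Real.pi_pos])
  have h2 : Real.sin ((g + b) / 2) ≤ Real.cos ((g + b) / 2 + y) := by
    rw [← Real.cos_pi_div_two_sub]
    exact Real.cos_le_cos_of_nonneg_of_le_pi (by linarith) (by linarith [Real.pi_pos]) (by linarith)
  have := mul_nonneg (mul_nonneg zero_le_two h1) (sub_nonneg.2 h2)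
  linarith

/-- The symmetry a ↦ π/2 − y − a of the cost. -/
theorem cost_reflect {y g : ℝ} (hy0 : 0 < y) (hy : y < π / 2) :
    (1 + Real.sin y) / Real.cos y * Real.cos (g - (π / 2 - y)) - Real.sin (g - (π / 2 - y)) =
      (1 + Real.sin y) / Real.cos y * Real.cos g + Real.sin g := by
  have hc : 0 < Real.cos y := Real.cos_pos_of_mem_Ioo ⟨by linarith, hy⟩
  have e : g - (π / 2 - y) = (g + y) - π / 2 := by ring
  rw [e, Real.cos_sub_pi_div_two, Real.sin_sub_pi_div_two, Real.sin_add, Real.cos_add]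
  field_simp
  linear_combination (Real.cos g) * Real.sin_sq_add_cos_sq y

/-- No point of the canonical triangle is farther from the apex than the length re/cos y of a side,
and the left walk contains a whole side. -/
theorem norm_le_cost {y : ℝ} (hy0 : 0 < y) (hy : y < π / 2) {z : ℂ}
    (h : |z.im| ≤ Real.tan y * z.re) :
    ‖z‖ ≤ (1 + Real.sin y) / Real.cos y * z.re + z.im := by
  have hc : 0 < Real.cos y := Real.cos_pos_of_mem_Ioo ⟨by linarith, hy⟩
  have hT : 0 < Real.tan y := Real.tan_pos_of_pos_of_lt_pi_div_two hy0 hy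
  have hre : 0 ≤ z.re := (mul_nonneg_iff_of_pos_left hT).1 ((abs_nonneg _).trans h)
  have e : (1 + Real.sin y) / Real.cos y = 1 / Real.cos y + Real.tan y := by
    rw [Real.tan_eq_sin_div_cos]; ring
  have h1 : z.re / Real.cos y ≤ (1 + Real.sin y) / Real.cos y * z.re + z.im := by
    rw [e]; have := (abs_le.1 h).1
    calc z.re / Real.cos y = 1 / Real.cos y * z.re := by ring
      _ ≤ _ := by linarith
  refine le_trans ?_ h1
  rw [← abs_of_nonneg (div_nonneg hre hc.le), ← sq_le_sq₀ (norm_nonneg _) (abs_nonneg _), sq_abs,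
    Complex.sq_norm, Complex.normSq_apply, div_pow, le_div_iff₀ (by positivity)]
  have h2 : z.im * z.im ≤ (Real.tan y * z.re) ^ 2 := by
    rw [← sq, ← sq_abs]; exact pow_le_pow_left₀ (abs_nonneg _) h 2
  have h3 : Real.tan y * Real.cos y = Real.sin y := Real.tan_mul_cos hc.ne'
  have h4 : (Real.tan y * z.re) ^ 2 * Real.cos y ^ 2 = Real.sin y ^ 2 * z.re ^ 2 := by
    rw [← h3]; ring
  have h5 := mul_le_mul_of_nonneg_right h2 (sq_nonneg (Real.cos y))
  have h6 := Real.sin_sq_add_cos_sq y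
  nlinarith

/-- The worst direction is the boundary of the cone, where the cost is 1 + 2 sin y. The comparison
of two angles at most y by `cost_mono` needs 3y ≤ π/2. -/
theorem cost_le_stretch {y : ℝ} (hy0 : 0 < y) (hy : y ≤ π / 6) {z : ℂ} (hz : z ≠ 0)
    (h : |z.im| ≤ Real.tan y * z.re) :
    (1 + Real.sin y) / Real.cos y * z.re + |z.im| ≤ (1 + 2 * Real.sin y) * ‖z‖ := by
  have hy' : y < π / 2 := by linarith [Real.pi_pos]
  have hc : 0 < Real.cos y := Real.cos_pos_of_mem_Ioo ⟨by linarith, hy'⟩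
  have ha := (abs_arg_le_iff hy0 hy' hz).2 h
  have h1 := cost_mono hy0 hy' (abs_nonneg z.arg) ha (by linarith)
  have h2 : (1 + Real.sin y) / Real.cos y * Real.cos y + Real.sin y = 1 + 2 * Real.sin y := by
    field_simp; ring
  rw [h2] at h1
  have h3 := mul_le_mul_of_nonneg_right h1 (norm_nonneg z)
  have e1 : z.re = ‖z‖ * Real.cos |z.arg| := by rw [Real.cos_abs, Complex.norm_mul_cos_arg]
  have e2 : |z.im| = ‖z‖ * Real.sin |z.arg| := by
    rw [← Complex.norm_mul_sin_arg z, abs_mul, abs_norm,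
      Real.abs_sin_eq_sin_abs_of_abs_le_pi (by linarith [Real.pi_pos])]
  rw [e2]
  nth_rewrite 1 [e1]
  linarith


/-! ### The visible vertices of a cone on one side of `w` -/

theorem cone_comb {T α β : ℝ} {a b : ℂ} (hα : 0 ≤ α) (hβ : 0 ≤ β) (ha : |a.im| ≤ T * a.re)
    (hb : |b.im| ≤ T * b.re) : |(α • a + β • b).im| ≤ T * (α • a + β • b).re := by
  obtain ⟨a1, a2⟩ := abs_le.1 ha
  obtain ⟨b1, b2⟩ := abs_le.1 hb
  simp only [Complex.add_re, Complex.add_im, Complex.smul_re, Complex.smul_im, smul_eq_mul]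
  rw [abs_le]
  constructor <;> nlinarith

/-- The vertices `q` that see `u`, lie in the cone, are not to the right of `w`, and are not
separated from `w` by a constraint. -/
def sector (T : ℝ) (f : V → ℂ) (S : SimpleGraph V) (u w : V) : Set V :=
  {q | Sees f S u q ∧ |(f q).im| ≤ T * (f q).re ∧ (q = w ∨ 0 < det (f q) (f w)) ∧
    ∀ z, S.Adj u z → ¬ (0 < det (f q) (f z) ∧ 0 < det (f z) (f w))}

section Sector

variable {T : ℝ} {f : V → ℂ} {S : SimpleGraph V} {u w : V}

theorem re_pos_of_sees (hT : 0 < T) (hinj : Function.Injective f) (hu : f u = 0) {q : V}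
    (hq : Sees f S u q) (hc : |(f q).im| ≤ T * (f q).re) : 0 < (f q).re :=
  re_pos_of_cone hT (fun h => hq.1 (hinj (hu.trans h.symm))) hc

theorem sector_re_pos (hT : 0 < T) (hinj : Function.Injective f) (hu : f u = 0) :
    ∀ q ∈ sector T f S u w, 0 < (f q).re :=
  fun _ hq => re_pos_of_sees hT hinj hu hq.1 hq.2.1

/-- As v' is not to the right of w, a constraint between v and v' would separate v from w. -/
theorem sector_no_constraint (hT : 0 < T) (hinj : Function.Injective f) (hu : f u = 0)
    (hw : 0 < (f w).re) {v v' : V} (hv : v ∈ sector T f S u w) (hv' : v' ∈ sector T f S u w)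
    (h : 0 < det (f v) (f v')) :
    ∀ z, S.Adj u z → ¬ (0 < det (f v) (f z) ∧ 0 < det (f z) (f v')) := by
  rintro z hz ⟨h1, h2⟩
  have hv're := sector_re_pos hT hinj hu v' hv'
  have hzre := re_pos_of_between (sector_re_pos hT hinj hu v hv) hv're h h1 h2
  refine hv.2.2.2 z hz ⟨h1, ?_⟩
  rcases hv'.2.2.1 with rfl | h3
  · exact h2
  · exact det_pos_trans hzre hv're hw h2 h3

/-- A vertex of the triangle that sees u would belong to the sector, by convexity of the cone, yet
lie below the hull; `triangle_empty` then excludes hidden vertices too. -/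
theorem hullEdge_empty [Finite V] (hf : NoThreeCollinear f) (hT : 0 < T)
    (hinj : Function.Injective f) (hu : f u = 0) (hw : 0 < (f w).re) {v₀ v v' : V}
    (h : HullEdge f (sector T f S u w) v₀ v v') :
    ∀ p, 0 < det (f v) (f p) → 0 < det (f p) (f v') → ¬ 0 < orient (f v) (f v') (f p) := by
  have hv := h.left_mem
  have hv' := h.right_mem
  have hvre := sector_re_pos hT hinj hu v hv
  have hv're := sector_re_pos hT hinj hu v' hv'
  refine triangle_empty hf hu hv.1 hv'.1 h.det_pos fun q hq h1 h2 h3 => ?_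
  have hqc : |(f q).im| ≤ T * (f q).re := by
    rw [comb_of_det_ne_zero h.det_pos.ne' (f q)]
    exact cone_comb (div_pos h2 h.det_pos).le (div_pos h1 h.det_pos).le hv.2.1 hv'.2.1
  have hqre := re_pos_of_sees hT hinj hu hq hqc
  have hqw : 0 < det (f q) (f w) := by
    rcases hv'.2.2.1 with rfl | h4
    · exact h2
    · exact det_pos_trans hqre hv're hw h2 h4
  have hqZ : q ∈ sector T f S u w := by
    refine ⟨hq, hqc, Or.inr hqw, fun z hz => ?_⟩
    rintro ⟨h5, h6⟩
    have hzre := re_pos_of_between hqre hw hqw h5 h6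
    exact hv.2.2.2 z hz ⟨det_pos_trans hvre hqre hzre h1 h5, h6⟩
  have hqv : q ≠ v := by rintro rfl; simp [det_self] at h1
  have hqv' : q ≠ v' := by rintro rfl; simp [det_self] at h2
  linarith [h.above q hqZ hqv hqv']

theorem hullEdge_sees [Finite V] (hf : NoThreeCollinear f) (hT : 0 < T)
    (hinj : Function.Injective f) (hu : f u = 0) (hw : 0 < (f w).re) {v₀ v v' : V}
    (h : HullEdge f (sector T f S u w) v₀ v v') : Sees f S v v' :=
  sees_of_triangle_empty hf hu h.left_mem.1 h.right_mem.1 h.det_pos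
    (hullEdge_empty hf hT hinj hu hw h)
    (sector_no_constraint hT hinj hu hw h.left_mem h.right_mem h.det_pos)

/-- Below a hull edge and to the left of its right end `v'`, no vertex on the right side of the
left boundary of the cone sees `v'`. -/
theorem hullEdge_clear_left [Finite V] (hf : NoThreeCollinear f) (hT : 0 < T)
    (hinj : Function.Injective f) (hu : f u = 0) (hw : 0 < (f w).re) {v₀ v v' : V}
    (h : HullEdge f (sector T f S u w) v₀ v v') {p : V} (hp : Sees f S v' p)
    (h1 : 0 < det (f p) (f v')) (h2 : 0 < (f p).im + T * (f p).re)
    (h3 : 0 < orient (f v) (f v') (f p)) : False := by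
  have hv := h.left_mem
  have hv' := h.right_mem
  have hv're := sector_re_pos hT hinj hu v' hv'
  have hpu : u ≠ p := by rintro rfl; rw [hu] at h1; simp [det] at h1
  have hpv : v ≠ p := by rintro rfl; rw [orient_self] at h3; exact lt_irrefl _ h3
  rcases lt_trichotomy (det (f v) (f p)) 0 with h4 | h4 | h4
  -- Here v'p crosses uv, and the resulting q belongs to the sector but lies below the hull edge.
  · obtain ⟨q, hq, ⟨a, b, ha, hb, hab, hqe⟩, hqz⟩ :=
      exists_visible_of_crossing hf hu hv.1 hp h.det_pos h4 h1 h3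
    have hqv' : 0 < det (f q) (f v') := by
      rw [hqe, det_comb_left]
      have := mul_nonneg ha h.det_pos.le
      have := mul_pos hb h1
      linarith
    have hqo : 0 < orient (f v) (f v') (f q) := by
      rw [hqe, orient_comb, orient_self]
      have := mul_pos hb h3
      have := mul_nonneg (by linarith : 0 ≤ 1 - a - b) h.det_pos.le
      linarith
    have hqb : 0 < (f q).im + T * (f q).re := by
      rw [hqe]
      simp only [Complex.add_re, Complex.add_im, Complex.smul_re, Complex.smul_im, smul_eq_mul]
      have h5 : 0 ≤ (f v).im + T * (f v).re := by linarith [(abs_le.1 hv.2.1).1]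
      have := mul_nonneg ha h5
      have := mul_pos hb h2
      linarith
    have hv'c := abs_le.1 hv'.2.1
    have hqre : 0 < (f q).re := by
      have h5 : 0 ≤ (f v').im + T * (f v').re := by linarith [hv'c.1]
      have h6 := mul_pos hqb hv're
      simp only [det] at hqv'
      by_contra hcon
      have := mul_nonpos_of_nonpos_of_nonneg (not_lt.1 hcon) h5
      linarith
    have hqc : |(f q).im| ≤ T * (f q).re := by
      refine abs_le.2 ⟨by linarith, ?_⟩
      simp only [det] at hqv'
      have := mul_le_mul_of_nonneg_left hv'c.2 hqre.le
      have h7 : 0 < (f v').re * (T * (f q).re - (f q).im) := by linarith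
      linarith [(mul_pos_iff_of_pos_left hv're).1 h7]
    have hqw : 0 < det (f q) (f w) := by
      rcases hv'.2.2.1 with rfl | h5
      · exact hqv'
      · exact det_pos_trans hqre hv're hw hqv' h5
    have hqZ : q ∈ sector T f S u w := by
      refine ⟨hq, hqc, Or.inr hqw, fun z hz => ?_⟩
      rintro ⟨h5, h6⟩
      rcases le_or_gt (det (f v) (f z)) 0 with h7 | h7
      · exact hqz z hz ⟨h7, h5⟩
      · exact hv.2.2.2 z hz ⟨h7, h6⟩
    have hqv : q ≠ v := by rintro rfl; rw [orient_self] at hqo; exact lt_irrefl _ hqo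
    have hqv'' : q ≠ v' := by rintro rfl; rw [orient_self_right] at hqo; exact lt_irrefl _ hqo
    linarith [h.above q hqZ hqv hqv'']
  · exact hf.det_ne_zero hu hv.1.1 hpu hpv h4
  · exact hullEdge_empty hf hT hinj hu hw h p h4 h1 h3

theorem orient_conj (a b c : ℂ) :
    orient ((starRingEnd ℂ) a) ((starRingEnd ℂ) b) ((starRingEnd ℂ) c) = -1 * orient a b c := by
  simp only [orient, det, Complex.sub_re, Complex.sub_im, Complex.conj_re, Complex.conj_im]; ring

/-- If no vertex of the cone of `u` that is lower than `w` and to the right of `w` sees `u`, then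
the same holds for the hull edges that lie in the cones of their left ends. -/
theorem hullEdge_clear_right [Finite V] (hf : NoThreeCollinear f) (hT : 0 < T)
    (hinj : Function.Injective f) (hu : f u = 0) (hw : 0 < (f w).re) {v₀ v v' : V}
    (h : HullEdge f (sector T f S u w) v₀ v v') (hwv' : (f v').re ≤ (f w).re)
    (he : (f v).re < (f v').re)
    (hclear : ∀ p, Sees f S u p → |(f p).im| ≤ T * (f p).re → (f p).re < (f w).re →
      ¬ 0 < det (f w) (f p))
    {p : V} (hp : Sees f S v p) (hpc : |(f p - f v).im| ≤ T * (f p - f v).re)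
    (hpre : (f p).re < (f v').re) : ¬ 0 < det (f v' - f v) (f p - f v) := by
  intro hpe
  have hv := h.left_mem
  have hv' := h.right_mem
  have hvre := sector_re_pos hT hinj hu v hv
  have hv're := sector_re_pos hT hinj hu v' hv'
  have hpvre : 0 < (f p - f v).re :=
    re_pos_of_cone hT (sub_ne_zero.2 fun e => hp.1 (hinj e.symm)) hpc
  have h3 : 0 < orient (f v) (f v') (f p) := hpe
  have h1 : 0 < det (f v) (f p) := by
    have h5 : 0 < det (f v) (f v' - f v) := by rw [det_sub_right, det_self]; linarith [h.det_pos]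
    have h6 := det_pos_trans hvre (by rw [Complex.sub_re]; linarith) hpvre h5 hpe
    rw [det_sub_right, det_self] at h6
    linarith
  have hpcone : |(f p).im| ≤ T * (f p).re := by
    have := cone_comb zero_le_one zero_le_one hv.2.1 hpc
    simpa using this
  have hpu : u ≠ p := by rintro rfl; rw [hu] at h1; simp [det] at h1
  have hpv' : v' ≠ p := by rintro rfl; exact lt_irrefl _ hpre
  rcases lt_trichotomy (det (f p) (f v')) 0 with h4 | h4 | h4
  -- Here vp crosses uv', so the crossing lemma is applied to the mirror image.
  · obtain ⟨q, hq, ⟨a, b, ha, hb, hab, hqe⟩, hqz⟩ :=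
      exists_visible_of_crossing (f := fun p => (starRingEnd ℂ) (f p)) (S := S) (u := u) (v := v')
        (v' := v) (p := p)
        (fun a b c h1 h2 h3 => by
          simp only [orient_conj]; exact mul_ne_zero (by norm_num) (hf a b c h1 h2 h3))
        (by simp [hu]) ((sees_iff_of_orient (by norm_num) (fun _ _ _ => orient_conj _ _ _) S _ _).2
          hv'.1) ((sees_iff_of_orient (by norm_num) (fun _ _ _ => orient_conj _ _ _) S _ _).2 hp)
        (by rw [det_conj]; exact h.det_pos) (by rw [det_conj]; exact h4)
        (by rw [det_conj]; exact h1) (by rw [orient_conj, orient_swap]; linarith)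
    replace hq : Sees f S u q :=
      (sees_iff_of_orient (by norm_num) (fun _ _ _ => orient_conj _ _ _) S _ _).1 hq
    replace hqe : f q = a • f v' + b • f p := by
      have := congrArg (starRingEnd ℂ) hqe
      simpa using this
    simp only [det_conj] at hqz
    have hqc : |(f q).im| ≤ T * (f q).re := by rw [hqe]; exact cone_comb ha hb.le hv'.2.1 hpcone
    have hqre := re_pos_of_sees hT hinj hu hq hqc
    have hqlow : (f q).re < (f v').re := by
      rw [hqe]
      simp only [Complex.add_re, Complex.smul_re, smul_eq_mul]
      have := mul_lt_mul_of_pos_left hpre hb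
      have := mul_nonneg (by linarith : 0 ≤ 1 - a - b) hv're.le
      linarith
    have hv'q : 0 < det (f v') (f q) := by
      rw [hqe, det_comb_right, det_self, det_swap]
      have := mul_pos hb (neg_pos.2 h4)
      linarith
    have hqo : 0 < orient (f v) (f v') (f q) := by
      rw [hqe, orient_comb, orient_self_right]
      have := mul_pos hb h3
      have := mul_nonneg (by linarith : 0 ≤ 1 - a - b) h.det_pos.le
      linarith
    -- The vertex q is below the hull edge, so it cannot be in the sector; if it is to the right of
    -- w, it contradicts `hclear`.
    by_cases hqw : q = w ∨ 0 < det (f q) (f w)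
    · have hqZ : q ∈ sector T f S u w := by
        refine ⟨hq, hqc, hqw, fun z hz => ?_⟩
        rintro ⟨h5, h6⟩
        have hqw' : 0 < det (f q) (f w) := by
          rcases hqw with rfl | h7
          · rw [det_swap] at h6; linarith
          · exact h7
        have hzre := re_pos_of_between hqre hw hqw' h5 h6
        exact hv'.2.2.2 z hz ⟨det_pos_trans hv're hqre hzre hv'q h5, h6⟩
      have hqv : q ≠ v := by rintro rfl; rw [orient_self] at hqo; exact lt_irrefl _ hqo
      have hqv'' : q ≠ v' := by rintro rfl; exact lt_irrefl _ hqlow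
      linarith [h.above q hqZ hqv hqv'']
    · push Not at hqw
      have huw : u ≠ w := by rintro rfl; rw [hu] at hw; exact lt_irrefl _ hw
      refine hclear q hq hqc (hqlow.trans_le hwv') ?_
      rw [det_swap]
      have := lt_of_le_of_ne hqw.2 (hf.det_ne_zero hu hq.1 huw hqw.1)
      linarith
  · exact hf.det_ne_zero hu hpu hv'.1.1 hpv'.symm h4
  · exact hullEdge_empty hf hT hinj hu hw h p h1 h4 h3

/-- The right end of a hull edge is at most as high as `w`. -/
theorem hull_re_le {Z : Set V}
    (hZ : ∀ q ∈ Z, 0 < (f q).re) {v₀ : V} (hv₀ : v₀ ∈ Z) (hw : w ∈ Z)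
    (hlow : ∀ q ∈ Z, q ≠ v₀ → (f v₀).re < (f q).re)
    (hright : ∀ q ∈ Z, q ≠ w → 0 < det (f q) (f w)) {v v' : V} (h : HullEdge f Z v₀ v v') :
    (f v').re ≤ (f w).re := by
  by_cases hv'w : v' = w
  · rw [hv'w]
  have hre := h.re_lt hZ hv₀ hlow
  have hvw : v ≠ w := by
    rintro rfl
    have := hright v' h.right_mem hv'w
    rw [det_swap] at this
    linarith [h.det_pos]
  have h1 := h.above w hw hvw.symm (Ne.symm hv'w)
  have h2 := hright v' h.right_mem hv'w
  have h3 := hZ v' h.right_mem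
  have e : ((f w).re - (f v').re) * det (f v) (f v') =
      ((f v').re - (f v).re) * det (f v') (f w) - (f v').re * orient (f v) (f v') (f w) := by
    simp only [orient, det, Complex.sub_re, Complex.sub_im]; ring
  have := mul_pos (sub_pos.2 hre) h2
  have := mul_neg_of_pos_of_neg h3 h1
  have := (mul_pos_iff_of_pos_right h.det_pos).1 (by rw [e]; linarith)
  linarith

end Sector


/-! ### Rotated frames -/

/-- Rotation by the angle `-φ`. -/
noncomputable def rot (φ : ℝ) (z : ℂ) : ℂ := z * Complex.exp (-((φ : ℂ) * I))

theorem rot_re (φ : ℝ) (z : ℂ) : (rot φ z).re = Real.cos φ * z.re + Real.sin φ * z.im := by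
  rw [rot, ← neg_mul, ← Complex.ofReal_neg, Complex.mul_re, Complex.exp_ofReal_mul_I_re,
    Complex.exp_ofReal_mul_I_im, Real.cos_neg, Real.sin_neg]; ring

theorem rot_im (φ : ℝ) (z : ℂ) : (rot φ z).im = Real.cos φ * z.im - Real.sin φ * z.re := by
  rw [rot, ← neg_mul, ← Complex.ofReal_neg, Complex.mul_im, Complex.exp_ofReal_mul_I_re,
    Complex.exp_ofReal_mul_I_im, Real.cos_neg, Real.sin_neg]; ring

theorem rot_re_arg (φ : ℝ) (z : ℂ) : (rot φ z).re = ‖z‖ * Real.cos (z.arg - φ) := by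
  rw [rot_re, Real.cos_sub, ← Complex.norm_mul_cos_arg z, ← Complex.norm_mul_sin_arg z]
  simp only [Complex.norm_mul_cos_arg, Complex.norm_mul_sin_arg]
  linear_combination (-Real.cos φ) * Complex.norm_mul_cos_arg z - (Real.sin φ) * Complex.norm_mul_sin_arg z

theorem rot_im_arg (φ : ℝ) (z : ℂ) : (rot φ z).im = ‖z‖ * Real.sin (z.arg - φ) := by
  rw [rot_im, Real.sin_sub]
  linear_combination (Real.sin φ) * Complex.norm_mul_cos_arg z - (Real.cos φ) * Complex.norm_mul_sin_arg z

theorem rot_sub (φ : ℝ) (z w : ℂ) : rot φ (z - w) = rot φ z - rot φ w := sub_mul _ _ _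

theorem rot_cone {y φ : ℝ} (hy : y < π / 2) {z : ℂ} (h : |z.arg - φ| ≤ y) :
    |(rot φ z).im| ≤ Real.tan y * (rot φ z).re := by
  have hy0 : 0 ≤ y := (abs_nonneg _).trans h
  have hc : 0 < Real.cos y := Real.cos_pos_of_mem_Ioo ⟨by linarith, hy⟩
  rw [rot_re_arg, rot_im_arg, abs_mul, abs_norm, mul_left_comm]
  refine mul_le_mul_of_nonneg_left ?_ (norm_nonneg _)
  rw [Real.abs_sin_eq_sin_abs_of_abs_le_pi (by linarith [Real.pi_pos]), Real.tan_eq_sin_div_cos,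
    div_mul_eq_mul_div, le_div_iff₀ hc, ← Real.cos_abs (z.arg - φ)]
  have := Real.sin_nonneg_of_nonneg_of_le_pi (sub_nonneg.2 h)
    (by linarith [Real.pi_pos, abs_nonneg (z.arg - φ)])
  rw [Real.sin_sub] at this
  linarith

/-- The projection of a hull edge on the bisector of its own cone is smaller than the height
of `w`. -/
theorem rot_re_sub_lt {y φ : ℝ} (hy0 : 0 < y) (hy : y < π / 2) (hφ : φ = 0 ∨ 2 * y ≤ φ)
    (hφ' : φ ≤ π / 2 - y) {v v' : ℂ} (hvre : 0 < v.re) (hv're : 0 < v'.re)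
    (hv : |v.im| < Real.tan y * v.re) (hv' : |v'.im| ≤ Real.tan y * v'.re) :
    (rot φ (v' - v)).re < v'.re := by
  have hc : 0 < Real.cos y := Real.cos_pos_of_mem_Ioo ⟨by linarith, hy⟩
  have hpi := Real.pi_pos
  rw [rot_sub, Complex.sub_re]
  rcases hφ with rfl | hφ
  · simp only [rot_re, Real.cos_zero, Real.sin_zero]; linarith
  · have hs : 0 < Real.sin φ := Real.sin_pos_of_pos_of_lt_pi (by linarith) (by linarith)
    have hTc : Real.tan y * Real.cos y = Real.sin y := Real.tan_mul_cos hc.ne'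
    -- In the rotated frame v' is no higher than before, since φ ≥ 2y, while v still has positive
    -- height, since φ + y ≤ π/2.
    have h1 : (rot φ v').re ≤ v'.re := by
      rw [rot_re]
      have a1 := mul_le_mul_of_nonneg_left (abs_le.1 hv').2 hs.le
      have a2 : Real.cos (φ - y) ≤ Real.cos y :=
        Real.cos_le_cos_of_nonneg_of_le_pi hy0.le (by linarith) (by linarith)
      have a3 : Real.cos φ + Real.sin φ * Real.tan y ≤ 1 := by
        rw [Real.cos_sub, ← hTc] at a2
        have : (Real.cos φ + Real.sin φ * Real.tan y) * Real.cos y ≤ 1 * Real.cos y := by linarith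
        exact le_of_mul_le_mul_right this hc
      have := mul_le_mul_of_nonneg_right a3 hv're.le
      linarith
    have h2 : 0 < (rot φ v).re := by
      rw [rot_re]
      have a1 := mul_lt_mul_of_pos_left (abs_lt.1 hv).1 hs
      have a2 : 0 ≤ Real.cos (φ + y) := Real.cos_nonneg_of_mem_Icc ⟨by linarith, by linarith⟩
      have a3 : 0 ≤ Real.cos φ - Real.sin φ * Real.tan y := by
        rw [Real.cos_add, ← hTc] at a2
        have : 0 * Real.cos y ≤ (Real.cos φ - Real.sin φ * Real.tan y) * Real.cos y := by linarith
        exact le_of_mul_le_mul_right this hc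
      have := mul_nonneg a3 hvre.le
      linarith
    linarith

/-! ### The cost of a hull edge -/

/-- No vertex of the cone of `u` that is lower than `w` and to its right sees `u`. -/
def Clear (T : ℝ) {P : Finset ℂ} (S : SimpleGraph P) (F : ℂ → ℂ) (u w : P) : Prop :=
  ∀ p : P, Sees (fun p : P => (p : ℂ)) S u p → |(F (p - u)).im| ≤ T * (F (p - u)).re →
    (F (p - u)).re < (F (w - u)).re → ¬ 0 < det (F (w - u)) (F (p - u))

/-- The bounds on the length of a path from `u` to `w` which are proved by induction. -/
def PathBound (y : ℝ) {P : Finset ℂ} (S H : SimpleGraph P) (F : ℂ → ℂ) (u w : P) : Prop :=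
  Reach H u w ((1 + Real.sin y) / Real.cos y * (F (w - u)).re + |(F (w - u)).im|) ∧
  (Clear (Real.tan y) S F u w →
    Reach H u w ((1 + Real.sin y) / Real.cos y * (F (w - u)).re + (F (w - u)).im))

/-- The lower triangle of a steep edge lies in the cone of `u`, to the left of its right end. -/
theorem steep_triangle {y : ℝ} (hy0 : 0 < y) (hy : y ≤ π / 6) {v v' q : ℂ}
    (hv : |v.im| ≤ Real.tan y * v.re) (hv' : |v'.im| < Real.tan y * v'.re)
    (hq : q ≠ v')
    (h1 : |(rot (π / 2 - y) (v' - q)).im| ≤ Real.tan y * (rot (π / 2 - y) (v' - q)).re)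
    (h2 : (rot (π / 2 - y) (v' - q)).re < (rot (π / 2 - y) (v' - v)).re) :
    0 < det q v' ∧ 0 < q.im + Real.tan y * q.re := by
  have hpi := Real.pi_pos
  have hy' : y < π / 2 := by linarith
  have hc : 0 < Real.cos y := Real.cos_pos_of_mem_Ioo ⟨by linarith, hy'⟩
  have hs : 0 < Real.sin y := Real.sin_pos_of_pos_of_lt_pi hy0 (by linarith)
  have hT : 0 < Real.tan y := Real.tan_pos_of_pos_of_lt_pi_div_two hy0 hy'
  have hTc : Real.tan y * Real.cos y = Real.sin y := Real.tan_mul_cos hc.ne'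
  have hsc := Real.sin_sq_add_cos_sq y
  have hs2 : Real.sin y ≤ 1 / 2 := by
    rw [← Real.sin_pi_div_six]
    exact Real.sin_le_sin_of_le_of_le_pi_div_two (by linarith) (by linarith) hy
  rw [rot_re, rot_im, Real.cos_pi_div_two_sub, Real.sin_pi_div_two_sub] at h1
  rw [rot_re, rot_re, Real.cos_pi_div_two_sub, Real.sin_pi_div_two_sub] at h2
  set T := Real.tan y
  set s := Real.sin y
  set c := Real.cos y
  simp only [Complex.sub_re, Complex.sub_im] at h1 h2
  set A := v'.re - q.re with hA
  set B := v'.im - q.im with hB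
  obtain ⟨h1a, h1b⟩ := abs_le.1 h1
  -- The height h and the lateral coordinate x of v' − q in the cone whose bisector is at angle π/2
  -- − y.
  set h := s * A + c * B with hh
  set x := s * B - c * A with hx
  have hre0 : 0 ≤ T * h := (abs_nonneg _).trans h1
  have hh0 : 0 ≤ h := (mul_nonneg_iff_of_pos_left hT).1 hre0
  have eA : A = s * h - c * x := by rw [hh, hx]; linear_combination (-A) * hsc
  have eB : B = c * h + s * x := by rw [hh, hx]; linear_combination (-B) * hsc
  have hA0 : 0 ≤ A := by
    rw [eA]
    have := mul_le_mul_of_nonneg_left h1b hc.le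
    have e : c * (T * h) = s * h := by rw [← hTc]; ring
    linarith
  -- Directions of this cone are at angle at least π/2 − 2y from the old bisector, and this is at
  -- least y because y ≤ π/6.
  have hBTA : 0 ≤ c * (B - T * A) := by
    have e : c * (B - T * A) = (c ^ 2 - s ^ 2) * h + 2 * s * (c * x) := by
      rw [eA, eB]; linear_combination (-(s * h - c * x)) * hTc
    rw [e]
    have a1 := mul_le_mul_of_nonneg_left h1a hc.le
    have e2 : c * (T * h) = s * h := by rw [← hTc]; ring
    have a2 : -(s * h) ≤ c * x := by linarith
    have a3 := mul_le_mul_of_nonneg_left a2 (by linarith : 0 ≤ 2 * s)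
    have a4 : 0 ≤ (c ^ 2 - 3 * s ^ 2) * h := mul_nonneg (by nlinarith) hh0
    linarith
  have hBTA' : 0 ≤ B - T * A := (mul_nonneg_iff_of_pos_left hc).1 hBTA
  have hv'b := (abs_lt.1 hv').2
  have hv're : 0 < v'.re :=
    (mul_pos_iff_of_pos_left hT).1 (lt_of_le_of_lt (abs_nonneg _) hv')
  constructor
  · have e : det q v' = v'.re * B - v'.im * A := by rw [hA, hB, det]; ring
    rw [e]
    rcases hA0.eq_or_lt with h0 | h0
    · rw [← h0, mul_zero, sub_zero] at hBTA' ⊢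
      have hBne : B ≠ 0 := by
        intro hB0
        apply hq
        apply Complex.ext <;> linarith
      exact mul_pos hv're (lt_of_le_of_ne hBTA' hBne.symm)
    · have := mul_lt_mul_of_pos_right hv'b h0
      have := mul_nonneg hv're.le hBTA'
      linarith
  -- The base of the triangle is perpendicular to the direction π/2 − y, hence parallel to the left
  -- boundary of the cone of u; q is to the right of the base line through v.
  · have a1 := (abs_le.1 hv).1
    have a2 : 0 < c * ((q.im - v.im) + T * (q.re - v.re)) := by
      have e : c * ((q.im - v.im) + T * (q.re - v.re)) =
        c * (q.im - v.im) + s * (q.re - v.re) := by rw [← hTc]; ring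
      rw [e]; linarith
    have := (mul_pos_iff_of_pos_left hc).1 a2
    linarith

section Main

variable {k : ℕ} {P : Finset ℂ} {S : SimpleGraph P}

/-- The half-aperture is `π / (4k + 2)`. -/
theorem half_aperture (k : ℕ) : aperture (4 * k + 2) / 2 * (4 * k + 2) = π := by
  rw [aperture]
  push_cast
  have : (4 * (k : ℝ) + 2) ≠ 0 := by positivity
  field_simp

theorem half_aperture_bounds (hk : 1 ≤ k) :
    0 < aperture (4 * k + 2) / 2 ∧ aperture (4 * k + 2) / 2 ≤ π / 6 := by
  have h := half_aperture k
  have hk' : (1 : ℝ) ≤ k := by exact_mod_cast hk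
  have hpi := Real.pi_pos
  have h0 : 0 < aperture (4 * k + 2) / 2 :=
    (mul_pos_iff_of_pos_right (by positivity : (0 : ℝ) < 4 * k + 2)).1 (by rw [h]; exact hpi)
  refine ⟨h0, ?_⟩
  nlinarith

theorem sees_frame_iff {m : ℕ} {F : ℂ → ℂ} (hF : IsFrame m F) (o : ℂ) (u v : P) :
    Sees (fun p : P => F (p - o)) S u v ↔ Sees (fun p : P => (p : ℂ)) S u v := by
  obtain ⟨ε, h1, h2⟩ := hF.exists_orient o
  exact sees_iff_of_orient (f := fun p : P => F (p - o)) (g := fun p : P => (p : ℂ)) h1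
    (fun a b c => h2 a b c) S u v

theorem IsFrame.noThreeCollinear {m : ℕ} {F : ℂ → ℂ} (hF : IsFrame m F)
    (hP : NoThreeCollinear (fun p : P => (p : ℂ))) (o : ℂ) :
    NoThreeCollinear (fun p : P => F (p - o)) := by
  obtain ⟨ε, h1, h2⟩ := hF.exists_orient o
  intro a b c hab hac hbc
  simp only [h2]
  refine mul_ne_zero ?_ (hP a b c hab hac hbc)
  rintro rfl; norm_num at h1

theorem IsFrame.injective {m : ℕ} {F : ℂ → ℂ} (hF : IsFrame m F) (o : ℂ) :
    Function.Injective (fun p : P => F (p - o)) := by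
  intro a b h
  have h1 : ‖F ((a - o) - (b - o))‖ = 0 := by
    rw [hF.sub]; simp only at h; rw [h, sub_self, norm_zero]
  rw [hF.norm, sub_sub_sub_cancel_right, norm_eq_zero, sub_eq_zero] at h1
  exact Subtype.ext h1

theorem IsFrame.zero {m : ℕ} {F : ℂ → ℂ} (hF : IsFrame m F) : F 0 = 0 := by
  rw [← norm_eq_zero, hF.norm, norm_zero]

theorem GeneralPosition.strict_cone {m : ℕ} (hm : 0 < m) (h : GeneralPosition m P)
    {F : ℂ → ℂ} (hF : IsFrame m F) (hc : 0 < Real.cos (aperture m / 2)) {p q : P} (hpq : p ≠ q)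
    (hcone : |(F (q - p)).im| ≤ Real.tan (aperture m / 2) * (F (q - p)).re) :
    |(F (q - p)).im| < Real.tan (aperture m / 2) * (F (q - p)).re := by
  have h1 := h.frame_im_ne hm hF hc hpq
  have h2 := h.frame_im_ne hm hF.conj hc hpq
  simp only [Complex.conj_im, Complex.conj_re] at h2
  obtain ⟨h3, h4⟩ := abs_le.1 hcone
  refine abs_lt.2 ⟨lt_of_le_of_ne h3 fun h => h2 (by linarith), lt_of_le_of_ne h4 h1⟩

/-- The cost of a hull edge. -/
theorem hullEdge_cost {H : SimpleGraph P} (hk : 1 ≤ k) (hP : GeneralPosition (4 * k + 2) P)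
    {y : ℝ} (hy : y = aperture (4 * k + 2) / 2) {F : ℂ → ℂ} (hF : IsFrame (4 * k + 2) F) {u w v₀ : P}
    (hw : w ∈ sector (Real.tan y) (fun p : P => F (p - u)) S u w)
    (hv₀ : v₀ ∈ sector (Real.tan y) (fun p : P => F (p - u)) S u w)
    (hlow : ∀ q ∈ sector (Real.tan y) (fun p : P => F (p - u)) S u w, q ≠ v₀ →
      (F (v₀ - u)).re < (F (q - u)).re)
    (ih : ∀ u' w' : P, ∀ F' : ℂ → ℂ, IsFrame (4 * k + 2) F' → Sees (fun p : P => (p : ℂ)) S u' w' →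
      |(F' (w' - u')).im| ≤ Real.tan y * (F' (w' - u')).re →
      (F' (w' - u')).re < (F (w - u)).re → PathBound y S H F' u' w')
    {v v' : P}
    (h : HullEdge (fun p : P => F (p - u))
      (sector (Real.tan y) (fun p : P => F (p - u)) S u w) v₀ v v') :
    Reach H v v' ((1 + Real.sin y) / Real.cos y * (F (v' - v)).re + (F (v' - v)).im
      + 2 * max 0 (-(F (w - u)).im / (F (w - u)).re) * (F (v' - v)).re) ∧
    (Clear (Real.tan y) S F u w →
      Reach H v v' ((1 + Real.sin y) / Real.cos y * (F (v' - v)).re + (F (v' - v)).im)) := by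
  obtain ⟨hy0, hy6⟩ := half_aperture_bounds hk
  have hyk := half_aperture k
  rw [← hy] at hy0 hy6 hyk
  have hpi := Real.pi_pos
  have hy2 : y < π / 2 := by linarith
  have hc : 0 < Real.cos y := Real.cos_pos_of_mem_Ioo ⟨by linarith, hy2⟩
  have hT : 0 < Real.tan y := Real.tan_pos_of_pos_of_lt_pi_div_two hy0 hy2
  set f : P → ℂ := fun p => F (p - u) with hfdef
  set Z := sector (Real.tan y) f S u w with hZdef
  have hf : NoThreeCollinear f := hF.noThreeCollinear hP.noThreeCollinear u
  have hinj : Function.Injective f := hF.injective u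
  have hu : f u = 0 := by simp only [hfdef, sub_self]; exact hF.zero
  have hZre := sector_re_pos (S := S) (w := w) hT hinj hu
  have hwre : 0 < (f w).re := hZre w hw
  have hright : ∀ q ∈ Z, q ≠ w → 0 < det (f q) (f w) := fun q hq hqw => hq.2.2.1.resolve_left hqw
  have hfe : ∀ a b : P, F (a - b) = f a - f b := by
    intro a b; simp only [hfdef]; rw [← hF.sub, sub_sub_sub_cancel_right]
  have hvre := hZre v h.left_mem
  have hv're := hZre v' h.right_mem
  have hvc := hP.strict_cone (by omega) hF (by rw [← hy]; exact hc) h.left_mem.1.1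
    (by rw [← hy]; exact h.left_mem.2.1)
  have hv'c := hP.strict_cone (by omega) hF (by rw [← hy]; exact hc) h.right_mem.1.1
    (by rw [← hy]; exact h.right_mem.2.1)
  rw [← hy] at hvc hv'c
  have hsees := hullEdge_sees hf hT hinj hu hwre h
  have hsees' := (sees_frame_iff hF u v v').1 hsees
  have hasc := h.re_lt hZre hv₀ hlow
  have hwv' := hull_re_le hZre hv₀ hw hlow hright h
  have hdir := h.det_pos_right hw hright
  set e := F (v' - v) with he
  have hee : e = f v' - f v := hfe v' v
  rw [← hee] at hdir
  have here : 0 < e.re := by rw [hee, Complex.sub_re]; linarith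
  set κ := (1 + Real.sin y) / Real.cos y with hκ
  set r := max 0 (-(f w).im / (f w).re) with hr
  have hr0 : 0 ≤ r := le_max_left _ _
  -- The edge points to the right of the direction of w, so per unit of height it moves left no more
  -- than w does.
  have hrim : -e.im ≤ r * e.re := by
    have h1 : -(f w).im / (f w).re ≤ r := le_max_right _ _
    rw [div_le_iff₀ hwre] at h1
    have h2 := mul_le_mul_of_nonneg_right h1 here.le
    simp only [det] at hdir
    have h3 : 0 ≤ (f w).re * (r * e.re + e.im) := by linarith
    linarith [(mul_nonneg_iff_of_pos_left hwre).1 h3]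
  -- it suffices to prove the second bound when the edge is not to the left
  have hsuff : Reach H v v' (κ * e.re + e.im) →
      Reach H v v' (κ * e.re + e.im + 2 * r * e.re) ∧
      (Clear (Real.tan y) S F u w → Reach H v v' (κ * e.re + e.im)) := by
    intro hR
    refine ⟨hR.mono ?_, fun _ => hR⟩
    have := mul_nonneg hr0 here.le
    linarith
  -- the direction of the edge
  have hg2 : e.arg < π / 2 := (arg_mem_of_re_pos here).2
  have hg1 : -y < e.arg := by
    have hmem : -y ∈ Set.Ioo (-(π / 2)) (π / 2) := ⟨by linarith, by linarith⟩
    rw [← Real.strictMonoOn_tan.lt_iff_lt hmem (arg_mem_of_re_pos here), Complex.tan_arg,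
      Real.tan_neg, lt_div_iff₀ here]
    have h1 := (abs_le.1 hw.2.1).1
    simp only [det] at hdir
    have h2 := mul_le_mul_of_nonneg_right h1 here.le
    have h3 : 0 < (f w).re * (e.im + Real.tan y * e.re) := by linarith
    linarith [(mul_pos_iff_of_pos_left hwre).1 h3]
  have hcases : ∀ i : ℤ, ∀ φ : ℝ, φ = i * aperture (4 * k + 2) → φ ≤ π / 2 - y →
      (φ = 0 ∨ 2 * y ≤ φ) → IsFrame (4 * k + 2) (fun z => rot φ (F z)) ∧
      (rot φ e).re < (f w).re := by
    intro i φ hi hφ hφ'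
    refine ⟨?_, ?_⟩
    · have := hF.rotate (by omega) i
      rw [hi]; exact this
    · rw [hee]
      exact (rot_re_sub_lt hy0 hy2 hφ' hφ hvre hv're hvc h.right_mem.2.1).trans_le hwv'
  rcases lt_or_ge e.arg y with hgy | hgy
  · -- the edge lies in the same cone as `w`
    obtain ⟨-, hlt⟩ := hcases 0 0 (by simp) (by linarith) (Or.inl rfl)
    have hcone : |e.im| ≤ Real.tan y * e.re := by
      have h1 : |e.arg| ≤ y := abs_le.2 ⟨hg1.le, hgy.le⟩
      have hne : e ≠ 0 := fun h0 => by rw [h0] at here; simp at here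
      exact (abs_arg_le_iff hy0 hy2 hne).1 h1
    have hlt' : e.re < (f w).re := by simpa [rot] using hlt
    obtain ⟨M1, M2⟩ := ih v v' F hF hsees' hcone hlt'
    rcases le_or_gt 0 e.im with him | him
    · refine hsuff ?_
      rw [← he, abs_of_nonneg him] at M1
      exact M1
    · refine ⟨M1.mono ?_, fun hcl => M2 ?_⟩
      -- Here |im| exceeds im by −2·im, which `hrim` bounds by 2r·re.
      · rw [← he, abs_of_neg him]; linarith
      · intro p hp hpc hpre
        rw [hfe p v] at hpc hpre ⊢
        rw [hfe v' v] at hpre ⊢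
        refine hullEdge_clear_right hf hT hinj hu hwre h hwv' hasc ?_
          ((sees_frame_iff hF u v p).2 hp) hpc ?_
        · exact fun q hq hqc hqre => hcl q ((sees_frame_iff hF u u q).1 hq) hqc hqre
        · simp only [Complex.sub_re] at hpre; linarith
  · refine hsuff ?_
    have hnorm : κ * e.re + e.im = ‖e‖ * (κ * Real.cos e.arg + Real.sin e.arg) := by
      rw [mul_add, mul_left_comm, Complex.norm_mul_cos_arg, Complex.norm_mul_sin_arg]
    have hapy : aperture (4 * k + 2) = 2 * y := by rw [hy]; ring
    have hky : 2 * y * k = π / 2 - y := by linarith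
    rcases le_or_gt e.arg (π / 2 - y) with hgk | hgk
    · -- an intermediate cone
      set i : ℤ := ⌊(e.arg + y) / (2 * y)⌋ with hi
      have hi1 : (i : ℝ) * (2 * y) ≤ e.arg + y := by
        rw [← le_div_iff₀ (by linarith)]; exact Int.floor_le _
      have hi2 : e.arg + y < ((i : ℝ) + 1) * (2 * y) := by
        rw [← div_lt_iff₀ (by linarith)]; exact Int.lt_floor_add_one _
      have hi3 : (1 : ℝ) ≤ i := by
        have : (1 : ℤ) ≤ i := by
          rw [hi, Int.le_floor, Int.cast_one, le_div_iff₀ (by linarith)]; linarith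
        exact_mod_cast this
      have hik : (i : ℝ) ≤ k := by
        have : i < (k : ℤ) + 1 := by
          rw [hi, Int.floor_lt, div_lt_iff₀ (by linarith)]
          push_cast; linarith
        have : i ≤ (k : ℤ) := by omega
        exact_mod_cast this
      set φ : ℝ := i * aperture (4 * k + 2) with hφ
      have hφy : φ = i * (2 * y) := by rw [hφ, hapy]
      have hφ1 : φ ≤ π / 2 - y := by
        rw [hφy, ← hky, mul_comm (2 * y)]
        exact mul_le_mul_of_nonneg_right hik (by linarith)
      have hφ2 : 2 * y ≤ φ := by
        rw [hφy]
        have := mul_le_mul_of_nonneg_right hi3 (by linarith : 0 ≤ 2 * y)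
        linarith
      obtain ⟨hF', hlt⟩ := hcases i φ hφ hφ1 (Or.inr hφ2)
      have hb : |e.arg - φ| ≤ y := abs_le.2 ⟨by linarith, by linarith⟩
      obtain ⟨M1, -⟩ := ih v v' _ hF' hsees' (rot_cone hy2 hb) hlt
      refine M1.mono ?_
      change κ * (rot φ e).re + |(rot φ e).im| ≤ _
      rw [hnorm, rot_re_arg, rot_im_arg, abs_mul, abs_norm,
        Real.abs_sin_eq_sin_abs_of_abs_le_pi (by linarith), ← Real.cos_abs (e.arg - φ)]
      -- With g = `e.arg`, the sum of the angles is φ if g ≤ φ and 2g − φ otherwise. The latter is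
      -- at most the next bisector φ + 2y if i < k, and at most π/2 − y if i = k.
      have h1 := cost_mono hy0 hy2 (abs_nonneg (e.arg - φ)) (by linarith : |e.arg - φ| ≤ e.arg)
        (by
          rcases abs_cases (e.arg - φ) with ⟨h1, -⟩ | ⟨h1, -⟩
          · rw [h1]
            rcases hik.eq_or_lt with h2 | h2
            · rw [hφy, h2]; linarith
            · have h3 : (i : ℝ) + 1 ≤ k := by
                have : i < (k : ℤ) := by exact_mod_cast h2
                have : i + 1 ≤ (k : ℤ) := by omega
                exact_mod_cast this
              have h4 := mul_le_mul_of_nonneg_right h3 (by linarith : 0 ≤ 2 * y)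
              linarith [abs_le.1 hb]
          · rw [h1]; linarith)
      have := mul_le_mul_of_nonneg_left h1 (norm_nonneg e)
      linarith
    · -- the steepest part of the last cone: use the cone of the right end
      set φ : ℝ := π / 2 - y with hφ
      obtain ⟨hF', hlt⟩ := hcases k φ (by rw [hapy]; push_cast; linarith) le_rfl
        (Or.inr (by
          have : (1 : ℝ) ≤ k := by exact_mod_cast hk
          nlinarith))
      have hb : |e.arg - φ| ≤ y := abs_le.2 ⟨by linarith, by linarith⟩
      -- The opposite cone, with apex v', reflected so that its right side is the side of the edge
      -- facing u.
      set G : ℂ → ℂ := fun z => (starRingEnd ℂ) (-rot φ (F z)) with hG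
      have hGF : IsFrame (4 * k + 2) G := hF'.neg.conj
      have hGe : ∀ p : P, G (p - v') = (starRingEnd ℂ) (rot φ (f v' - f p)) := by
        intro p
        simp only [hG]
        rw [hfe, ← neg_sub (f v') (f p), rot, neg_mul, neg_neg, rot]
      have hGv : G (v - v') = (starRingEnd ℂ) (rot φ e) := by rw [hGe, ← hee]
      obtain ⟨-, M2⟩ := ih v' v G hGF hsees'.symm
        (by rw [hGv, Complex.conj_im, Complex.conj_re, abs_neg]; exact rot_cone hy2 hb)
        (by rw [hGv, Complex.conj_re]; exact hlt)
      refine (M2 ?_).symm.mono (le_of_eq ?_)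
      · intro p hp hpc hpre hdet
        rw [hGv, hGe p, det_conj] at hdet
        rw [hGe p, Complex.conj_im, Complex.conj_re, abs_neg] at hpc
        rw [hGe p, hGv, Complex.conj_re, Complex.conj_re, hee] at hpre
        obtain ⟨h1, h2⟩ := steep_triangle hy0 hy6 h.left_mem.2.1 hv'c
          (hinj.ne hp.1.symm) hpc hpre
        refine hullEdge_clear_left hf hT hinj hu hwre h ((sees_frame_iff hF u v' p).2 hp) h1 h2 ?_
        have e1 : det (rot φ (f v' - f p)) (rot φ e) =
            (Real.sin φ ^ 2 + Real.cos φ ^ 2) * det (f v' - f p) e := by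
          simp only [det, rot_re, rot_im]; ring
        rw [e1, Real.sin_sq_add_cos_sq, one_mul, hee] at hdet
        have e2 : orient (f v) (f v') (f p) = det (f v' - f p) (f v' - f v) := by
          simp only [orient, det, Complex.sub_re, Complex.sub_im]; ring
        rw [e2]; exact hdet
      · rw [hnorm, hGv, Complex.conj_re, Complex.conj_im, rot_re_arg, rot_im_arg, hφ]
        have := cost_reflect (g := e.arg) hy0 hy2
        rw [← hκ] at this
        linear_combination ‖e‖ * this

end Main


variable {k : ℕ} {P : Finset ℂ} {S : SimpleGraph P}

/-! ### The upper bound -/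

theorem IsFrame.dist_eq {m : ℕ} {F : ℂ → ℂ} (hF : IsFrame m F) (a b : ℂ) :
    dist a b = ‖F (b - a)‖ := by
  rw [hF.norm, dist_comm, dist_eq_norm]

/-- The path bounds when the arc from `u` ends to the left of `w`. -/
theorem pathBound_of_arc_left {H : SimpleGraph P} (hk : 1 ≤ k)
    (hP : GeneralPosition (4 * k + 2) P) {y : ℝ} (hy : y = aperture (4 * k + 2) / 2)
    {F : ℂ → ℂ} (hF : IsFrame (4 * k + 2) F) {u w v₀ : P}
    (huw : Sees (fun p : P => (p : ℂ)) S u w)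
    (hw : |(F (w - u)).im| ≤ Real.tan y * (F (w - u)).re)
    (huv : Sees (fun p : P => (p : ℂ)) S u v₀)
    (hv : |(F (v₀ - u)).im| ≤ Real.tan y * (F (v₀ - u)).re)
    (hsep : ¬ Separates (fun p : P => F (p - u)) S u v₀ w)
    (hlow : ∀ q : P, Sees (fun p : P => (p : ℂ)) S u q →
      |(F (q - u)).im| ≤ Real.tan y * (F (q - u)).re →
      ¬ Separates (fun p : P => F (p - u)) S u q w → (F (v₀ - u)).re ≤ (F (q - u)).re)
    (hleft : 0 < det (F (v₀ - u)) (F (w - u))) (hadj : H.Adj u v₀)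
    (ih : ∀ u' w' : P, ∀ F' : ℂ → ℂ, IsFrame (4 * k + 2) F' → Sees (fun p : P => (p : ℂ)) S u' w' →
      |(F' (w' - u')).im| ≤ Real.tan y * (F' (w' - u')).re →
      (F' (w' - u')).re < (F (w - u)).re → PathBound y S H F' u' w') :
    PathBound y S H F u w := by
  obtain ⟨hy0, hy6⟩ := half_aperture_bounds hk
  rw [← hy] at hy0 hy6
  have hpi := Real.pi_pos
  have hy2 : y < π / 2 := by linarith
  have hT : 0 < Real.tan y := Real.tan_pos_of_pos_of_lt_pi_div_two hy0 hy2
  set f : P → ℂ := fun p => F (p - u) with hfdef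
  have hinj : Function.Injective f := hF.injective u
  have hu : f u = 0 := by simp only [hfdef, sub_self]; exact hF.zero
  have hfe : ∀ a b : P, F (a - b) = f a - f b := by
    intro a b; simp only [hfdef]; rw [← hF.sub, sub_sub_sub_cancel_right]
  set Z := sector (Real.tan y) f S u w with hZdef
  have hwZ : w ∈ Z := by
    refine ⟨(sees_frame_iff hF u u w).2 huw, hw, Or.inl rfl, fun z _ => ?_⟩
    rintro ⟨h1, h2⟩
    rw [det_swap] at h1; linarith
  have hvZ : v₀ ∈ Z := ⟨(sees_frame_iff hF u u v₀).2 huv, hv, Or.inr hleft, fun z hz hzz =>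
    hsep ⟨z, hz, Or.inl ⟨hleft, hzz.1, hzz.2⟩⟩⟩
  have hlow' : ∀ q ∈ Z, q ≠ v₀ → (f v₀).re < (f q).re := by
    intro q hq hqv
    refine lt_of_le_of_ne (hlow q ((sees_frame_iff hF u u q).1 hq.1) hq.2.1 ?_) ?_
    · rintro ⟨z, hz, ⟨-, h2, h3⟩ | ⟨h1, h2, h3⟩⟩
      · exact hq.2.2.2 z hz ⟨h2, h3⟩
      · rcases hq.2.2.1 with rfl | h4
        · rw [det_self] at h1; exact lt_irrefl _ h1
        · change 0 < det (f w) (f q) at h1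
          rw [det_swap] at h1; linarith
    · have := hP.frame_re_ne hF (Ne.symm hqv)
      rw [hfe, Complex.sub_re] at this
      exact fun h => this (by rw [h, sub_self])
  have hright : ∀ q ∈ Z, q ≠ w → 0 < det (f q) (f w) := fun q hq hqw => hq.2.2.1.resolve_left hqw
  have hwre : 0 < (f w).re := sector_re_pos hT hinj hu w hwZ
  have hf : NoThreeCollinear f := hF.noThreeCollinear hP.noThreeCollinear u
  have hcost : ∀ {v v' : P}, HullEdge f Z v₀ v v' → _ :=
    fun h => hullEdge_cost hk hP hy hF hwZ hvZ hlow' ih h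
  have hfirst : Reach H u v₀ ((1 + Real.sin y) / Real.cos y * (f v₀).re + (f v₀).im) := by
    refine (Reach.of_adj hadj).mono ?_
    rw [hF.dist_eq]
    exact norm_le_cost hy0 hy2 hv
  have hvre := sector_re_pos hT hinj hu v₀ hvZ
  set κ := (1 + Real.sin y) / Real.cos y with hκ
  set r := max 0 (-(f w).im / (f w).re) with hr
  have hr0 : 0 ≤ r := le_max_left _ _
  constructor
  · have hchain : Reach H v₀ w (κ * ((f w).re - (f v₀).re) + ((f w).im - (f v₀).im)
        + 2 * r * ((f w).re - (f v₀).re)) := by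
      refine hull_induction hf hu (sector_re_pos hT hinj hu) hvZ hwZ hlow' hright
        (fun v => Reach H v w (κ * ((f w).re - (f v).re) + ((f w).im - (f v).im)
          + 2 * r * ((f w).re - (f v).re))) ?_ ?_
      · exact (Reach.refl w).mono (by simp)
      · intro v v' h hv'
        refine ((hcost h).1.trans hv').mono (le_of_eq ?_)
        rw [hfe, Complex.sub_re, Complex.sub_im]; ring
    refine (hfirst.trans hchain).mono ?_
    -- The slope r is chosen so that the accumulated corrections turn im into |im|.
    have h1 : (f w).im + 2 * r * (f w).re = |(f w).im| := by
      rcases le_or_gt 0 (f w).im with h | h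
      · have : r = 0 := max_eq_left (div_nonpos_of_nonpos_of_nonneg (by linarith) hwre.le)
        rw [this, abs_of_nonneg h]; ring
      · have : r = -(f w).im / (f w).re := max_eq_right (div_pos (by linarith) hwre).le
        rw [this, abs_of_neg h]; field_simp; ring
    have h2 := mul_nonneg hr0 hvre.le
    change _ ≤ κ * (f w).re + |(f w).im|
    rw [← h1]
    linarith
  · intro hcl
    have hchain : Reach H v₀ w (κ * ((f w).re - (f v₀).re) + ((f w).im - (f v₀).im)) := by
      refine hull_induction hf hu (sector_re_pos hT hinj hu) hvZ hwZ hlow' hright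
        (fun v => Reach H v w (κ * ((f w).re - (f v).re) + ((f w).im - (f v).im))) ?_ ?_
      · exact (Reach.refl w).mono (by simp)
      · intro v v' h hv'
        refine (((hcost h).2 hcl).trans hv').mono (le_of_eq ?_)
        rw [hfe, Complex.sub_re, Complex.sub_im]; ring
    refine (hfirst.trans hchain).mono (le_of_eq ?_)
    change _ = κ * (f w).re + (f w).im
    ring

/-- The induction runs over all pairs and frames at once, because a hull edge is measured in the
frame of its own cone and possibly from its other end. -/
theorem pathBound (hk : 1 ≤ k) (hP : GeneralPosition (4 * k + 2) P) (hS : IsPlanar S) {y : ℝ}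
    (hy : y = aperture (4 * k + 2) / 2) {F : ℂ → ℂ} (hF : IsFrame (4 * k + 2) F) {u w : P}
    (huw : Sees (fun p : P => (p : ℂ)) S u w)
    (hw : |(F (w - u)).im| ≤ Real.tan y * (F (w - u)).re) :
    PathBound y S (constrainedThetaGraph (4 * k + 2) S) F u w := by
  set H := constrainedThetaGraph (4 * k + 2) S
  obtain ⟨hy0, hy6⟩ := half_aperture_bounds hk
  have hpi := Real.pi_pos
  have hy2 : aperture (4 * k + 2) / 2 < π / 2 := by linarith
  have hc : 0 < Real.cos (aperture (4 * k + 2) / 2) :=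
    Real.cos_pos_of_mem_Ioo ⟨by linarith, hy2⟩
  -- a counterexample of smallest height
  let bad : Set (P × P × (ℂ → ℂ)) := {x | IsFrame (4 * k + 2) x.2.2 ∧
    Sees (fun p : P => (p : ℂ)) S x.1 x.2.1 ∧
    |(x.2.2 (x.2.1 - x.1)).im| ≤ Real.tan y * (x.2.2 (x.2.1 - x.1)).re ∧
    ¬ PathBound y S H x.2.2 x.1 x.2.1}
  have hfin : bad.Finite := by
    refine ((Set.finite_univ (α := P)).prod ((Set.finite_univ (α := P)).prod
      (finite_frames (4 * k + 2)))).subset ?_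
    rintro ⟨a, b, G⟩ hx
    exact ⟨trivial, trivial, hx.1⟩
  by_contra hbad
  obtain ⟨⟨u, w, F⟩, ⟨hF, huw, hw, hnot⟩, hmin⟩ := hfin.exists_minimalFor
    (fun x => (x.2.2 (x.2.1 - x.1)).re) bad ⟨⟨u, w, F⟩, hF, huw, hw, hbad⟩
  simp only at hF huw hw hnot
  have ih : ∀ u' w' : P, ∀ F' : ℂ → ℂ, IsFrame (4 * k + 2) F' →
      Sees (fun p : P => (p : ℂ)) S u' w' →
      |(F' (w' - u')).im| ≤ Real.tan y * (F' (w' - u')).re →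
      (F' (w' - u')).re < (F (w - u)).re → PathBound y S H F' u' w' := by
    intro u' w' F' h1 h2 h3 h4
    by_contra h5
    exact absurd (hmin (j := ⟨u', w', F'⟩) ⟨h1, h2, h3, h5⟩ h4.le) (not_le.2 h4)
  apply hnot
  -- the endpoint of the arc from `u`
  let A : Set P := {q | Sees (fun p : P => (p : ℂ)) S u q ∧
    |(F (q - u)).im| ≤ Real.tan y * (F (q - u)).re ∧
    ¬ Separates (fun p : P => F (p - u)) S u q w}
  have hwA : w ∈ A := by
    refine ⟨huw, hw, ?_⟩
    rintro ⟨z, -, ⟨h, -, -⟩ | ⟨h, -, -⟩⟩ <;> rw [det_self] at h <;> exact lt_irrefl _ h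
  obtain ⟨v, ⟨huv, hv, hsep⟩, hvmin⟩ := (Set.toFinite A).exists_minimalFor
    (fun q : P => (F (q - u)).re) A ⟨w, hwA⟩
  have hlow : ∀ q : P, Sees (fun p : P => (p : ℂ)) S u q →
      |(F (q - u)).im| ≤ Real.tan y * (F (q - u)).re →
      ¬ Separates (fun p : P => F (p - u)) S u q w → (F (v - u)).re ≤ (F (q - u)).re := by
    intro q h1 h2 h3
    rcases le_total (F (v - u)).re (F (q - u)).re with h | h
    · exact h
    · exact hvmin (j := q) ⟨h1, h2, h3⟩ h
  have hvadj := visibilityGraph_adj_iff hP.noThreeCollinear hS u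
  have harc : ThetaArc (4 * k + 2) S u v := by
    rw [hy] at hw hv hlow
    exact thetaArc_of_lowest hy0 hy2 hF huw.1 (hP.strict_cone (by omega) hF hc huw.1 hw) hv
      ((hvadj v).2 huv) hsep fun q hq => hlow q ((hvadj q).1 hq)
  have hadj : H.Adj u v := Or.inl harc
  by_cases hvw : v = w
  · subst hvw
    have h := norm_le_cost (by rw [hy]; exact hy0) (by rw [hy]; exact hy2) hw
    have hR : Reach H u v ((1 + Real.sin y) / Real.cos y * (F (v - u)).re + (F (v - u)).im) := by
      refine (Reach.of_adj hadj).mono ?_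
      rw [hF.dist_eq]; exact h
    exact ⟨hR.mono (by linarith [le_abs_self (F (v - u)).im]), fun _ => hR⟩
  have hne : det (F (v - u)) (F (w - u)) ≠ 0 := by
    have hf := hF.noThreeCollinear hP.noThreeCollinear u
    exact hf.det_ne_zero (u := u) (by simp only [sub_self]; exact hF.zero) huv.1 huw.1 hvw
  rcases lt_or_gt_of_ne hne with h | h
  -- The arc ends to the right of w: reflection yields the symmetric bound, and the signed one is
  -- vacuous because v itself violates clearness.
  · have h' : 0 < det (F (w - u)) (F (v - u)) := by rw [det_swap]; linarith
    have hre : (F (v - u)).re < (F (w - u)).re := by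
      refine lt_of_le_of_ne (hlow w hwA.1 hwA.2.1 hwA.2.2) fun he => ?_
      have := hP.frame_re_ne hF hvw
      rw [← sub_sub_sub_cancel_right (w : ℂ) v u, hF.sub, Complex.sub_re, he, sub_self] at this
      exact this rfl
    have hB : PathBound y S H (fun z => (starRingEnd ℂ) (F z)) u w := by
      refine pathBound_of_arc_left hk hP hy hF.conj huw ?_ huv ?_ ?_ ?_ ?_ hadj ?_
      · rw [Complex.conj_im, Complex.conj_re, abs_neg]; exact hw
      · rw [Complex.conj_im, Complex.conj_re, abs_neg]; exact hv
      · exact fun h => hsep (separates_conj.1 h)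
      · intro q h1 h2 h3
        rw [Complex.conj_im, Complex.conj_re, abs_neg] at h2
        exact hlow q h1 h2 fun h => h3 (separates_conj.2 h)
      · rw [det_conj]; exact h'
      · exact ih
    refine ⟨?_, fun hcl => absurd h' (hcl v huv hv hre)⟩
    have := hB.1
    rwa [Complex.conj_im, Complex.conj_re, abs_neg] at this
  · exact pathBound_of_arc_left hk hP hy hF huw hw huv hv hsep hlow h hadj ih

/-- Every direction lies in some cone. -/
theorem exists_frame_cone (hk : 1 ≤ k) {y : ℝ} (hy : y = aperture (4 * k + 2) / 2) (z : ℂ) :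
    ∃ F, IsFrame (4 * k + 2) F ∧ |(F z).im| ≤ Real.tan y * (F z).re := by
  obtain ⟨hy0, hy6⟩ := half_aperture_bounds hk
  rw [← hy] at hy0 hy6
  have hpi := Real.pi_pos
  let F₀ : ℂ → ℂ := fun z => z / bisectorDir (4 * k + 2) ⟨0, by omega⟩
  have hF₀ : IsFrame (4 * k + 2) F₀ := ⟨_, Or.inl rfl⟩
  have hap : aperture (4 * k + 2) = 2 * y := by rw [hy]; ring
  set j : ℤ := round ((F₀ z).arg / (2 * y)) with hj
  refine ⟨_, hF₀.rotate (by omega) j, ?_⟩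
  refine rot_cone (φ := j * aperture (4 * k + 2)) (by linarith) ?_
  have h1 := abs_sub_round ((F₀ z).arg / (2 * y))
  rw [← hj] at h1
  have e : (F₀ z).arg - j * aperture (4 * k + 2) = ((F₀ z).arg / (2 * y) - j) * (2 * y) := by
    rw [hap]; field_simp
  rw [e, abs_mul, abs_of_pos (by linarith : 0 < 2 * y)]
  have := mul_le_mul_of_nonneg_right h1 (by linarith : 0 ≤ 2 * y)
  linarith

theorem constrainedThetaGraph_isSpanner (hk : 1 ≤ k) (hP : GeneralPosition (4 * k + 2) P)
    (hS : IsPlanar S) :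
    IsSpanner (1 + 2 * Real.sin (aperture (4 * k + 2) / 2))
      (constrainedThetaGraph (4 * k + 2) S) (visibilityGraph S) := by
  obtain ⟨hy0, hy6⟩ := half_aperture_bounds hk
  have hpi := Real.pi_pos
  have hs := Real.sin_pos_of_pos_of_lt_pi hy0 (by linarith)
  refine isSpanner_of_adj (by linarith) ?_ ?_
  · rintro u v (h | h)
    · exact h.1
    · exact h.1.symm
  · intro u v huv
    obtain ⟨F, hF, hcone⟩ := exists_frame_cone hk rfl (v - u : ℂ)
    refine (pathBound hk hP hS rfl hF
      ((visibilityGraph_adj_iff hP.noThreeCollinear hS u v).1 huv) hcone).1.mono ?_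
    rw [hF.dist_eq]
    refine cost_le_stretch hy0 hy6 (fun h0 => huv.1 ?_) hcone
    have := congrArg norm h0
    rw [hF.norm, norm_zero, norm_eq_zero, sub_eq_zero] at this
    exact Subtype.ext this.symm


/-! ### The lower bound -/

/-- No cone boundary is parallel to `d`, and no bisector is perpendicular to `d`. -/
def Generic (m : ℕ) (d : ℂ) : Prop :=
  ∀ i : Fin m, (d / (bisectorDir m i * Complex.exp (((aperture m / 2 : ℝ) : ℂ) * I))).im ≠ 0 ∧
    (d / bisectorDir m i).re ≠ 0

theorem Generic.neg {m : ℕ} {d : ℂ} (h : Generic m d) : Generic m (-d) := by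
  intro i
  rw [neg_div, neg_div, Complex.neg_im, Complex.neg_re, neg_ne_zero, neg_ne_zero]
  exact h i

theorem I_mul_div_bisectorDir (m : ℕ) (i : Fin m) (d : ℂ) :
    I * d / bisectorDir m i = d * Complex.exp (((((i : ℕ) : ℝ) * aperture m : ℝ) : ℂ) * I) := by
  rw [bisectorDir, mul_div_mul_left _ _ Complex.I_ne_zero, div_eq_mul_inv, ← Complex.exp_neg,
    neg_neg]

theorem re_mul_exp (d : ℂ) (φ : ℝ) :
    (d * Complex.exp ((φ : ℂ) * I)).re = ‖d‖ * Real.cos (d.arg + φ) := by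
  rw [Complex.mul_re, Complex.exp_ofReal_mul_I_re, Complex.exp_ofReal_mul_I_im, Real.cos_add]
  linear_combination (-Real.cos φ) * Complex.norm_mul_cos_arg d
    + Real.sin φ * Complex.norm_mul_sin_arg d

theorem im_mul_exp (d : ℂ) (φ : ℝ) :
    (d * Complex.exp ((φ : ℂ) * I)).im = ‖d‖ * Real.sin (d.arg + φ) := by
  rw [Complex.mul_im, Complex.exp_ofReal_mul_I_re, Complex.exp_ofReal_mul_I_im, Real.sin_add]
  linear_combination (-Real.sin φ) * Complex.norm_mul_cos_arg d
    - Real.cos φ * Complex.norm_mul_sin_arg d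

/-- A direction whose angle to the vertical is not an odd multiple of the half-aperture is
generic. -/
theorem generic_of_arg {k : ℕ} {y : ℝ} (hy : y = aperture (4 * k + 2) / 2) {d : ℂ} (hd : d ≠ 0)
    (h : ∀ n : ℤ, d.arg ≠ (2 * n + 1) * y) : Generic (4 * k + 2) (I * d) := by
  have hyk := half_aperture k
  rw [← hy] at hyk
  have hap : aperture (4 * k + 2) = 2 * y := by rw [hy]; ring
  have hn : ‖d‖ ≠ 0 := norm_ne_zero_iff.2 hd
  intro i
  constructor
  · rw [← div_div, I_mul_div_bisectorDir, mul_div_assoc, ← Complex.exp_sub, ← sub_mul,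
      ← Complex.ofReal_sub, im_mul_exp]
    refine mul_ne_zero hn fun h0 => ?_
    obtain ⟨n, hn⟩ := Real.sin_eq_zero_iff.1 h0
    refine h (n * (2 * k + 1) - i) ?_
    rw [hap, ← hyk] at hn
    push_cast
    linarith
  · rw [I_mul_div_bisectorDir, re_mul_exp]
    refine mul_ne_zero hn fun h0 => ?_
    obtain ⟨n, hn⟩ := Real.cos_eq_zero_iff.1 h0
    -- A right angle is 2k + 1 half-apertures, an odd number, so perpendiculars to bisectors are
    -- again at odd multiples of y.
    refine h (n * (2 * k + 1) + k - i) ?_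
    rw [hap, ← hyk] at hn
    push_cast
    linarith

theorem odd_mul_ne_of_mem {y x : ℝ} (hy : 0 < y) (j : ℤ) (h1 : (2 * j - 1) * y < x)
    (h2 : x < (2 * j + 1) * y) (n : ℤ) : x ≠ (2 * n + 1) * y := by
  rintro rfl
  have a1 := lt_of_mul_lt_mul_right h1 hy.le
  have a2 := lt_of_mul_lt_mul_right h2 hy.le
  have b1 : 2 * j - 1 < 2 * n + 1 := by exact_mod_cast a1
  have b2 : 2 * n + 1 < 2 * j + 1 := by exact_mod_cast a2
  omega

theorem orient_eq_zero_of_collinear {a b c : ℂ} (h : Collinear ℝ ({a, b, c} : Set ℂ)) :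
    orient a b c = 0 := by
  obtain ⟨v, hv⟩ := (collinear_iff_of_mem (p₀ := a) (by simp)).1 h
  obtain ⟨r, hr⟩ := hv b (by simp)
  obtain ⟨s, hs⟩ := hv c (by simp)
  rw [vadd_eq_add] at hr hs
  rw [orient, hr, hs, add_sub_cancel_right, add_sub_cancel_right]
  simp only [det, Complex.smul_re, Complex.smul_im, smul_eq_mul]
  ring

theorem orient_I_mul (a b c : ℂ) : orient (I * a) (I * b) (I * c) = orient a b c := by
  simp only [orient, det, Complex.sub_re, Complex.sub_im, Complex.I_mul_re, Complex.I_mul_im]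
  ring

/-- Vertices of the parallelogram `0`, `b`, `a`, `a - b`, turned by a right angle. -/
noncomputable def parallelogram (a b : ℂ) : Finset ℂ := {I * 0, I * a, I * b, I * (a - b)}

theorem mem_parallelogram {a b p : ℂ} : p ∈ parallelogram a b ↔
    p = I * 0 ∨ p = I * a ∨ p = I * b ∨ p = I * (a - b) := by
  simp [parallelogram]

/-- Up to sign the differences of vertices are a, b, a − b and 2b − a, and any three vertices span a
triangle of area |det a b|/2. -/
theorem parallelogram_generalPosition {m : ℕ} {a b : ℂ} (hab : det a b ≠ 0)
    (ha : Generic m (I * a)) (hb : Generic m (I * b)) (hc : Generic m (I * (a - b)))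
    (hd : Generic m (I * (2 * b - a))) : GeneralPosition m (parallelogram a b) := by
  have hgen : ∀ p ∈ parallelogram a b, ∀ q ∈ parallelogram a b, p ≠ q → Generic m (q - p) := by
    have hrev : ∀ {p q : ℂ}, Generic m (q - p) → Generic m (p - q) := fun h => by
      rw [← neg_sub]; exact h.neg
    have e1 : Generic m (I * a - I * 0) := by rwa [mul_zero, sub_zero]
    have e2 : Generic m (I * b - I * 0) := by rwa [mul_zero, sub_zero]
    have e3 : Generic m (I * (a - b) - I * 0) := by rwa [mul_zero, sub_zero]
    have e4 : Generic m (I * a - I * b) := by rwa [← mul_sub]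
    have e5 : Generic m (I * a - I * (a - b)) := by rwa [← mul_sub, sub_sub_cancel]
    have e6 : Generic m (I * b - I * (a - b)) := by
      rw [← mul_sub, show b - (a - b) = 2 * b - a by ring]; exact hd
    intro p hp q hq hpq
    rcases mem_parallelogram.1 hp with rfl | rfl | rfl | rfl <;>
    rcases mem_parallelogram.1 hq with rfl | rfl | rfl | rfl <;>
    first
      | exact absurd rfl hpq
      | assumption
      | (apply hrev; assumption)
  refine ⟨fun p hp q hq hpq i => (hgen p hp q hq hpq i).1,
    fun p hp q hq hpq i => (hgen p hp q hq hpq i).2, ?_⟩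
  intro p hp q hq r hr hpq hpr hqr hcol
  have h0 := orient_eq_zero_of_collinear hcol
  rcases mem_parallelogram.1 hp with rfl | rfl | rfl | rfl <;>
  rcases mem_parallelogram.1 hq with rfl | rfl | rfl | rfl <;>
  (try exact absurd rfl hpq) <;>
  rcases mem_parallelogram.1 hr with rfl | rfl | rfl | rfl <;>
  (try exact absurd rfl hpr) <;>
  (try exact absurd rfl hqr) <;>
  rw [orient_I_mul] at h0 <;>
  simp only [orient, det, Complex.sub_re, Complex.sub_im, Complex.zero_re, Complex.zero_im] at h0 hab <;>
  exact hab (by linarith)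

/-- The shorter of two vertices in the same undivided cone prevents an arc to the longer one. -/
theorem not_thetaArc {k : ℕ} (hk : 1 ≤ k) {P : Finset ℂ} {u w x : P} {c a b : ℂ} (j : ℤ)
    (hc : c = I * Complex.exp (-((((j : ℝ) * aperture (4 * k + 2) : ℝ) : ℂ) * I)))
    (hw : (w : ℂ) - u = c * a) (hx : (x : ℂ) - u = c * b) (ha : a ≠ 0)
    (haa : |a.arg| < aperture (4 * k + 2) / 2) (hba : |b.arg| ≤ aperture (4 * k + 2) / 2)
    (hre : b.re < a.re) (hux : u ≠ x) :
    ¬ ThetaArc (4 * k + 2) (⊥ : SimpleGraph P) u w := by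
  obtain ⟨hy0, hy6⟩ := half_aperture_bounds hk
  have hyk := half_aperture k
  set y := aperture (4 * k + 2) / 2 with hy
  have hap : aperture (4 * k + 2) = 2 * y := by rw [hy]; ring
  rintro ⟨-, i, C, ⟨α, hα, β, hβ, hαβ, -, rfl⟩, ⟨hwc, -⟩, hmin⟩
  have hA : ∀ γ ∈ splitAngles (4 * k + 2) (⊥ : SimpleGraph P) i u, γ = -y ∨ γ = y := by
    rintro γ ((h | h) | ⟨v, hv, -⟩)
    · exact Or.inl h
    · exact Or.inr h
    · exact absurd hv (by simp)
  have hα' : α = -y := by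
    rcases hA α hα with h | h
    · exact h
    · rcases hA β hβ with h' | h' <;> linarith
  have hβ' : β = y := by
    rcases hA β hβ with h | h
    · linarith
    · exact h
  set φ : ℝ := ((i : ℕ) - j : ℝ) * aperture (4 * k + 2) with hφ
  have hcoord : ∀ d : ℂ, c * d / bisectorDir (4 * k + 2) i = d * Complex.exp ((φ : ℂ) * I) := by
    intro d
    rw [hc, mul_assoc, I_mul_div_bisectorDir, mul_comm (Complex.exp _) d, mul_assoc,
      ← Complex.exp_add]
    congr 2
    rw [hφ]; push_cast; ring
  have hwcoord : coneCoord (4 * k + 2) i u w = a * Complex.exp ((φ : ℂ) * I) := by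
    rw [coneCoord, hw, hcoord]
  have hxcoord : coneCoord (4 * k + 2) i u x = b * Complex.exp ((φ : ℂ) * I) := by
    rw [coneCoord, hx, hcoord]
  -- the rotation is trivial
  have hwc' : |(a * Complex.exp ((φ : ℂ) * I)).arg| ≤ y := by rw [← hwcoord]; exact hwc
  -- Since a is strictly inside the cone with bisector c, no other cone contains w.
  have hone : Complex.exp ((φ : ℂ) * I) = 1 := by
    set g := (a * Complex.exp ((φ : ℂ) * I)).arg with hg
    have e1 : Complex.exp (((a.arg + φ : ℝ) : ℂ) * I) = Complex.exp ((g : ℂ) * I) := by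
      have h1 := Complex.norm_mul_exp_arg_mul_I (a * Complex.exp ((φ : ℂ) * I))
      rw [norm_mul, Complex.norm_exp_ofReal_mul_I, mul_one, ← hg] at h1
      nth_rewrite 2 [← Complex.norm_mul_exp_arg_mul_I a] at h1
      rw [mul_assoc, ← Complex.exp_add] at h1
      have hn : (‖a‖ : ℂ) ≠ 0 := by exact_mod_cast norm_ne_zero_iff.2 ha
      rw [mul_left_cancel₀ hn h1]
      congr 1; push_cast; ring
    rw [Complex.exp_eq_exp_iff_exists_int] at e1
    obtain ⟨n, hn⟩ := e1
    have e2 : a.arg + φ = g + n * (2 * π) := by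
      have h2 : ((a.arg + φ : ℝ) : ℂ) * I = ((g + n * (2 * π) : ℝ) : ℂ) * I := by
        rw [hn]; push_cast; ring
      exact_mod_cast mul_right_cancel₀ Complex.I_ne_zero h2
    obtain ⟨a1, a2⟩ := abs_lt.1 haa
    obtain ⟨g1, g2⟩ := abs_le.1 hwc'
    have e3 : g - a.arg = (((i : ℕ) : ℝ) - j - n * (4 * k + 2)) * (2 * y) := by
      rw [hφ, hap, ← hyk] at e2; linarith
    have b1 : (((i : ℕ) : ℝ) - j - n * (4 * k + 2)) < 1 := by
      by_contra hcon
      have := mul_le_mul_of_nonneg_right (not_lt.1 hcon) (by linarith : 0 ≤ 2 * y)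
      linarith
    have b2 : -1 < (((i : ℕ) : ℝ) - j - n * (4 * k + 2)) := by
      by_contra hcon
      have := mul_le_mul_of_nonneg_right (not_lt.1 hcon) (by linarith : 0 ≤ 2 * y)
      linarith
    have c1 : ((i : ℕ) : ℤ) - j - n * (4 * k + 2) < 1 := by exact_mod_cast b1
    have c2 : -1 < ((i : ℕ) : ℤ) - j - n * (4 * k + 2) := by exact_mod_cast b2
    have c3 : ((i : ℕ) : ℤ) - j - n * (4 * k + 2) = 0 := by omega
    have c4 : ((i : ℕ) : ℝ) - j - n * (4 * k + 2) = 0 := by exact_mod_cast c3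
    rw [Complex.exp_eq_one_iff]
    refine ⟨n, ?_⟩
    have : φ = n * (2 * π) := by
      rw [c4, zero_mul] at e3; linarith
    rw [this]; push_cast; ring
  rw [hone, mul_one] at hwcoord hxcoord
  have hadj : (visibilityGraph (⊥ : SimpleGraph P)).Adj u x :=
    ⟨hux, Or.inr fun a b hab => absurd hab (by simp)⟩
  have := hmin x ⟨by change |(coneCoord (4 * k + 2) i u x).arg| ≤ y; rw [hxcoord]; exact hba,
    by rw [hxcoord, hα', hβ']; exact abs_le.1 hba⟩ hadj
  rw [hwcoord, hxcoord] at this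
  linarith

theorem dist_le_walkLength {P : Finset ℂ} {G : SimpleGraph P} {u v : P} (p : G.Walk u v) :
    dist (u : ℂ) v ≤ walkLength p := by
  induction p with
  | nil => simp [walkLength]
  | @cons u v w h p ih =>
    refine (dist_triangle (u : ℂ) v w).trans ?_
    simp only [walkLength, SimpleGraph.Walk.darts_cons, List.map_cons, List.sum_cons] at ih ⊢
    exact add_le_add le_rfl ih

theorem exists_adj_le_walkLength {P : Finset ℂ} {G : SimpleGraph P} {u w : P} (p : G.Walk u w)
    (huw : u ≠ w) : ∃ v, G.Adj u v ∧ dist (u : ℂ) v + dist (v : ℂ) w ≤ walkLength p := by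
  cases p with
  | nil => exact absurd rfl huw
  | @cons _ v _ h p =>
    refine ⟨v, h, ?_⟩
    simp only [walkLength, SimpleGraph.Walk.darts_cons, List.map_cons, List.sum_cons]
    exact add_le_add le_rfl (dist_le_walkLength p)

/-- The half-turn z ↦ a − z swaps 0 with a and b with a − b, so neither end has an arc to the other.
A path from u must start at b or a − b, and either detour is at least ‖b‖ + ‖a − b‖ long. -/
theorem parallelogram_not_isSpanner {k : ℕ} (hk : 1 ≤ k) {a b : ℂ} {t : ℝ} (hab : det a b ≠ 0)
    (haa : |a.arg| < aperture (4 * k + 2) / 2) (hba : |b.arg| ≤ aperture (4 * k + 2) / 2)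
    (hre : b.re < a.re) (ht : t * ‖a‖ < ‖b‖ + ‖a - b‖) :
    ¬ IsSpanner t (constrainedThetaGraph (4 * k + 2) (⊥ : SimpleGraph (parallelogram a b)))
      (visibilityGraph (⊥ : SimpleGraph (parallelogram a b))) := by
  rintro ⟨-, hsp⟩
  have ha : a ≠ 0 := by rintro rfl; exact hab (by simp [det])
  have hb : b ≠ 0 := by rintro rfl; exact hab (by simp [det])
  set P := parallelogram a b with hP
  let u : P := ⟨I * 0, mem_parallelogram.2 (by simp)⟩
  let w : P := ⟨I * a, mem_parallelogram.2 (by simp)⟩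
  let x : P := ⟨I * b, mem_parallelogram.2 (by simp)⟩
  let x' : P := ⟨I * (a - b), mem_parallelogram.2 (by simp)⟩
  have huv : ∀ {c d : ℂ} {hc : I * c ∈ P} {hd : I * d ∈ P}, c ≠ d →
      (⟨I * c, hc⟩ : P) ≠ ⟨I * d, hd⟩ := fun h e =>
    h (mul_left_cancel₀ Complex.I_ne_zero (congrArg Subtype.val e))
  have hnadj : ¬ (constrainedThetaGraph (4 * k + 2) (⊥ : SimpleGraph P)).Adj u w := by
    rintro (h | h)
    · refine not_thetaArc (x := x) (c := I) hk 0 (by simp) (a := a) (b := b) ?_ ?_ ha haa hba hre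
        (huv hb.symm) h
      · simp [w]
      · simp [x]
    · refine not_thetaArc (x := x') (c := -I) hk (2 * k + 1) ?_ (a := a) (b := b) ?_ ?_ ha haa hba
        hre (huv fun e => hb (by linear_combination e)) h
      · have e : (((2 * k + 1 : ℤ) : ℝ) * aperture (4 * k + 2)) = π := by
          have := half_aperture k; push_cast; linarith
        rw [e, Complex.exp_neg, Complex.exp_pi_mul_I]; simp
      · simp [u]
      · simp only [x']; ring
  have hvis : (visibilityGraph (⊥ : SimpleGraph P)).Adj u w :=
    ⟨huv ha.symm, Or.inr fun a b hab => absurd hab (by simp)⟩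
  have hup := (Reach.of_adj hvis).graphDist_le
  have hlow : ENNReal.ofReal (‖b‖ + ‖a - b‖) ≤
      graphDist (constrainedThetaGraph (4 * k + 2) (⊥ : SimpleGraph P)) u w := by
    refine le_iInf fun p => ENNReal.ofReal_le_ofReal ?_
    have hlen : ∀ v : P, (constrainedThetaGraph (4 * k + 2) (⊥ : SimpleGraph P)).Adj u v →
        ‖b‖ + ‖a - b‖ ≤ dist (u : ℂ) v + dist (v : ℂ) w := by
      intro v hv
      have h0 : (u : ℂ) = 0 := mul_zero I
      rcases mem_parallelogram.1 v.2 with h | h | h | h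
      · exact absurd (Subtype.ext h : v = u) hv.ne'
      · exact absurd ((Subtype.ext h : v = w) ▸ hv) hnadj
      · have e : dist (I * b) (I * a) = ‖a - b‖ := by
          rw [dist_eq_norm, ← mul_sub, norm_mul, Complex.norm_I, one_mul, norm_sub_rev]
        change _ ≤ dist _ _ + dist _ (I * a)
        rw [h, h0, dist_zero_left, e, norm_mul, Complex.norm_I, one_mul]
      · have e : dist (I * (a - b)) (I * a) = ‖b‖ := by
          rw [dist_eq_norm, ← mul_sub, norm_mul, Complex.norm_I, one_mul, sub_sub_cancel_left,
            norm_neg]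
        change _ ≤ dist _ _ + dist _ (I * a)
        rw [h, h0, dist_zero_left, e, norm_mul, Complex.norm_I, one_mul, add_comm]
    obtain ⟨v, hv, hvp⟩ := exists_adj_le_walkLength p (huv ha.symm)
    exact (hlen v hv).trans hvp
  have h1 := hlow.trans ((hsp u w).trans (mul_le_mul_right hup _))
  rw [← ENNReal.ofReal_mul' dist_nonneg] at h1
  have hd : dist (u : ℂ) w = ‖a‖ := by
    change dist (I * 0) (I * a) = ‖a‖
    rw [mul_zero, dist_zero_left, norm_mul, Complex.norm_I, one_mul]
  rw [hd] at h1
  refine absurd h1 (not_le.2 ((ENNReal.ofReal_lt_ofReal_iff ?_).2 ht))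
  have := norm_pos_iff.2 hb
  have := norm_nonneg (a - b)
  linarith

open Filter Topology in
-- Take a of height 1 and slope ρ·tan y, and b equal to ρ times the conjugate of a. For ρ < 1 both
-- are strictly inside the cone and b is lower; as ρ → 1 they tend to the two corners of a canonical
-- triangle. The rest is to keep the four directions off odd multiples of y.
theorem exists_not_isSpanner {k : ℕ} (hk : 1 ≤ k) {t : ℝ}
    (ht : t < 1 + 2 * Real.sin (aperture (4 * k + 2) / 2)) :
    ∃ P : Finset ℂ, GeneralPosition (4 * k + 2) P ∧
      ¬ IsSpanner t (constrainedThetaGraph (4 * k + 2) (⊥ : SimpleGraph P))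
        (visibilityGraph (⊥ : SimpleGraph P)) := by
  obtain ⟨hy0, hy6⟩ := half_aperture_bounds hk
  have hyk := half_aperture k
  set y := aperture (4 * k + 2) / 2 with hy
  have hpi := Real.pi_pos
  have hy2 : y < π / 2 := by linarith
  have hc : 0 < Real.cos y := Real.cos_pos_of_mem_Ioo ⟨by linarith, hy2⟩
  have hs : 0 < Real.sin y := Real.sin_pos_of_pos_of_lt_pi hy0 (by linarith)
  have hT : 0 < Real.tan y := Real.tan_pos_of_pos_of_lt_pi_div_two hy0 hy2
  have hTc : Real.tan y * Real.cos y = Real.sin y := Real.tan_mul_cos hc.ne'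
  have hsc := Real.sin_sq_add_cos_sq y
  set T := Real.tan y with hTdef
  set s := Real.sin y with hsdef
  set c := Real.cos y with hcdef
  have h2y : 0 < Real.sin (2 * y) := Real.sin_pos_of_pos_of_lt_pi (by linarith) (by linarith)
  -- conditions on the parameter that hold near `1`
  have C1 : ∀ᶠ ρ in 𝓝[<] (1 : ℝ),
      0 < (2 * ρ - 1) * Real.sin (3 * y) - ρ * (1 + 2 * ρ) * T * Real.cos (3 * y) := by
    refine (ContinuousAt.eventually_lt continuousAt_const (by fun_prop) ?_).filter_mono
      nhdsWithin_le_nhds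
    rw [Real.sin_three_mul, Real.cos_three_mul, ← hsdef, ← hcdef]
    -- At ρ = 1 the inequality reads sin 3y > 3 tan y cos 3y; it keeps the direction 2b − a above
    -- the angle −3y.
    have e : (2 * 1 - 1) * (3 * s - 4 * s ^ 3) - 1 * (1 + 2 * 1) * T * (4 * c ^ 3 - 3 * c) =
        8 * s ^ 3 := by
      linear_combination (-3 * (4 * c ^ 2 - 3)) * hTc - 12 * s * hsc
    rw [e]; positivity
  -- This puts a − b at an angle greater than π/2 − 2y, strictly inside the k-th cone.
  have C2 : ∀ᶠ ρ in 𝓝[<] (1 : ℝ),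
      0 < ρ * (1 + ρ) * T * Real.sin (2 * y) - (1 - ρ) * Real.cos (2 * y) := by
    refine (ContinuousAt.eventually_lt continuousAt_const (by fun_prop) ?_).filter_mono
      nhdsWithin_le_nhds
    have := mul_pos hT h2y
    linarith
  -- In the limit the detour is 1/cos y + 2 tan y against a distance of 1/cos y.
  have C3 : ∀ᶠ ρ in 𝓝[<] (1 : ℝ), t * √(1 ^ 2 + (ρ * T) ^ 2) <
      √(ρ ^ 2 + (-(ρ ^ 2 * T)) ^ 2) + √((1 - ρ) ^ 2 + (ρ * T + ρ ^ 2 * T) ^ 2) := by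
    refine (ContinuousAt.eventually_lt (by fun_prop) (by fun_prop) ?_).filter_mono
      nhdsWithin_le_nhds
    have e1 : √(1 ^ 2 + (1 * T) ^ 2) = 1 / c := by
      rw [Real.sqrt_eq_iff_mul_self_eq (by positivity) (by positivity)]
      field_simp
      linear_combination hsc + (T * c + s) * hTc
    have e2 : √(1 ^ 2 + (-(1 ^ 2 * T)) ^ 2) = 1 / c := by
      rw [← e1]; congr 1; ring
    have e3 : √((1 - 1) ^ 2 + (1 * T + 1 ^ 2 * T) ^ 2) = 2 * T := by
      rw [Real.sqrt_eq_iff_mul_self_eq (by positivity) (by positivity)]; ring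
    rw [e1, e2, e3]
    have e4 : 1 / c + 2 * T = (1 + 2 * s) * (1 / c) := by rw [← hTc]; field_simp
    rw [e4]
    exact mul_lt_mul_of_pos_right ht (by positivity)
  have C4 : ∀ᶠ ρ in 𝓝[<] (1 : ℝ), ρ < 1 := self_mem_nhdsWithin
  have C5 : ∀ᶠ ρ in 𝓝[<] (1 : ℝ), 1 / 2 < ρ :=
    (eventually_gt_nhds (by norm_num : (1 / 2 : ℝ) < 1)).filter_mono nhdsWithin_le_nhds
  obtain ⟨ρ, ⟨⟨⟨c1, c2⟩, c3⟩, c4⟩, c5⟩ := ((((C1.and C2).and C3).and C4).and C5).exists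
  have hρ : 0 < ρ := by linarith
  let a : ℂ := ⟨1, ρ * T⟩
  let b : ℂ := ⟨ρ, -(ρ ^ 2 * T)⟩
  have hab : det a b ≠ 0 := by
    have e : det a b = -(2 * ρ ^ 2 * T) := by simp only [det, a, b]; ring
    rw [e]; have : 0 < 2 * ρ ^ 2 * T := by positivity
    linarith
  have ha0 : a ≠ 0 := by rintro h; rw [h] at hab; exact hab (by simp [det])
  have hb0 : b ≠ 0 := by rintro h; rw [h] at hab; exact hab (by simp [det])
  have hsmall : ∀ z : ℂ, 0 < z.re → |z.im| < T * z.re → |z.arg| < y := by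
    intro z hz hzi
    have hmem : y ∈ Set.Ioo (-(π / 2)) (π / 2) := ⟨by linarith, hy2⟩
    have hmem' : -y ∈ Set.Ioo (-(π / 2)) (π / 2) := ⟨by linarith, by linarith⟩
    obtain ⟨h1, h2⟩ := abs_lt.1 hzi
    rw [abs_lt, ← Real.strictMonoOn_tan.lt_iff_lt hmem' (arg_mem_of_re_pos hz),
      ← Real.strictMonoOn_tan.lt_iff_lt (arg_mem_of_re_pos hz) hmem, Complex.tan_arg,
      Real.tan_neg, div_lt_iff₀ hz, lt_div_iff₀ hz, neg_mul]
    exact ⟨h1, h2⟩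
  have haa : |a.arg| < y := by
    refine hsmall a one_pos ?_
    simp only [a]
    rw [abs_of_pos (by positivity)]; nlinarith
  have hba : |b.arg| < y := by
    refine hsmall b hρ ?_
    simp only [b]
    rw [abs_neg, abs_of_pos (by positivity)]
    have := mul_pos hρ hT
    nlinarith
  have hgen : ∀ z : ℂ, z ≠ 0 → |z.arg| < y → Generic (4 * k + 2) (I * z) := by
    intro z hz hzy
    obtain ⟨h1, h2⟩ := abs_lt.1 hzy
    exact generic_of_arg hy hz (odd_mul_ne_of_mem hy0 0 (by push_cast; linarith)
      (by push_cast; linarith))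
  have hsin : ∀ (z : ℂ) (φ : ℝ), ‖z‖ * Real.sin (z.arg + φ) =
      z.im * Real.cos φ + z.re * Real.sin φ := by
    intro z φ
    rw [Real.sin_add]
    linear_combination Real.sin φ * Complex.norm_mul_cos_arg z
      + Real.cos φ * Complex.norm_mul_sin_arg z
  have hgc : Generic (4 * k + 2) (I * (a - b)) := by
    have hre : (a - b).re = 1 - ρ := rfl
    have him : (a - b).im = ρ * T + ρ ^ 2 * T := by simp only [Complex.sub_im, a, b]; ring
    have hz : a - b ≠ 0 := by
      intro h; rw [h, Complex.zero_re] at hre; linarith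
    obtain ⟨h1, h2⟩ := arg_mem_of_re_pos (show 0 < (a - b).re by rw [hre]; linarith)
    have h3 : 0 < Real.sin ((a - b).arg + (2 * y - π / 2)) := by
      have := hsin (a - b) (2 * y - π / 2)
      rw [Real.cos_sub_pi_div_two, Real.sin_sub_pi_div_two, hre, him] at this
      refine (mul_pos_iff_of_pos_left (norm_pos_iff.2 hz)).1 ?_
      rw [this]; linarith
    refine generic_of_arg hy hz (odd_mul_ne_of_mem hy0 k ?_ (by push_cast; linarith))
    push_cast
    by_contra hcon
    have := Real.sin_nonpos_of_nonpos_of_neg_pi_le (x := (a - b).arg + (2 * y - π / 2))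
      (by linarith) (by linarith)
    linarith
  have hgd : Generic (4 * k + 2) (I * (2 * b - a)) := by
    have hre : (2 * b - a).re = 2 * ρ - 1 := by simp [a, b]
    have him : (2 * b - a).im = -(ρ * (1 + 2 * ρ) * T) := by simp [a, b]; ring
    have hz : 2 * b - a ≠ 0 := by
      intro h; rw [h, Complex.zero_re] at hre; linarith
    obtain ⟨h1, h2⟩ := arg_mem_of_re_pos (show 0 < (2 * b - a).re by rw [hre]; linarith)
    have h3 : 0 < Real.sin ((2 * b - a).arg + 3 * y) := by
      have := hsin (2 * b - a) (3 * y)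
      rw [hre, him] at this
      refine (mul_pos_iff_of_pos_left (norm_pos_iff.2 hz)).1 ?_
      rw [this]; linarith
    have h4 : Real.sin ((2 * b - a).arg + y) < 0 := by
      have := hsin (2 * b - a) y
      rw [hre, him] at this
      refine neg_of_mul_neg_right (a := ‖2 * b - a‖) ?_ (norm_nonneg _)
      rw [this]
      have e : -(ρ * (1 + 2 * ρ) * T) * Real.cos y + (2 * ρ - 1) * Real.sin y =
          -(s * (2 * ρ ^ 2 - ρ + 1)) := by
        linear_combination (-(ρ * (1 + 2 * ρ))) * hTc
      rw [e]
      have := mul_pos hs (by nlinarith : 0 < 2 * ρ ^ 2 - ρ + 1)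
      linarith
    refine generic_of_arg hy hz (odd_mul_ne_of_mem hy0 (-1) ?_ ?_)
    · push_cast
      by_contra hcon
      have := Real.sin_nonpos_of_nonpos_of_neg_pi_le (x := (2 * b - a).arg + 3 * y)
        (by linarith) (by linarith)
      linarith
    · push_cast
      by_contra hcon
      have := Real.sin_nonneg_of_nonneg_of_le_pi (x := (2 * b - a).arg + y)
        (by linarith) (by linarith)
      linarith
  refine ⟨parallelogram a b, parallelogram_generalPosition hab (hgen a ha0 haa) (hgen b hb0 hba)
    hgc hgd, parallelogram_not_isSpanner hk hab haa hba.le c4 ?_⟩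
  have hnorm : ∀ z : ℂ, ‖z‖ = √(z.re ^ 2 + z.im ^ 2) := by
    intro z
    rw [Complex.norm_def, Complex.normSq_apply]; congr 1; ring
  rw [hnorm a, hnorm b, hnorm (a - b)]
  have him : (a - b).im = ρ * T + ρ ^ 2 * T := by simp only [Complex.sub_im, a, b]; ring
  rw [him]
  exact c3

end ConstrainedTheta

theorem mainTheorem1 (k : ℕ) (hk : 1 ≤ k) (θ : ℝ) (hθ : θ = 2 * π / (4 * (k : ℝ) + 2)) :
    (∀ (P : Finset ℂ) (S : SimpleGraph P),
      ConstrainedTheta.GeneralPosition (4 * k + 2) P → ConstrainedTheta.IsPlanar S →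
      ConstrainedTheta.IsSpanner (1 + 2 * Real.sin (θ / 2))
        (ConstrainedTheta.constrainedThetaGraph (4 * k + 2) S)
        (ConstrainedTheta.visibilityGraph S)) ∧
    (∀ t : ℝ, t < 1 + 2 * Real.sin (θ / 2) →
      ∃ P : Finset ℂ, ConstrainedTheta.GeneralPosition (4 * k + 2) P ∧
        ¬ ConstrainedTheta.IsSpanner t
          (ConstrainedTheta.constrainedThetaGraph (4 * k + 2) (⊥ : SimpleGraph P))
          (ConstrainedTheta.visibilityGraph (⊥ : SimpleGraph P))) := by
  have hap : ConstrainedTheta.aperture (4 * k + 2) = θ := by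
    rw [hθ, ConstrainedTheta.aperture]; push_cast; rfl
  rw [← hap]
  exact ⟨fun _ _ hP hS => ConstrainedTheta.constrainedThetaGraph_isSpanner hk hP hS,
    fun _ ht => ConstrainedTheta.exists_not_isSpanner hk ht⟩
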